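/- **Model.** Let $(b_i)_{i\ge1},(h_i)_{i\ge1},(\sigma_{p,i})_{i\ge1},(\sigma_{f,i})_{i\ge1}$ be sequences of positive reals and $(\theta_i)_{i\ge1}$ a real sequence; put $\tilde b_i=b_i/(b_i+h_i)$. $N(\mu,\sigma)$ denotes the normal law with mean $\mu$ and variance $\sigma$; $\phi,\Phi$ are the standard normal density and distribution function; $G(w,\beta)=\phi(w)+w\Phi(w)-\beta w$, and $G'$ is its derivative in $w$; $H_k$ is the $k$-th probabilists' Hermite polynomial; $x^+=\max(x,0)$. For each $n$ one observes $X=(X_1,\dots,X_n)$ with independent $X_i\sim N(\theta_i,\sigma_{p,i})$, and $\bar X=n^{-1}\sum_{i\le n}X_i$. The loss of a prediction $q\in\mathbb R^n$ is $$L_n(\theta,q)=\frac1n\sum_{i=1}^n \mathbb E_{Y\sim N(\theta_i,\sigma_{f,i})}\big[b_i(Y-q_i)^++h_i(q_i-Y)^+\big].$$ For $\tau\in[0,\infty]$ let $\alpha_i(\tau)=\tau/(\tau+\sigma_{p,i})$ (with $\alpha_i(\infty)=1$), and let $\hat q^G(\tau)$ be the grand-mean-centric rule $$\hat q_i^G(\tau)=\alpha_i(\tau)X_i+(1-\alpha_i(\tau))\bar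 X+\sqrt{\sigma_{f,i}+\alpha_i(\tau)\sigma_{p,i}}\;\Phi^{-1}(\tilde b_i).$$ **Assumptions.** A1: $0<\inf_i\tilde b_i\le\sup_i\tilde b_i<1$ and $\sup_i(b_i+h_i)<\infty$. A2: $\limsup_{n}\frac1n\sum_{i=1}^n|\theta_i|<\infty$. A3: $\sup_i\sigma_{p,i}/\sigma_{f,i}<1/(4e)$, $\sup_i\sigma_{f,i}<\infty$ and $\inf_i\sigma_{p,i}>0$. **Risk estimate.** Fix constants $\gamma(i)$ with $\inf_i\gamma(i)>0$ and $\gamma(i)<1/\sqrt{4e}-\sqrt{\sigma_{p,i}/\sigma_{f,i}}$ for all $i$. Put $\lambda_n(i)=\gamma(i)\sqrt{2\log n}$, $K_n(i)=1+\big\lceil e^2\big(\gamma(i)+\sqrt{2\sigma_{p,i}/\sigma_{f,i}}\big)^2\,2\log n\big\rceil$, and $$c_i(\tau)=\sqrt{\frac{\sigma_{f,i}+\alpha_i(\tau)\sigma_{p,i}}{\sigma_{f,i}+\alpha_i(\tau)^2\sigma_{p,i}}}\;\Phi^{-1}(\tilde b_i),\qquad d_i(\tau)=-\frac{1-\alpha_i(\tau)}{\sqrt{\sigma_{f,i}+\sigma_{p,i}\alpha_i(\tau)^2}}.$$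 With $v=2\sigma_{p,i}d_i(\tau)^2$ let $$S_i(u)=G(0,\tilde b_i)+G'(0,\tilde b_i)u+\phi(0)\sum_{k=0}^{K_n(i)-2}\frac{(-1)^kH_k(0)}{(k+2)!}\,v^{(k+2)/2}H_{k+2}\big(u/\sqrt v\big)$$ (where $v^{k/2}H_{k}(u/\sqrt v)$ means its limit $u^{k}$ if $v=0$), and $\tilde S_i(u)=\operatorname{sign}(S_i(u))\min\{|S_i(u)|,n\}$. For $x,z\in\mathbb R$ put $U=c_i(\tau)+d_i(\tau)(x+\sqrt{\sigma_{p,i}}\,z)$, $V=c_i(\tau)+d_i(\tau)(x-\sqrt{\sigma_{p,i}}\,z)$, and let $\hat T_i(x,z,\tau)$ be $-\tilde b_iU$ if $V<-\lambda_n(i)$, $\tilde S_i(U)$ if $|V|\le\lambda_n(i)$, and $(1-\tilde b_i)U$ if $V>\lambda_n(i)$. Let $\hat T_i(x,\tau)=\mathbb E_{Z\sim N(0,1)}\hat T_i(x,Z,\tau)$ and, for $x\in\mathbb R^n$, $$\mathrm{ARE}_n(\tau,x)=\frac1n\sum_{i=1}^n(b_i+h_i)\sqrt{\sigma_{f,i}+\sigma_{p,i}\alpha_i(\tau)^2}\;\hat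 T_i(x_i,\tau),\qquad \mathrm{ARE}^G_n(\tau)=\mathrm{ARE}_n(\tau,X-\bar X),$$ where $\bar X$ is subtracted from every coordinate. **Grid.** Let $a_n=\log\log n$ and let $C_1,\dots,C_4$ be constants, not depending on $n$, with $\sup_i(b_i+h_i)\le C_1$; $\sup_i\sigma_{p,i}\le C_2$ and $\sup_i\sigma_{p,i}^{-1}\le C_2$; $\sup_i(\sigma_{p,i}/\sigma_{f,i})\cdot\sup_i|\Phi^{-1}(\tilde b_i)|\le C_3$; and $\frac1n\sum_{i\le n}|\theta_i|\le C_4\sqrt{a_n}$ for all large $n$. Put $\delta_n=\{2C_1C_2(2\phi(0)+C_3+\sqrt{a_n}\,C_4+a_n)\}^{-1}$, and let $\Lambda_n$ be the set of all $\tau\in[0,\infty]$ with $\tau/(\tau+1)=(j-1)\delta_n$ for some $1\le j\le\lceil1/\delta_n\rceil$ (for $n$ so large that $a_n>0$). **Theorem.** Under A1, A2 and A3, for all $\gamma$ and $C_1,\dots,C_4$ as above, $$\lim_{n\to\infty}\mathbb E\Big[\sup_{\tau\in\Lambda_n}\big|\mathrm{ARE}^G_n(\tau)-L_n(\theta,\hat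 q^G(\tau))\big|\Big]=0 .$$ -/

import Mathlib

open MeasureTheory ProbabilityTheory Filter Topology
open scoped NNReal ENNReal

noncomputable section

namespace CheckLoss

/-! ### The standard normal law and the function `G` -/

/-- The standard normal density. -/
def stdPdf (w : ℝ) : ℝ := gaussianPDFReal 0 1 w

/-- The standard normal distribution function. -/
def stdCdf (w : ℝ) : ℝ := cdf (gaussianReal 0 1) w

/-- The standard normal quantile function; it is the inverse of `stdCdf` on `(0, 1)`. -/
def stdQuantile (p : ℝ) : ℝ := sInf {w : ℝ | p ≤ stdCdf w}

/-- `G(w, β) = φ(w) + w Φ(w) - β w`. -/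
def G (w β : ℝ) : ℝ := stdPdf w + w * stdCdf w - β * w

/-! ### The prediction model -/

/-- The known quantities of the model: the weights `b i`, `h i` of the check loss and the
variances `σp i`, `σf i` of the past and the future observation in each coordinate.
Coordinates are numbered from `0`; the `n`-dimensional problem uses those with `i < n`. -/
structure Model where
  b : ℕ → ℝ
  h : ℕ → ℝ
  σp : ℕ → ℝ≥0
  σf : ℕ → ℝ≥0
  b_pos : ∀ i, 0 < b i
  h_pos : ∀ i, 0 < h i
  σp_pos : ∀ i, 0 < σp i
  σf_pos : ∀ i, 0 < σf i

namespace Model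

variable (M : Model)

/-- The critical ratio `b / (b + h)`. -/
def ratio (i : ℕ) : ℝ := M.b i / (M.b i + M.h i)

/-- The law `N(θ, Σp)` of the past data `(X_0, …, X_{n-1})`, with independent coordinates. -/
def pastLaw (θ : ℕ → ℝ) (n : ℕ) : Measure (Fin n → ℝ) :=
  Measure.pi fun i : Fin n => gaussianReal (θ i) (M.σp i)

/-- The predictive loss of coordinate `i`: the mean check loss of the prediction `q` for
`Y ~ N(t, σf i)`. -/
def coordLoss (i : ℕ) (t q : ℝ) : ℝ :=
  ∫ y, (M.b i * max (y - q) 0 + M.h i * max (q - y) 0) ∂(gaussianReal t (M.σf i))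

/-- The cumulative predictive loss `L_n(θ, q)`. -/
def loss (n : ℕ) (θ : ℕ → ℝ) (q : Fin n → ℝ) : ℝ :=
  (1 / (n : ℝ)) * ∑ i : Fin n, M.coordLoss i (θ i) (q i)

/-- The shrinkage factor `α_i(τ) = τ / (τ + σp i)` for `τ ∈ [0, ∞]`, equal to `1` at `τ = ∞`. -/
def shrink (i : ℕ) (τ : ℝ≥0∞) : ℝ :=
  if τ = ⊤ then 1 else τ.toReal / (τ.toReal + M.σp i)

/-- The average of the coordinates of `x`. -/
def _root_.CheckLoss.mean {n : ℕ} (x : Fin n → ℝ) : ℝ := (1 / (n : ℝ)) * ∑ i, x i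

/-- The rule in the class of grand-mean-centric shrinkage rules with hyperparameter `τ`. -/
def grandMeanRule (n : ℕ) (τ : ℝ≥0∞) (x : Fin n → ℝ) (i : Fin n) : ℝ :=
  M.shrink i τ * x i + (1 - M.shrink i τ) * mean x
    + √(M.σf i + M.shrink i τ * M.σp i) * stdQuantile (M.ratio i)

/-! ### The asymptotic risk estimate -/

/-- `c_i(τ)`, the intercept of the linear argument of `G` in the risk of coordinate `i`. -/
def c (i : ℕ) (τ : ℝ≥0∞) : ℝ :=
  √((M.σf i + M.shrink i τ * M.σp i) / (M.σf i + M.shrink i τ ^ 2 * M.σp i))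
    * stdQuantile (M.ratio i)

/-- `d_i(τ)`, the slope of the linear argument of `G` in the risk of coordinate `i`. -/
def d (i : ℕ) (τ : ℝ≥0∞) : ℝ :=
  -(1 - M.shrink i τ) / √(M.σf i + M.σp i * M.shrink i τ ^ 2)

/-- `v ^ (k / 2) * H_k (u / √v)` with the probabilists' Hermite polynomial `H_k`, extended to
`v = 0` by its limit `u ^ k`. -/
def _root_.CheckLoss.scaledHermite (k : ℕ) (v u : ℝ) : ℝ :=
  if v = 0 then u ^ k else √v ^ k * Polynomial.aeval (u / √v) (Polynomial.hermite k)

/-- The threshold `λ_n(i) = γ(i) √(2 log n)`. -/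
def _root_.CheckLoss.threshold (γ : ℕ → ℝ) (n i : ℕ) : ℝ := γ i * √(2 * Real.log n)

/-- The truncation order `K_n(i)`. -/
def order (γ : ℕ → ℝ) (n i : ℕ) : ℕ :=
  1 + ⌈Real.exp 1 ^ 2 * (γ i + √(2 * M.σp i / M.σf i)) ^ 2 * (2 * Real.log n)⌉₊

/-- `S_i(u)`, the unbiased estimate of the Taylor polynomial of order `K_n(i)` of `G(·, b̃_i)`;
the sum runs over `0 ≤ k ≤ K_n(i) - 2`. -/
def S (γ : ℕ → ℝ) (n i : ℕ) (τ : ℝ≥0∞) (u : ℝ) : ℝ :=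
  G 0 (M.ratio i) + deriv (fun w => G w (M.ratio i)) 0 * u
    + stdPdf 0 * ∑ k ∈ Finset.range (M.order γ n i - 1),
        ((-1) ^ k * Polynomial.aeval (0 : ℝ) (Polynomial.hermite k) / (k + 2).factorial)
          * scaledHermite (k + 2) (2 * M.σp i * M.d i τ ^ 2) u

/-- `S_i(u)` truncated to `[-n, n]`. -/
def truncS (γ : ℕ → ℝ) (n i : ℕ) (τ : ℝ≥0∞) (u : ℝ) : ℝ :=
  Real.sign (M.S γ n i τ u) * min |M.S γ n i τ u| n

/-- The randomized threshold estimate `T_i(x, z, τ)`. -/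
def randT (γ : ℕ → ℝ) (n i : ℕ) (x z : ℝ) (τ : ℝ≥0∞) : ℝ :=
  let U := M.c i τ + M.d i τ * (x + √(M.σp i) * z)
  let V := M.c i τ + M.d i τ * (x - √(M.σp i) * z)
  if V < -threshold γ n i then -M.ratio i * U
  else if V ≤ threshold γ n i then M.truncS γ n i τ U
  else (1 - M.ratio i) * U

/-- The estimate `T_i(x, τ)`: the mean of the randomized estimate over the added noise
`Z ~ N(0, 1)`. -/
def T (γ : ℕ → ℝ) (n i : ℕ) (x : ℝ) (τ : ℝ≥0∞) : ℝ :=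
  ∫ z, M.randT γ n i x z τ ∂(gaussianReal 0 1)

/-- The asymptotic risk estimate `ARE_n(τ, x)`. -/
def ARE (γ : ℕ → ℝ) (n : ℕ) (τ : ℝ≥0∞) (x : Fin n → ℝ) : ℝ :=
  (1 / (n : ℝ)) * ∑ i : Fin n,
    (M.b i + M.h i) * √(M.σf i + M.σp i * M.shrink i τ ^ 2) * M.T γ n i (x i) τ

/-- The plug-in estimate `ARE^G_n(τ, x) = ARE_n(τ, x - x̄)`. -/
def AREG (γ : ℕ → ℝ) (n : ℕ) (τ : ℝ≥0∞) (x : Fin n → ℝ) : ℝ :=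
  M.ARE γ n τ fun i => x i - mean x

/-! ### Assumptions -/

/-- Bounded weights of the loss function. -/
def BoundedWeights : Prop :=
  (∃ ε > 0, ∀ i, ε ≤ M.ratio i ∧ M.ratio i ≤ 1 - ε) ∧ ∃ C, ∀ i, M.b i + M.h i ≤ C

/-- Sufficient historical data: `sup σp / σf < 1 / (4e)`, with `sup σf < ∞` and `inf σp > 0`. -/
def SufficientData : Prop :=
  (∃ r < 1 / (4 * Real.exp 1), ∀ i, (M.σp i : ℝ) / M.σf i ≤ r) ∧
    (∃ C : ℝ, ∀ i, (M.σf i : ℝ) ≤ C) ∧ ∃ ε : ℝ, 0 < ε ∧ ∀ i, ε ≤ (M.σp i : ℝ)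

/-- Bounded parametric space: `limsup (1/n) ∑_{i<n} |θ i| < ∞`. -/
def _root_.CheckLoss.BoundedMeans (θ : ℕ → ℝ) : Prop :=
  ∃ C : ℝ, ∀ᶠ n : ℕ in atTop, (1 / (n : ℝ)) * ∑ i ∈ Finset.range n, |θ i| ≤ C

/-- Admissible threshold constants: `γ i < 1/√(4e) - √(σp i / σf i)`, and bounded away
from `0`. -/
def AdmissibleThreshold (γ : ℕ → ℝ) : Prop :=
  (∃ ε > 0, ∀ i, ε ≤ γ i) ∧
    ∀ i, γ i < 1 / √(4 * Real.exp 1) - √((M.σp i : ℝ) / M.σf i)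

/-! ### The grid -/

/-- `a_n = log log n`. -/
def _root_.CheckLoss.a (n : ℕ) : ℝ := Real.log (Real.log n)

/-- The constants that enter the mesh of the grid. -/
structure GridConstants (θ : ℕ → ℝ) (C₁ C₂ C₃ C₄ : ℝ) : Prop where
  weights : ∀ i, M.b i + M.h i ≤ C₁
  variances : ∀ i, (M.σp i : ℝ) ≤ C₂ ∧ (M.σp i : ℝ)⁻¹ ≤ C₂
  quantiles : ∀ i j, (M.σp i : ℝ) / M.σf i * |stdQuantile (M.ratio j)| ≤ C₃
  means : ∀ᶠ n : ℕ in atTop, (1 / (n : ℝ)) * ∑ i ∈ Finset.range n, |θ i| ≤ C₄ * √(a n)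

end Model

/-- The mesh `δ_n` of the grid. -/
def mesh (C₁ C₂ C₃ C₄ : ℝ) (n : ℕ) : ℝ :=
  (2 * C₁ * C₂ * (2 * stdPdf 0 + C₃ + √(a n) * C₄ + a n))⁻¹

/-- The inverse of the transformation `τ ↦ τ / (τ + 1)` from `[0, ∞]` onto `[0, 1]`. -/
def fromUnit (t : ℝ) : ℝ≥0∞ := if t < 1 then ENNReal.ofReal (t / (1 - t)) else ⊤

/-- The grid `Λ_n`: the points of `[0, ∞]` that `τ ↦ τ / (τ + 1)` maps to
`0, δ_n, 2δ_n, …, (m - 1)δ_n`, where `m = ⌈1/δ_n⌉`. -/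
def grid (C₁ C₂ C₃ C₄ : ℝ) (n : ℕ) : Finset ℝ≥0∞ :=
  (Finset.range ⌈1 / mesh C₁ C₂ C₃ C₄ n⌉₊).image
    fun j : ℕ => fromUnit (j * mesh C₁ C₂ C₃ C₄ n)

end CheckLoss

end

/-! For a single τ the mean absolute error is at most C (1 + log n)² n^(-δ) with δ > 0 and C
independent of τ (`exists_lintegral_abs_AREG_sub_loss_le`). The grid has only O(log n) points
(`card_grid_le`), so the supremum can be replaced by the sum over the grid.

Fix τ and write Δ_i = X_i - θ_i. The loss is Lipschitz in the prediction, so the grand mean of the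
data in the rule can be replaced by that of the parameters at the price of a multiple of the
absolute value of the average noise. What remains is an average of terms g_i(Δ_i - mean of Δ), with
g_i the function `lossError`. Three facts control it.

Small bias. When the observation is averaged as well as the added noise, U and V are independent
with a common law N(ω, 2η²), so V chooses the regime without disturbing the estimate made from U. In
the outer regimes G is exponentially close to its linear asymptotes. In the middle regime the
Hermite sum is unbiased for a Taylor polynomial of G, since the scaled H_m is unbiased for ω^m
(`integral_heatPoly`). The Taylor remainder is tiny for |ω| somewhat beyond the threshold, and for
larger |ω| the middle regime is improbable. This gives `abs_integral_thresholdEstimate_sub_G_le`.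

Moderate size. Averaged over the added noise alone, the estimate stays within O(log n · n^(1/10)) of
a check function, whatever the observation (`abs_integral_thresholdEstimate_sub_check_le`). The
Hermite sum grows like exp(U²/2), but on |V| ≤ λ this growth is compensated by a factor exp(-tV²/2),
at the cost exp(tλ²/2). The upper bound on γ keeps that cost below n^(1/10). The actual loss follows
the same check function, so the parameters cancel from the bound on g_i.

Weak dependence. No regularity of g_i is needed. With the other coordinates fixed, subtracting the
grand mean acts on (Δ_i, Δ_j) as a shift and a linear map within O(1/n) of the identity, and that
map alters a Gaussian density by O(1/n) only (`exists_abs_integral_subSum_sub_le`). Hence the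
expectation of g_i g_j is bounded by a product of two bias bounds up to O(B²/n), and the mean square
of the average is of order B²/n + η² + D²/n, where now B bounds the growth, η the bias, and D the
sensitivity to a shift (`exists_integral_sq_average_centred_le`). -/

namespace CheckLoss

/-! ### Gaussian integrals -/

/-- The standard normal law. -/
noncomputable abbrev stdNormal : Measure ℝ := gaussianReal 0 1

lemma integrable_gaussianReal_iff {E : Type*} [NormedAddCommGroup E] [NormedSpace ℝ E]
    {μ : ℝ} {v : ℝ≥0} (hv : v ≠ 0) {f : ℝ → E} :
    Integrable f (gaussianReal μ v) ↔ Integrable fun x => gaussianPDFReal μ v x • f x := by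
  rw [gaussianReal_of_var_ne_zero μ hv, integrable_withDensity_iff_integrable_smul'
    (measurable_gaussianPDF μ v) (ae_of_all _ fun x => gaussianPDF_lt_top)]
  simp only [toReal_gaussianPDF]

/-- Completing the square. With the quadratic coefficient written as (1 - s)/2 the tilted density is
a multiple of that of N(α/s, 1/s), so both integrability and the value of the integral can be read
off. -/
lemma stdPdf_mul_exp_quadratic (α : ℝ) {s : ℝ} (hs : 0 < s) (z : ℝ) :
    gaussianPDFReal 0 1 z * Real.exp (α * z + (1 - s) / 2 * z ^ 2)
      = Real.exp (α ^ 2 / (2 * s)) / √s * gaussianPDFReal (α / s) (Real.toNNReal (1 / s)) z := by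
  have h1 : ((Real.toNNReal (1 / s) : ℝ≥0) : ℝ) = 1 / s := Real.coe_toNNReal _ (by positivity)
  simp only [gaussianPDFReal, h1]
  have h2 : √(2 * Real.pi * (1 / s)) = √(2 * Real.pi) / √s := by
    rw [mul_one_div, Real.sqrt_div (by positivity)]
  have hs' : √s ≠ 0 := (Real.sqrt_pos.2 hs).ne'
  have h3 : √(2 * Real.pi) ≠ 0 := (Real.sqrt_pos.2 (by positivity)).ne'
  rw [h2]
  have h4 : Real.exp (-(z - 0) ^ 2 / (2 * ((1 : ℝ≥0) : ℝ))) * Real.exp (α * z + (1 - s) / 2 * z ^ 2)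
      = Real.exp (α ^ 2 / (2 * s)) * Real.exp (-(z - α / s) ^ 2 / (2 * (1 / s))) := by
    rw [← Real.exp_add, ← Real.exp_add]
    congr 1
    push_cast
    field_simp
    ring
  have h5 : √(2 * Real.pi * ((1 : ℝ≥0) : ℝ)) = √(2 * Real.pi) := by simp
  rw [mul_assoc, h4, h5]
  field_simp

lemma integrable_exp_quadratic (α : ℝ) {s : ℝ} (hs : 0 < s) :
    Integrable (fun z => Real.exp (α * z + (1 - s) / 2 * z ^ 2)) stdNormal := by
  rw [integrable_gaussianReal_iff one_ne_zero]
  simp only [smul_eq_mul, stdPdf_mul_exp_quadratic α hs]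
  exact (integrable_gaussianPDFReal _ _).const_mul _

lemma integral_exp_quadratic (α : ℝ) {s : ℝ} (hs : 0 < s) :
    ∫ z, Real.exp (α * z + (1 - s) / 2 * z ^ 2) ∂stdNormal = Real.exp (α ^ 2 / (2 * s)) / √s := by
  rw [integral_gaussianReal_eq_integral_smul one_ne_zero]
  simp only [smul_eq_mul, stdPdf_mul_exp_quadratic α hs]
  rw [integral_const_mul, integral_gaussianPDFReal_eq_one, mul_one]
  simp [hs]

lemma integrable_pow_gaussianReal (μ : ℝ) (v : ℝ≥0) (n : ℕ) :
    Integrable (fun x => x ^ n) (gaussianReal μ v) := by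
  rcases Nat.eq_zero_or_pos n with rfl | hn
  · simp
  have := (memLp_id_gaussianReal (μ := μ) (v := v) (n : ℝ≥0)).integrable_norm_pow (by
    exact_mod_cast hn.ne')
  refine this.mono (by fun_prop) (ae_of_all _ fun x => ?_)
  simp

lemma integrable_polynomial_gaussianReal {𝕜 : Type*} [RCLike 𝕜] (μ : ℝ) (v : ℝ≥0)
    (p : Polynomial 𝕜) : Integrable (fun x : ℝ => p.eval (x : 𝕜)) (gaussianReal μ v) := by
  simp only [Polynomial.eval_eq_sum, Polynomial.sum]
  refine integrable_finsetSum _ fun i _ => Integrable.const_mul ?_ _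
  have := (integrable_pow_gaussianReal μ v i).ofReal (𝕜 := 𝕜)
  simpa using this

lemma hasDerivAt_stdPdf (x : ℝ) : HasDerivAt stdPdf (-x * stdPdf x) x := by
  unfold stdPdf gaussianPDFReal
  have h : HasDerivAt (fun x : ℝ => -(x - 0) ^ 2 / (2 * ((1 : ℝ≥0) : ℝ))) (-x) x := by
    have := (((hasDerivAt_id x).sub_const 0).pow 2).neg.div_const (2 * ((1 : ℝ≥0) : ℝ))
    exact this.congr_deriv (by simp; ring)
  exact (h.exp.const_mul _).congr_deriv (by ring)

/-- Stein's identity: integration by parts against φ' = -xφ. The real case yields the unbiasedness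
of Hermite polynomials, the complex case their growth bound. -/
lemma integral_mul_polynomial_stdNormal {𝕜 : Type*} [RCLike 𝕜] (p : Polynomial 𝕜) :
    ∫ x : ℝ, (x : 𝕜) * p.eval (x : 𝕜) ∂stdNormal
      = ∫ x : ℝ, p.derivative.eval (x : 𝕜) ∂stdNormal := by
  have key : ∀ q : Polynomial 𝕜, Integrable fun x : ℝ => q.eval (x : 𝕜) * ((stdPdf x : ℝ) : 𝕜) := by
    intro q
    have := (integrable_gaussianReal_iff one_ne_zero).1 (integrable_polynomial_gaussianReal 0 1 q)
    refine this.congr (ae_of_all _ fun x => ?_)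
    simp only [RCLike.real_smul_eq_coe_mul, stdPdf]
    ring
  have h := integral_mul_deriv_eq_deriv_mul_of_integrable (A := 𝕜)
    (u := fun x : ℝ => p.eval (x : 𝕜)) (u' := fun x : ℝ => p.derivative.eval (x : 𝕜))
    (v := fun x : ℝ => ((stdPdf x : ℝ) : 𝕜)) (v' := fun x : ℝ => ((-x * stdPdf x : ℝ) : 𝕜))
    (fun x _ => by
      have h1 := (p.hasDerivAt (x : 𝕜)).scomp_of_eq x (RCLike.ofRealCLM (K := 𝕜)).hasDerivAt (by simp)
      simpa [Function.comp_def] using h1)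
    (fun x _ => by
      exact (RCLike.ofRealCLM (K := 𝕜)).hasFDerivAt.comp_hasDerivAt x (hasDerivAt_stdPdf x))
    (by
      refine ((key (p * Polynomial.X)).neg).congr (ae_of_all _ fun x => ?_)
      simp only [Pi.mul_apply, Pi.neg_apply]
      push_cast
      simp
      ring)
    (key _) (key _)
  rw [integral_gaussianReal_eq_integral_smul one_ne_zero,
    integral_gaussianReal_eq_integral_smul one_ne_zero]
  simp only [RCLike.real_smul_eq_coe_mul]
  have e1 : ∫ x : ℝ, ((gaussianPDFReal 0 1 x : ℝ) : 𝕜) * ((x : 𝕜) * p.eval (x : 𝕜))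
      = -∫ x : ℝ, p.eval (x : 𝕜) * ((-x * stdPdf x : ℝ) : 𝕜) := by
    rw [← integral_neg]
    refine integral_congr_ae (ae_of_all _ fun x => ?_)
    simp only [stdPdf]
    push_cast
    ring
  rw [e1, h, neg_neg]
  refine integral_congr_ae (ae_of_all _ fun x => ?_)
  simp only [stdPdf]
  ring

lemma map_rotation_stdNormal :
    (stdNormal.prod stdNormal).map (fun p : ℝ × ℝ => ((p.1 - p.2) / √2, (p.1 + p.2) / √2))
      = stdNormal.prod stdNormal := by
  have h := IsGaussian.map_rotation_eq_self (μ := stdNormal)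
    (by simp) (-(Real.pi / 4))
  convert h using 2
  ext p
  · simp [ContinuousLinearMap.rotation_apply, Real.cos_neg, Real.sin_neg]
    field_simp
    rw [Real.sq_sqrt (by norm_num)]
    ring
  · simp [ContinuousLinearMap.rotation_apply, Real.cos_neg, Real.sin_neg]
    field_simp
    rw [Real.sq_sqrt (by norm_num)]

/-- Sum and difference of two independent standard normal variables are independent. -/
lemma integral_add_sub_stdNormal {f : ℝ × ℝ → ℝ} (hf : Measurable f) :
    ∫ p : ℝ × ℝ, f (p.1 + p.2, p.1 - p.2) ∂(stdNormal.prod stdNormal)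
      = ∫ p : ℝ × ℝ, f (√2 * p.1, √2 * p.2) ∂(stdNormal.prod stdNormal) := by
  have h2 : √2 ≠ 0 := by positivity
  have hm : Measurable (fun p : ℝ × ℝ => ((p.1 - p.2) / √2, (p.1 + p.2) / √2)) := by fun_prop
  have hsw : (stdNormal.prod stdNormal).map Prod.swap = stdNormal.prod stdNormal :=
    Measure.prod_swap
  -- The rotation produces the difference first, so `f` is read with its arguments exchanged, and
  -- the symmetry of the product law undoes the exchange.
  calc _ = ∫ p : ℝ × ℝ, f (√2 * p.2, √2 * p.1) ∂((stdNormal.prod stdNormal).map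
        (fun p : ℝ × ℝ => ((p.1 - p.2) / √2, (p.1 + p.2) / √2))) := by
        rw [integral_map hm.aemeasurable
          (by apply Measurable.aestronglyMeasurable; fun_prop)]
        simp only [mul_div_cancel₀ _ h2]
    _ = ∫ p : ℝ × ℝ, f (√2 * p.2, √2 * p.1) ∂(stdNormal.prod stdNormal) := by
        rw [map_rotation_stdNormal]
    _ = ∫ p : ℝ × ℝ, f (√2 * p.2, √2 * p.1) ∂((stdNormal.prod stdNormal).map Prod.swap) := by
        rw [hsw]
    _ = _ := by
        rw [integral_map measurable_swap.aemeasurable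
          (by apply Measurable.aestronglyMeasurable; fun_prop)]
        rfl

/-! ### Hermite polynomials -/

open Polynomial in
lemma derivative_hermite_succ (n : ℕ) :
    derivative (hermite (n + 1)) = ((n : ℤ[X]) + 1) * hermite n := by
  induction n with
  | zero => simp
  | succ n ih =>
    rw [hermite_succ (n + 1)]
    simp only [derivative_sub, derivative_mul, derivative_X, ih, one_mul, derivative_add,
      derivative_natCast, derivative_one, zero_add, zero_mul, add_zero]
    rw [hermite_succ n]
    push_cast
    ring

open Polynomial in
lemma hermite_add_two (n : ℕ) :
    hermite (n + 2) = X * hermite (n + 1) - ((n : ℤ[X]) + 1) * hermite n := by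
  rw [hermite_succ (n + 1), derivative_hermite_succ]

/-- The value at `0` of the `k`-th Hermite polynomial. -/
noncomputable def hermiteZero (k : ℕ) : ℝ := Polynomial.aeval (0 : ℝ) (Polynomial.hermite k)

lemma hermiteZero_zero : hermiteZero 0 = 1 := by simp [hermiteZero]

lemma hermiteZero_one : hermiteZero 1 = 0 := by simp [hermiteZero]

lemma hermiteZero_add_two (k : ℕ) : hermiteZero (k + 2) = -((k + 1) * hermiteZero k) := by
  rw [hermiteZero, hermite_add_two]
  simp [hermiteZero]

lemma hermiteZero_odd (j : ℕ) : hermiteZero (2 * j + 1) = 0 := by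
  induction j with
  | zero => exact hermiteZero_one
  | succ j ih => rw [show 2 * (j + 1) + 1 = (2 * j + 1) + 2 by ring, hermiteZero_add_two, ih]; simp

/-- These are the Maclaurin coefficients of exp(-x²/2), which is how the sum in the risk estimate
comes to be a Taylor expansion of φ/φ(0) = G''/φ(0). -/
lemma hermiteZero_even (j : ℕ) :
    hermiteZero (2 * j) / (2 * j).factorial = (-1 / 2) ^ j / j.factorial := by
  induction j with
  | zero => simp [hermiteZero_zero]
  | succ j ih =>
    have h1 : ((2 * j).factorial : ℝ) ≠ 0 := by positivity
    have h2 : (j.factorial : ℝ) ≠ 0 := by positivity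
    rw [div_eq_div_iff h1 h2] at ih
    rw [show 2 * (j + 1) = 2 * j + 2 by ring, hermiteZero_add_two, Nat.factorial_succ,
      Nat.factorial_succ, Nat.factorial_succ, div_eq_div_iff (by positivity) (by positivity)]
    push_cast
    rw [pow_succ]
    linear_combination (-(2 * (j : ℝ) + 1) * (j + 1)) * ih

/-- Two steps of the recursion multiply the square by (k + 1)², while the factorial gains (k + 1)(k
+ 2). -/
lemma hermiteZero_sq_le (k : ℕ) : hermiteZero k ^ 2 ≤ k.factorial := by
  induction k using Nat.twoStepInduction with
  | zero => simp [hermiteZero_zero]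
  | one => simp [hermiteZero_one]
  | more k ih _ =>
    rw [hermiteZero_add_two, Nat.factorial_succ, Nat.factorial_succ]
    push_cast
    have : (0 : ℝ) ≤ k.factorial := by positivity
    calc (-(((k : ℝ) + 1) * hermiteZero k)) ^ 2 = ((k : ℝ) + 1) ^ 2 * hermiteZero k ^ 2 := by ring
      _ ≤ ((k : ℝ) + 1) ^ 2 * k.factorial := by gcongr
      _ ≤ ((k : ℝ) + 1 + 1) * (((k : ℝ) + 1) * k.factorial) := by
        rw [sq, mul_assoc]; gcongr; linarith

lemma abs_hermiteZero_le (k : ℕ) : |hermiteZero k| ≤ √(k.factorial) :=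
  Real.abs_le_sqrt (hermiteZero_sq_le k)

open Polynomial in
/-- The polynomial `v ^ (m / 2) * H_m (X / √v)`. -/
noncomputable def heatPoly (v : ℝ) : ℕ → ℝ[X]
  | 0 => 1
  | 1 => X
  | m + 2 => X * heatPoly v (m + 1) - C (((m : ℝ) + 1) * v) * heatPoly v m

lemma scaledHermite_eq_eval {v : ℝ} (hv : 0 ≤ v) (m : ℕ) (u : ℝ) :
    scaledHermite m v u = (heatPoly v m).eval u := by
  induction m using Nat.twoStepInduction with
  | zero => simp [scaledHermite, heatPoly]
  | one =>
    by_cases h : v = 0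
    · simp [scaledHermite, heatPoly, h]
    · have : √v ≠ 0 := by rw [Real.sqrt_ne_zero hv]; exact h
      simp [scaledHermite, heatPoly, h]
      field_simp
  | more m ih1 ih2 =>
    simp only [heatPoly, Polynomial.eval_sub, Polynomial.eval_mul, Polynomial.eval_X,
      Polynomial.eval_C, ← ih1, ← ih2]
    by_cases h : v = 0
    · simp [scaledHermite, h]; ring
    · have h1 : √v ≠ 0 := by rw [Real.sqrt_ne_zero hv]; exact h
      simp only [scaledHermite, h, if_false, hermite_add_two]
      have h2 : v = √v ^ 2 := (Real.sq_sqrt hv).symm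
      simp only [map_sub, map_mul, Polynomial.aeval_X, map_add, map_natCast, map_one]
      have h3 : √v ^ (m + 2) * (u / √v) = u * √v ^ (m + 1) := by field_simp; ring
      have h4 : √v ^ (m + 2) = v * √v ^ m := by nth_rw 2 [h2]; ring
      rw [mul_sub, ← mul_assoc, h3, h4]
      ring

open Polynomial in
lemma derivative_heatPoly_succ (v : ℝ) (m : ℕ) :
    derivative (heatPoly v (m + 1)) = ((m : ℝ[X]) + 1) * heatPoly v m := by
  induction m using Nat.twoStepInduction with
  | zero => simp [heatPoly]
  | one => simp [heatPoly]; ring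
  | more m ih1 ih2 =>
    rw [show heatPoly v (m + 2 + 1) = X * heatPoly v (m + 2)
      - C ((((m + 1 : ℕ) : ℝ) + 1) * v) * heatPoly v (m + 1) from rfl]
    simp only [derivative_sub, derivative_mul, derivative_X, derivative_C, ih1, ih2]
    rw [show heatPoly v (m + 2) = X * heatPoly v (m + 1)
      - C (((m : ℝ) + 1) * v) * heatPoly v m from rfl]
    push_cast
    simp only [map_mul, map_add, map_natCast, map_one]
    ring

lemma integrable_heatPoly (v ω κ : ℝ) (m : ℕ) :
    Integrable (fun z => (heatPoly v m).eval (ω + κ * z)) stdNormal := by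
  have := integrable_polynomial_gaussianReal (𝕜 := ℝ) 0 1
    ((heatPoly v m).comp (Polynomial.C ω + Polynomial.C κ * Polynomial.X))
  simpa using this

/-- `heatPoly (κ ^ 2) m` is the unbiased estimate of `ω ^ m` from `N(ω, κ ^ 2)`. -/
lemma integral_heatPoly (ω κ : ℝ) (m : ℕ) :
    ∫ z, (heatPoly (κ ^ 2) m).eval (ω + κ * z) ∂stdNormal = ω ^ m := by
  induction m using Nat.twoStepInduction with
  | zero => simp [heatPoly]
  | one =>
    simp only [heatPoly, Polynomial.eval_X]
    rw [integral_add (integrable_const _)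
      ((by simpa using integrable_pow_gaussianReal 0 1 1 : Integrable (fun z : ℝ => z) _).const_mul _),
      integral_const_mul, integral_id_gaussianReal]
    simp
  | more m ih1 ih2 =>
    set p := heatPoly (κ ^ 2) (m + 1)
    set L : Polynomial ℝ := Polynomial.C ω + Polynomial.C κ * Polynomial.X
    -- In the recursion the term κ E[Z p(ω + κZ)] becomes, by Stein's identity, (m + 1)κ² times the
    -- previous moment. This is exactly what the second term of the recursion removes, leaving ω ·
    -- ω^(m+1).
    have ibp := integral_mul_polynomial_stdNormal (𝕜 := ℝ) (p.comp L)
    have hd : (p.comp L).derivative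
        = Polynomial.C (κ * (m + 1)) * (heatPoly (κ ^ 2) m).comp L := by
      rw [Polynomial.derivative_comp, derivative_heatPoly_succ]
      simp [L]
      ring
    rw [hd] at ibp
    simp only [RCLike.ofReal_real_eq_id, id_eq, Polynomial.eval_mul, Polynomial.eval_C,
      Polynomial.eval_comp, L, Polynomial.eval_add, Polynomial.eval_X, integral_const_mul, ih1]
      at ibp
    have i1 := integrable_heatPoly (κ ^ 2) ω κ (m + 1)
    have i0 := integrable_heatPoly (κ ^ 2) ω κ m
    have i2 : Integrable (fun z => z * p.eval (ω + κ * z)) stdNormal := by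
      have := integrable_polynomial_gaussianReal (𝕜 := ℝ) 0 1 (Polynomial.X * p.comp L)
      simpa [L] using this
    have e : ∀ z, (heatPoly (κ ^ 2) (m + 2)).eval (ω + κ * z)
        = ω * p.eval (ω + κ * z) + κ * (z * p.eval (ω + κ * z))
          - ((m + 1) * κ ^ 2) * (heatPoly (κ ^ 2) m).eval (ω + κ * z) := by
      intro z
      simp only [heatPoly, Polynomial.eval_sub, Polynomial.eval_mul, Polynomial.eval_X,
        Polynomial.eval_C, p]
      ring
    simp only [e]
    rw [integral_sub (by exact (i1.const_mul _).add (i2.const_mul _)) (i0.const_mul _),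
      integral_add (i1.const_mul _) (i2.const_mul _), integral_const_mul, integral_const_mul,
      integral_const_mul, ibp, ih1, ih2]
    ring

/-- The computation behind unbiasedness with κ = ik: now κ² = -k² supplies the minus sign of the
recursion. Taking absolute values under this integral bounds the growth of Hermite polynomials. -/
lemma integral_complex_pow (u k : ℝ) (m : ℕ) :
    ∫ x : ℝ, ((u : ℂ) + (k * Complex.I) * x) ^ m ∂stdNormal
      = ((heatPoly (k ^ 2) m).eval u : ℝ) := by
  have int : ∀ q : Polynomial ℂ, Integrable (fun x : ℝ => q.eval (x : ℂ)) stdNormal :=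
    integrable_polynomial_gaussianReal (𝕜 := ℂ) 0 1
  set L : Polynomial ℂ := Polynomial.C (u : ℂ) + Polynomial.C (k * Complex.I) * Polynomial.X
    with hL
  induction m using Nat.twoStepInduction with
  | zero => simp [heatPoly]
  | one =>
    have h0 := integral_mul_polynomial_stdNormal (𝕜 := ℂ) 1
    simp at h0
    have h1 : Integrable (fun x : ℝ => (x : ℂ)) stdNormal := by simpa using int Polynomial.X
    simp only [pow_one]
    rw [integral_add (integrable_const _) (h1.const_mul _), integral_const_mul, h0]
    simp [heatPoly]
  | more m ih1 ih2 =>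
    have ibp := integral_mul_polynomial_stdNormal (𝕜 := ℂ) (L ^ (m + 1))
    have hd : (L ^ (m + 1)).derivative = Polynomial.C ((m + 1) * (k * Complex.I)) * L ^ m := by
      rw [Polynomial.derivative_pow]
      simp [L]
      ring
    rw [hd] at ibp
    have hLe : ∀ x : ℝ, L.eval (x : ℂ) = (u : ℂ) + (k * Complex.I) * x := by
      intro x; simp [L]
    simp only [Polynomial.eval_mul, Polynomial.eval_C, Polynomial.eval_pow,
      integral_const_mul] at ibp
    have ibp' : ∫ x : ℝ, (x : ℂ) * ((u : ℂ) + (k * Complex.I) * x) ^ (m + 1) ∂stdNormal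
        = (m + 1) * (k * Complex.I) * ((heatPoly (k ^ 2) m).eval u : ℝ) := by
      rw [← ih1]
      simpa [hLe] using ibp
    have i1 : Integrable (fun x : ℝ => ((u : ℂ) + (k * Complex.I) * x) ^ (m + 1)) stdNormal := by
      simpa [L] using int (L ^ (m + 1))
    have i2 : Integrable
        (fun x : ℝ => (x : ℂ) * ((u : ℂ) + (k * Complex.I) * x) ^ (m + 1)) stdNormal := by
      refine (int (Polynomial.X * L ^ (m + 1))).congr (ae_of_all _ fun x => ?_)
      simp only [Polynomial.eval_mul, Polynomial.eval_X, Polynomial.eval_pow, hLe]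
    have e : ∀ x : ℝ, ((u : ℂ) + (k * Complex.I) * x) ^ (m + 2)
        = u * ((u : ℂ) + (k * Complex.I) * x) ^ (m + 1)
          + (k * Complex.I) * ((x : ℂ) * ((u : ℂ) + (k * Complex.I) * x) ^ (m + 1)) := by
      intro x; ring
    simp only [e]
    rw [integral_add (i1.const_mul _) (i2.const_mul _), integral_const_mul, integral_const_mul,
      ibp', ih2]
    simp only [heatPoly, Polynomial.eval_sub, Polynomial.eval_mul, Polynomial.eval_X,
      Polynomial.eval_C]
    push_cast
    linear_combination ((m : ℂ) + 1) * k ^ 2 * (((heatPoly (k ^ 2) m).eval u : ℝ) : ℂ) * Complex.I_sq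

/-- Square root of a single term of the exponential series at x². The resulting √m! is small enough
to be absorbed by the coefficients of the Hermite sum. -/
lemma pow_le_sqrt_factorial_mul_exp {x : ℝ} (hx : 0 ≤ x) (m : ℕ) :
    x ^ m ≤ √(m.factorial) * Real.exp (x ^ 2 / 2) := by
  have h := Real.pow_div_factorial_le_exp (x ^ 2) (sq_nonneg x) m
  rw [div_le_iff₀ (by positivity)] at h
  have h2 : Real.exp (x ^ 2) = Real.exp (x ^ 2 / 2) ^ 2 := by
    rw [← Real.exp_nat_mul]; congr 1; push_cast; ring
  refine (pow_le_pow_iff_left₀ (by positivity) (by positivity) two_ne_zero).1 ?_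
  rw [mul_pow, Real.sq_sqrt (by positivity), ← h2]
  calc (x ^ m) ^ 2 = (x ^ 2) ^ m := by ring
    _ ≤ _ := by linarith

/-- Since |u + i√v x|² = u² + v x², the complex moment is at most √m! exp(u²/2) times the mean of
exp(v x²/2), which is 1/√(1 - v). The restriction on v keeps this factor below 2. -/
lemma abs_eval_heatPoly_le {v : ℝ} (hv0 : 0 ≤ v) (hv : v ≤ 1 / 2) (m : ℕ) (u : ℝ) :
    |(heatPoly v m).eval u| ≤ √(m.factorial) * (2 * Real.exp (u ^ 2 / 2)) := by
  have hk : √v ^ 2 = v := Real.sq_sqrt hv0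
  have h := integral_complex_pow u √v m
  rw [hk] at h
  have hi := integrable_exp_quadratic 0 (s := 1 - v) (by linarith)
  have he := integral_exp_quadratic 0 (s := 1 - v) (by linarith)
  have hb : ∀ x : ℝ, ‖((u : ℂ) + (√v * Complex.I) * x) ^ m‖
      ≤ √(m.factorial) * Real.exp (u ^ 2 / 2) * Real.exp (0 * x + (1 - (1 - v)) / 2 * x ^ 2) := by
    intro x
    rw [norm_pow]
    refine (pow_le_sqrt_factorial_mul_exp (norm_nonneg _) m).trans (le_of_eq ?_)
    have hn : ‖((u : ℂ) + (√v * Complex.I) * x)‖ ^ 2 = u ^ 2 + v * x ^ 2 := by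
      rw [← Complex.normSq_eq_norm_sq, Complex.normSq_apply]
      simp
      linear_combination x ^ 2 * hk
    rw [hn, mul_assoc, ← Real.exp_add]
    congr 2
    ring
  have h1 : |(heatPoly v m).eval u| = ‖(((heatPoly v m).eval u : ℝ) : ℂ)‖ := by simp
  rw [h1, ← h]
  refine (norm_integral_le_of_norm_le (hi.const_mul _) (ae_of_all _ hb)).trans ?_
  rw [integral_const_mul, he, mul_assoc]
  have hs : (1 / 2 : ℝ) ≤ √(1 - v) := by
    apply Real.le_sqrt_of_sq_le; linarith
  have : Real.exp (0 ^ 2 / (2 * (1 - v))) / √(1 - v) ≤ 2 := by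
    rw [div_le_iff₀ (by linarith)]
    simp
    linarith
  have h0 := Real.exp_pos (u ^ 2 / 2)
  refine mul_le_mul_of_nonneg_left ?_ (by positivity)
  nlinarith

/-! ### The function `G` -/

lemma stdPdf_nonneg (w : ℝ) : 0 ≤ stdPdf w := gaussianPDFReal_nonneg 0 1 w

lemma stdPdf_eq (w : ℝ) : stdPdf w = stdPdf 0 * Real.exp (-(w ^ 2 / 2)) := by
  simp only [stdPdf, gaussianPDFReal]
  rw [mul_assoc (√_)⁻¹, ← Real.exp_add]
  congr 2
  push_cast
  ring

lemma stdPdf_zero_le_one : stdPdf 0 ≤ 1 := by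
  have h : 1 ≤ √(2 * Real.pi) := by
    apply Real.le_sqrt_of_sq_le
    nlinarith [Real.pi_gt_three]
  simp only [stdPdf, gaussianPDFReal]
  simpa using inv_le_one_of_one_le₀ h

lemma stdPdf_le_exp (w : ℝ) : stdPdf w ≤ Real.exp (-(w ^ 2 / 2)) := by
  rw [stdPdf_eq]
  exact mul_le_of_le_one_left (Real.exp_pos _).le stdPdf_zero_le_one

lemma stdPdf_le_one (w : ℝ) : stdPdf w ≤ 1 := by
  refine (stdPdf_le_exp w).trans (Real.exp_le_one_iff.2 ?_)
  have := sq_nonneg w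
  linarith

lemma stdPdf_neg (w : ℝ) : stdPdf (-w) = stdPdf w := by
  rw [stdPdf_eq, stdPdf_eq w]; simp

lemma continuous_stdPdf : Continuous stdPdf :=
  continuous_iff_continuousAt.2 fun x => (hasDerivAt_stdPdf x).continuousAt

lemma integrable_stdPdf : Integrable stdPdf := integrable_gaussianPDFReal 0 1

lemma stdCdf_eq_integral (w : ℝ) : stdCdf w = ∫ x in Set.Iic w, stdPdf x := by
  rw [stdCdf, cdf_eq_real, measureReal_def, gaussianReal_apply_eq_integral _ one_ne_zero,
    ENNReal.toReal_ofReal (integral_nonneg fun x => gaussianPDFReal_nonneg 0 1 x)]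
  rfl

lemma hasDerivAt_stdCdf (w : ℝ) : HasDerivAt stdCdf (stdPdf w) w := by
  have h : stdCdf = fun w => (∫ x in Set.Iic 0, stdPdf x) + ∫ x in (0 : ℝ)..w, stdPdf x := by
    ext w
    rw [stdCdf_eq_integral, ← intervalIntegral.integral_Iic_sub_Iic
      integrable_stdPdf.integrableOn integrable_stdPdf.integrableOn]
    ring
  rw [h]
  exact (intervalIntegral.integral_hasDerivAt_right
    integrable_stdPdf.intervalIntegrable
    continuous_stdPdf.stronglyMeasurable.stronglyMeasurableAtFilter
    continuous_stdPdf.continuousAt).const_add _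

lemma hasDerivAt_G (w β : ℝ) : HasDerivAt (fun w => G w β) (stdCdf w - β) w := by
  have h := ((hasDerivAt_stdPdf w).add ((hasDerivAt_id w).mul (hasDerivAt_stdCdf w))).sub
    ((hasDerivAt_id w).const_mul β)
  exact h.congr_deriv (by simp)

lemma stdCdf_nonneg (w : ℝ) : 0 ≤ stdCdf w := cdf_nonneg _ _

lemma stdCdf_le_one (w : ℝ) : stdCdf w ≤ 1 := cdf_le_one _ _

lemma integral_Ioi_mul_stdPdf (a : ℝ) : ∫ z in Set.Ioi a, z * stdPdf z = stdPdf a := by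
  have hi : Integrable (fun z => z * stdPdf z) := by
    have := (integrable_gaussianReal_iff one_ne_zero).1 (integrable_pow_gaussianReal 0 1 1)
    refine this.congr (ae_of_all _ fun z => ?_)
    simp [stdPdf, mul_comm]
  have ht : Tendsto (fun z => -stdPdf z) atTop (𝓝 0) := by
    rw [← neg_zero]
    refine Tendsto.neg ?_
    have h1 : Tendsto (fun z : ℝ => Real.exp (-(z ^ 2 / 2))) atTop (𝓝 0) := by
      refine Real.tendsto_exp_neg_atTop_nhds_zero.comp ?_
      exact (tendsto_pow_atTop two_ne_zero).atTop_div_const two_pos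
    exact squeeze_zero stdPdf_nonneg stdPdf_le_exp h1
  have := integral_Ioi_of_hasDerivAt_of_tendsto' (a := a) (f := fun z => -stdPdf z)
    (f' := fun z => z * stdPdf z) (fun x _ => (hasDerivAt_stdPdf x).neg.congr_deriv (by ring))
    hi.integrableOn ht
  rw [this]
  ring

lemma map_neg_stdNormal : stdNormal.map (fun z => -z) = stdNormal := by
  rw [gaussianReal_map_neg, neg_zero]

lemma integrable_id_stdNormal : Integrable (fun z : ℝ => z) stdNormal := by
  simpa using integrable_pow_gaussianReal 0 1 1

lemma integrable_posPart (w : ℝ) : Integrable (fun z => max (w + z) 0) stdNormal :=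
  ((integrable_const w).add integrable_id_stdNormal).sup (integrable_const 0)

/-- The mean of the positive part of a normal variable. -/
lemma integral_posPart (w : ℝ) :
    ∫ z, max (w + z) 0 ∂stdNormal = stdPdf w + w * stdCdf w := by
  have h1 : (fun z => max (w + z) 0) = (Set.Ici (-w)).indicator fun z => w + z := by
    ext z
    by_cases h : z ∈ Set.Ici (-w)
    · rw [Set.indicator_of_mem h, max_eq_left]
      have : -w ≤ z := h
      linarith
    · rw [Set.indicator_of_notMem h, max_eq_right]
      have : z < -w := not_le.1 h
      linarith
  rw [h1, integral_indicator measurableSet_Ici, integral_add (integrable_const _).integrableOn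
    integrable_id_stdNormal.integrableOn]
  have h2 : stdNormal.real (Set.Ici (-w)) = stdCdf w := by
    rw [stdCdf, cdf_eq_real]
    nth_rw 1 [← map_neg_stdNormal]
    rw [ map_measureReal_apply (by fun_prop)
      measurableSet_Ici]
    congr 1
    ext z
    simp
  have h3 : ∫ z in Set.Ici (-w), z ∂stdNormal = stdPdf w := by
    rw [← stdPdf_neg, ← integral_Ioi_mul_stdPdf, ← integral_Ici_eq_integral_Ioi,
      ← integral_indicator measurableSet_Ici, ← integral_indicator measurableSet_Ici,
      integral_gaussianReal_eq_integral_smul one_ne_zero]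
    refine integral_congr_ae (ae_of_all _ fun z => ?_)
    by_cases h : z ∈ Set.Ici (-w)
    · simp only [Set.indicator_of_mem h, stdPdf, smul_eq_mul]; ring
    · simp only [Set.indicator_of_notMem h, smul_zero]
  rw [h3, setIntegral_const, h2, smul_eq_mul]
  ring

lemma G_eq_integral (w β : ℝ) : G w β = (∫ z, max (w + z) 0 ∂stdNormal) - β * w := by
  rw [integral_posPart, G]

/-- `G w β + β * w` does not depend on `β`. -/
lemma G_add_nonneg (w β : ℝ) : 0 ≤ G w β + β * w := by
  rw [G_eq_integral, sub_add_cancel]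
  exact integral_nonneg fun z => le_max_right _ _

lemma G_add_le_of_nonpos {w : ℝ} (hw : w ≤ 0) (β : ℝ) : G w β + β * w ≤ Real.exp (-(w ^ 2 / 2)) := by
  have := mul_nonpos_of_nonpos_of_nonneg hw (stdCdf_nonneg w)
  have := stdPdf_le_exp w
  simp only [G]
  linarith

lemma G_add_le (w β : ℝ) : G w β + β * w ≤ 1 + max w 0 := by
  have h1 := stdPdf_le_one w
  have h2 : w * stdCdf w ≤ max w 0 := by
    calc w * stdCdf w ≤ max w 0 * stdCdf w :=
          mul_le_mul_of_nonneg_right (le_max_left _ _) (stdCdf_nonneg w)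
      _ ≤ max w 0 := mul_le_of_le_one_right (le_max_right _ _) (stdCdf_le_one w)
  simp only [G]
  linarith

/-- Reflection: exchanging the two kinds of error exchanges `β` and `1 - β`. -/
lemma G_neg (w β : ℝ) : G (-w) (1 - β) = G w β := by
  have h : ∫ z, max (-w + z) 0 ∂stdNormal = (∫ z, max (w + z) 0 ∂stdNormal) - w := by
    have h1 : ∫ z, max (-w + z) 0 ∂stdNormal = ∫ z, max (-w - z) 0 ∂stdNormal := by
      nth_rw 1 [← map_neg_stdNormal]
      rw [integral_map measurable_neg.aemeasurable
        (by apply Measurable.aestronglyMeasurable; fun_prop)]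
      rfl
    have h2 : ∀ z : ℝ, max (-w - z) 0 = max (w + z) 0 - (w + z) := by
      intro z
      rcases le_total 0 (w + z) with h | h
      · rw [max_eq_left h, max_eq_right (by linarith)]; ring
      · rw [max_eq_right h, max_eq_left (by linarith)]; ring
    rw [h1]
    simp only [h2]
    rw [integral_sub (integrable_posPart w)
      (by exact (integrable_const w).add integrable_id_stdNormal),
      integral_add (integrable_const w) integrable_id_stdNormal, integral_id_gaussianReal]
    simp
  rw [G_eq_integral, G_eq_integral, h]
  ring

/-- Odd indices contribute nothing, and (N + 1)/2 in natural division counts the even indices below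
N. -/
lemma sum_hermiteZero (N : ℕ) (w : ℝ) :
    ∑ k ∈ Finset.range N, (-1) ^ k * hermiteZero k / k.factorial * w ^ k
      = ∑ j ∈ Finset.range ((N + 1) / 2), (-(w ^ 2 / 2)) ^ j / j.factorial := by
  have even : ∀ J : ℕ, ∑ k ∈ Finset.range (2 * J), (-1) ^ k * hermiteZero k / k.factorial * w ^ k
      = ∑ j ∈ Finset.range J, (-(w ^ 2 / 2)) ^ j / j.factorial := by
    intro J
    induction J with
    | zero => simp
    | succ J ih =>
      rw [show 2 * (J + 1) = 2 * J + 1 + 1 by ring, Finset.sum_range_succ, Finset.sum_range_succ,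
        ih, Finset.sum_range_succ, hermiteZero_odd, mul_div_assoc, hermiteZero_even, pow_mul,
        pow_mul, show -(w ^ 2 / 2) = (-1 / 2) * w ^ 2 by ring, mul_pow]
      simp
      ring
  rcases Nat.even_or_odd' N with ⟨J, rfl | rfl⟩
  · rw [even, show (2 * J + 1) / 2 = J by omega]
  · rw [show (2 * J + 1 + 1) / 2 = J + 1 by omega, ← even,
      show 2 * (J + 1) = 2 * J + 1 + 1 by ring, Finset.sum_range_succ _ (2 * J + 1),
      hermiteZero_odd]
    simp

/-- Weighting the term of index j ≥ J by exp(j - J) ≥ 1 bounds the tail by exp(-J) times the full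
series at e·y. The bound is useful once J exceeds e·y. -/
lemma abs_exp_neg_sub_sum_le {y : ℝ} (hy : 0 ≤ y) (J : ℕ) :
    |Real.exp (-y) - ∑ j ∈ Finset.range J, (-y) ^ j / j.factorial|
      ≤ Real.exp (Real.exp 1 * y - J) := by
  have hs : ∀ x : ℝ, HasSum (fun j : ℕ => x ^ j / j.factorial) (Real.exp x) := by
    intro x
    rw [Real.exp_eq_exp_ℝ]
    exact NormedSpace.expSeries_div_hasSum_exp x
  have h1 := (hasSum_nat_add_iff' J).2 (hs (-y))
  have h2 := ((hasSum_nat_add_iff' J).2 (hs (Real.exp 1 * y))).mul_left (Real.exp (-J))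
  rw [← h1.tsum_eq, ← Real.norm_eq_abs]
  refine (tsum_of_norm_bounded h2 fun i => ?_).trans ?_
  · rw [norm_div, norm_pow, norm_neg (y : ℝ), Real.norm_of_nonneg hy, RCLike.norm_natCast, mul_pow,
      ← mul_div_assoc, ← mul_assoc, ← Real.exp_nat_mul, ← Real.exp_add]
    gcongr
    refine le_mul_of_one_le_left (by positivity) (Real.one_le_exp ?_)
    push_cast
    simp
  · rw [sub_eq_add_neg (Real.exp 1 * y), Real.exp_add, mul_comm]
    refine mul_le_mul_of_nonneg_right ?_ (Real.exp_pos _).le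
    have : 0 ≤ ∑ j ∈ Finset.range J, (Real.exp 1 * y) ^ j / j.factorial :=
      Finset.sum_nonneg fun j _ => by positivity
    linarith

/-- The Taylor polynomial of degree `N + 1` of `G · β` at `0`. -/
noncomputable def taylorG (N : ℕ) (β w : ℝ) : ℝ :=
  G 0 β + deriv (fun w => G w β) 0 * w
    + stdPdf 0 * ∑ k ∈ Finset.range N, ((-1) ^ k * hermiteZero k / (k + 2).factorial) * w ^ (k + 2)

/-- Since G'' = φ, the second derivative of the error is φ(0) times the error of a partial
exponential series at -x²/2. The mean value inequality on [-|w|, |w|], applied twice, brings the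
bound back to G and yields the factor w². -/
lemma abs_G_sub_taylorG_le (N : ℕ) (β w : ℝ) :
    |G w β - taylorG N β w|
      ≤ Real.exp (Real.exp 1 * (w ^ 2 / 2) - ((N + 1) / 2 : ℕ)) * w ^ 2 := by
  set M := Real.exp (Real.exp 1 * (w ^ 2 / 2) - ((N + 1) / 2 : ℕ)) with hM
  set c : ℕ → ℝ := fun k => (-1) ^ k * hermiteZero k with hc
  set f2 : ℝ → ℝ := fun x => stdPdf x - stdPdf 0 * ∑ k ∈ Finset.range N, c k / k.factorial * x ^ k
    with hf2
  set f1 : ℝ → ℝ := fun x => stdCdf x - stdCdf 0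
    - stdPdf 0 * ∑ k ∈ Finset.range N, c k / (k + 1).factorial * x ^ (k + 1) with hf1
  set f0 : ℝ → ℝ := fun x => G x β - taylorG N β x with hf0
  have hpow : ∀ (k m : ℕ) (x : ℝ), HasDerivAt (fun x : ℝ => c k / (m + 1).factorial * x ^ (m + 1))
      (c k / m.factorial * x ^ m) x := by
    intro k m x
    refine ((hasDerivAt_pow (m + 1) x).const_mul _).congr_deriv ?_
    rw [Nat.factorial_succ]
    have : (m.factorial : ℝ) ≠ 0 := by positivity
    have : (m : ℝ) + 1 ≠ 0 := by positivity
    push_cast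
    field_simp
  have d1 : ∀ x, HasDerivAt f1 (f2 x) x := by
    intro x
    have hsum := HasDerivAt.fun_sum (u := Finset.range N) fun k _ => hpow k k x
    exact (((hasDerivAt_stdCdf x).sub_const (stdCdf 0)).sub (hsum.const_mul (stdPdf 0)))
  have d0 : ∀ x, HasDerivAt f0 (f1 x) x := by
    intro x
    have hsum := HasDerivAt.fun_sum (u := Finset.range N) fun k _ => hpow k (k + 1) x
    have hlin : HasDerivAt (fun x => G 0 β + deriv (fun w => G w β) 0 * x)
        (deriv (fun w => G w β) 0) x := by
      simpa using ((hasDerivAt_id x).const_mul (deriv (fun w => G w β) 0)).const_add (G 0 β)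
    have := (hasDerivAt_G x β).sub (hlin.add (hsum.const_mul (stdPdf 0)))
    refine this.congr_deriv ?_
    rw [(hasDerivAt_G 0 β).deriv]
    simp only [hf1]
    ring
  have b2 : ∀ x ∈ Set.Icc (-|w|) |w|, ‖f2 x‖ ≤ M := by
    intro x hx
    have hx2 : x ^ 2 ≤ w ^ 2 := by
      rw [← sq_abs w]; exact sq_le_sq' hx.1 hx.2
    have e : f2 x = stdPdf 0 * (Real.exp (-(x ^ 2 / 2))
        - ∑ j ∈ Finset.range ((N + 1) / 2), (-(x ^ 2 / 2)) ^ j / j.factorial) := by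
      simp only [hf2, hc]
      rw [sum_hermiteZero, stdPdf_eq x]
      ring
    rw [e, norm_mul, Real.norm_of_nonneg (stdPdf_nonneg 0)]
    refine (mul_le_of_le_one_left (norm_nonneg _) stdPdf_zero_le_one).trans ?_
    refine (abs_exp_neg_sub_sum_le (by positivity) _).trans ?_
    rw [hM]
    gcongr
  have h0 : (0 : ℝ) ∈ Set.Icc (-|w|) |w| := by simp
  have hw : w ∈ Set.Icc (-|w|) |w| := ⟨neg_abs_le w, le_abs_self w⟩
  have f10 : f1 0 = 0 := by simp [hf1]
  have f00 : f0 0 = 0 := by simp [hf0, taylorG]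
  have b1 : ∀ x ∈ Set.Icc (-|w|) |w|, ‖f1 x‖ ≤ M * |w| := by
    intro x hx
    have := (convex_Icc (-|w|) |w|).norm_image_sub_le_of_norm_hasDerivWithin_le
      (fun y _ => (d1 y).hasDerivWithinAt) b2 h0 hx
    rw [f10, sub_zero, sub_zero] at this
    refine this.trans (mul_le_mul_of_nonneg_left (abs_le.2 hx) (Real.exp_pos _).le)
  have := (convex_Icc (-|w|) |w|).norm_image_sub_le_of_norm_hasDerivWithin_le
      (fun y _ => (d0 y).hasDerivWithinAt) b1 h0 hw
  rw [f00, sub_zero, sub_zero] at this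
  refine this.trans (le_of_eq ?_)
  rw [Real.norm_eq_abs, mul_assoc, abs_mul_abs_self, sq]

/-! ### The estimate of a Taylor polynomial of `G` -/

/-- The truncation of `s` to `[-n, n]`. -/
noncomputable def truncate (n s : ℝ) : ℝ := Real.sign s * min |s| n

lemma truncate_eq {n : ℝ} (hn : 0 ≤ n) (s : ℝ) : truncate n s = max (-n) (min s n) := by
  rcases lt_trichotomy s 0 with h | rfl | h
  · rw [truncate, Real.sign_of_neg h, abs_of_neg h, min_eq_left (by linarith : s ≤ n)]
    rcases le_total (-s) n with h1 | h1
    · rw [min_eq_left h1, max_eq_right (by linarith)]; ring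
    · rw [min_eq_right h1, max_eq_left (by linarith)]; ring
  · simp [truncate, hn]
  · rw [truncate, Real.sign_of_pos h, abs_of_pos h, one_mul, max_eq_right]
    exact le_min (by linarith) (by linarith)

lemma measurable_truncate {n : ℝ} (hn : 0 ≤ n) : Measurable (truncate n) := by
  have : truncate n = fun s => max (-n) (min s n) := funext (truncate_eq hn)
  rw [this]
  fun_prop

lemma abs_truncate_le {n : ℝ} (hn : 0 ≤ n) (s : ℝ) : |truncate n s| ≤ n := by
  rw [truncate_eq hn, abs_le]
  exact ⟨le_max_left _ _, max_le (by linarith) (min_le_right _ _)⟩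

lemma abs_truncate_le_abs {n : ℝ} (hn : 0 ≤ n) (s : ℝ) : |truncate n s| ≤ |s| := by
  rw [truncate_eq hn]
  refine abs_le.2 ⟨?_, ?_⟩
  · refine le_max_of_le_right (le_min (neg_abs_le s) ?_)
    linarith [abs_nonneg s]
  · exact max_le (by linarith [abs_nonneg s]) ((min_le_left _ _).trans (le_abs_self s))

/-- Only values beyond n are altered, and there |s| ≤ s²/n. In this form the bias of truncation
costs a second moment divided by n. -/
lemma abs_truncate_sub_le {n : ℝ} (hn : 0 < n) (s : ℝ) : |truncate n s - s| ≤ s ^ 2 / n := by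
  rw [truncate_eq hn.le, le_div_iff₀ hn]
  rcases le_total s n with h | h
  · rw [min_eq_left h]
    rcases le_total (-n) s with h1 | h1
    · rw [max_eq_right h1]; simp; positivity
    · rw [max_eq_left h1, abs_of_nonneg (by linarith)]; nlinarith
  · rw [min_eq_right h, max_eq_right (by linarith), abs_of_nonpos (by linarith)]; nlinarith

/-- The unbiased estimate of `taylorG N β ω` from `u ~ N(ω, v)`. -/
noncomputable def hermiteEstimate (N : ℕ) (v β u : ℝ) : ℝ :=
  G 0 β + deriv (fun w => G w β) 0 * u
    + stdPdf 0 * ∑ k ∈ Finset.range N,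
        ((-1) ^ k * hermiteZero k / (k + 2).factorial) * scaledHermite (k + 2) v u

lemma hermiteEstimate_eq {v : ℝ} (hv : 0 ≤ v) (N : ℕ) (β u : ℝ) :
    hermiteEstimate N v β u = G 0 β + deriv (fun w => G w β) 0 * u
      + stdPdf 0 * ∑ k ∈ Finset.range N,
        ((-1) ^ k * hermiteZero k / (k + 2).factorial) * (heatPoly v (k + 2)).eval u := by
  simp only [hermiteEstimate, scaledHermite_eq_eval hv]

lemma measurable_hermiteEstimate {v : ℝ} (hv : 0 ≤ v) (N : ℕ) (β : ℝ) :
    Measurable (hermiteEstimate N v β) := by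
  have : hermiteEstimate N v β = _ := funext (hermiteEstimate_eq hv N β)
  rw [this]
  fun_prop

lemma integrable_hermiteEstimate (N : ℕ) (β ω κ : ℝ) :
    Integrable (fun z => hermiteEstimate N (κ ^ 2) β (ω + κ * z)) stdNormal := by
  simp only [hermiteEstimate_eq (sq_nonneg κ)]
  refine ((integrable_const _).add
    (((integrable_const _).add (integrable_id_stdNormal.const_mul _)).const_mul _)).add ?_
  exact (integrable_finsetSum _ fun k _ =>
    (integrable_heatPoly _ ω κ (k + 2)).const_mul _).const_mul _

lemma integral_hermiteEstimate (N : ℕ) (β ω κ : ℝ) :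
    ∫ z, hermiteEstimate N (κ ^ 2) β (ω + κ * z) ∂stdNormal = taylorG N β ω := by
  simp only [hermiteEstimate_eq (sq_nonneg κ)]
  have h1 : Integrable (fun z => ω + κ * z) stdNormal :=
    (integrable_const _).add (integrable_id_stdNormal.const_mul _)
  rw [integral_add (by exact (integrable_const _).add (h1.const_mul _))
    ((integrable_finsetSum _ fun k _ =>
      (integrable_heatPoly _ ω κ (k + 2)).const_mul _).const_mul _),
    integral_add (integrable_const _) (h1.const_mul _), integral_const_mul, integral_const_mul,
    integral_finsetSum _ fun k _ => (integrable_heatPoly _ ω κ (k + 2)).const_mul _,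
    integral_add (integrable_const _) (integrable_id_stdNormal.const_mul _), integral_const_mul,
    integral_id_gaussianReal]
  simp only [integral_const_mul, integral_heatPoly]
  simp [taylorG]

/-- The factorials cancel: √k! from the coefficient and √(k + 2)! from the polynomial are together
at most (k + 2)!. Each of the N terms of the sum, and the linear part, is thus at most 2 exp(u²/2).
-/
lemma abs_hermiteEstimate_le {v β : ℝ} (hv0 : 0 ≤ v) (hv : v ≤ 1 / 2) (hβ0 : 0 ≤ β) (hβ1 : β ≤ 1)
    (N : ℕ) (u : ℝ) :
    |hermiteEstimate N v β u| ≤ (2 * N + 2) * Real.exp (u ^ 2 / 2) := by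
  rw [hermiteEstimate_eq hv0]
  set E := Real.exp (u ^ 2 / 2) with hE
  have hE1 : 1 ≤ E := Real.one_le_exp (by positivity)
  have hu : |u| ≤ E := by simpa using pow_le_sqrt_factorial_mul_exp (abs_nonneg u) 1
  have h1 : |G 0 β| ≤ 1 := by
    simp [G, abs_of_nonneg (stdPdf_nonneg 0), stdPdf_zero_le_one]
  have h2 : |deriv (fun w => G w β) 0| ≤ 1 := by
    rw [(hasDerivAt_G 0 β).deriv, abs_le]
    constructor <;> linarith [stdCdf_nonneg 0, stdCdf_le_one 0]
  have h3 : ∀ k ∈ Finset.range N, |((-1) ^ k * hermiteZero k / (k + 2).factorial)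
      * (heatPoly v (k + 2)).eval u| ≤ 2 * E := by
    intro k _
    rw [abs_mul, abs_div, abs_mul, abs_pow, abs_neg, abs_one, one_pow, one_mul, Nat.abs_cast]
    have hf : (0 : ℝ) < (k + 2).factorial := by positivity
    have hs : √((k + 2).factorial : ℝ) * √((k + 2).factorial : ℝ) = (k + 2).factorial :=
      Real.mul_self_sqrt hf.le
    have hk : √(k.factorial : ℝ) ≤ √((k + 2).factorial : ℝ) := by
      apply Real.sqrt_le_sqrt
      exact_mod_cast Nat.factorial_le (by omega)
    calc |hermiteZero k| / ((k + 2).factorial : ℝ) * |(heatPoly v (k + 2)).eval u|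
        ≤ √((k + 2).factorial : ℝ) / ((k + 2).factorial : ℝ)
            * (√((k + 2).factorial : ℝ) * (2 * E)) := by
          gcongr
          · exact (abs_hermiteZero_le k).trans hk
          · exact abs_eval_heatPoly_le hv0 hv (k + 2) u
      _ = (√((k + 2).factorial : ℝ) * √((k + 2).factorial : ℝ)) / ((k + 2).factorial : ℝ)
            * (2 * E) := by ring
      _ = 2 * E := by rw [hs, div_self hf.ne', one_mul]
  have h4 := (Finset.abs_sum_le_sum_abs _ _).trans (Finset.sum_le_sum h3)
  rw [Finset.sum_const, Finset.card_range, nsmul_eq_mul] at h4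
  refine (abs_add_le _ _).trans ?_
  have h5 : |G 0 β + deriv (fun w => G w β) 0 * u| ≤ 2 * E := by
    refine (abs_add_le _ _).trans ?_
    rw [abs_mul]
    have := mul_le_mul h2 hu (abs_nonneg u) zero_le_one
    linarith
  have h6 : |stdPdf 0 * ∑ k ∈ Finset.range N, ((-1) ^ k * hermiteZero k / (k + 2).factorial)
      * (heatPoly v (k + 2)).eval u| ≤ N * (2 * E) := by
    rw [abs_mul, abs_of_nonneg (stdPdf_nonneg 0)]
    exact (mul_le_of_le_one_left (abs_nonneg _) stdPdf_zero_le_one).trans h4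
  linarith

/-! ### Exponential estimates -/

lemma exp_sq_sub_eq (a η t z : ℝ) :
    Real.exp ((a + η * z) ^ 2 - t * (a - η * z) ^ 2)
      = Real.exp ((1 - t) * a ^ 2) * Real.exp ((2 * a * η * (1 + t)) * z
        + (1 - (1 + 2 * (t - 1) * η ^ 2)) / 2 * z ^ 2) := by
  rw [← Real.exp_add]; congr 1; ring

lemma integrable_exp_sq_sub (a η : ℝ) {t : ℝ} (ht : 1 ≤ t) :
    Integrable (fun z => Real.exp ((a + η * z) ^ 2 - t * (a - η * z) ^ 2)) stdNormal := by
  simp only [exp_sq_sub_eq]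
  refine (integrable_exp_quadratic _ ?_).const_mul _
  have := mul_nonneg (sub_nonneg.2 ht) (sq_nonneg η)
  nlinarith

/-- The integral is explicit, and because (1 + t)² - (t - 1)² = 4t its exponent is nonpositive
precisely under the condition on `8 * t * η ^ 2`. What matters is that the bound does not depend on
`a`, which carries the unbounded observation. -/
lemma integral_exp_sq_sub_le (a : ℝ) {η t : ℝ} (ht : 1 ≤ t) (htη : 8 * t * η ^ 2 ≤ t - 1) :
    ∫ z, Real.exp ((a + η * z) ^ 2 - t * (a - η * z) ^ 2) ∂stdNormal ≤ 1 := by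
  have h0 := mul_nonneg (sub_nonneg.2 ht) (sq_nonneg η)
  have hs : 1 ≤ 1 + 2 * (t - 1) * η ^ 2 := by nlinarith
  simp only [exp_sq_sub_eq]
  rw [integral_const_mul, integral_exp_quadratic _ (by linarith), ← mul_div_assoc, ← Real.exp_add]
  refine (div_le_self (Real.exp_pos _).le (Real.one_le_sqrt.2 hs)).trans ?_
  rw [Real.exp_le_one_iff]
  have h1 : (2 * a * η * (1 + t)) ^ 2 / (2 * (1 + 2 * (t - 1) * η ^ 2)) ≤ (t - 1) * a ^ 2 := by
    rw [div_le_iff₀ (by linarith)]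
    have := mul_le_mul_of_nonneg_left htη (sq_nonneg a)
    nlinarith
  linarith

/-- A Gaussian tail bound that remains meaningful for a degenerate law. -/
lemma stdNormal_tail_le {κ v₀ x : ℝ} (hκ : κ ^ 2 ≤ v₀) (hv₀ : 0 < v₀) (hx : 0 ≤ x) :
    stdNormal.real {z | κ * z ≤ -x} ≤ Real.exp (-(x ^ 2 / (2 * v₀))) := by
  -- The Chernoff parameter that is optimal for the variance v₀. Using v₀ instead of κ² avoids a
  -- division by zero when κ = 0.
  set s := x / v₀ with hs
  have hm : MeasurableSet {z : ℝ | κ * z ≤ -x} := measurableSet_le (by fun_prop) (by fun_prop)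
  have hs0 : 0 ≤ s := by positivity
  have he : ∀ z, Real.exp (-s * x) * Real.exp ((-s * κ) * z + (1 - 1) / 2 * z ^ 2)
      = Real.exp (-s * (κ * z + x)) := by
    intro z; rw [← Real.exp_add]; congr 1; ring
  have hi := (integrable_exp_quadratic (-s * κ) (s := 1) one_pos).const_mul (Real.exp (-s * x))
  have hv := integral_exp_quadratic (-s * κ) (s := 1) one_pos
  rw [← integral_indicator_one hm]
  calc ∫ z, {z : ℝ | κ * z ≤ -x}.indicator 1 z ∂stdNormal
      ≤ ∫ z, Real.exp (-s * x) * Real.exp ((-s * κ) * z + (1 - 1) / 2 * z ^ 2) ∂stdNormal := by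
        refine integral_mono ((integrable_const (1 : ℝ)).indicator hm) hi fun z => ?_
        simp only [he]
        by_cases h : z ∈ {z : ℝ | κ * z ≤ -x}
        · rw [Set.indicator_of_mem h]
          have h' : κ * z ≤ -x := h
          exact Real.one_le_exp (by nlinarith)
        · rw [Set.indicator_of_notMem h]
          exact (Real.exp_pos _).le
    _ = Real.exp (-s * x + (-s * κ) ^ 2 / 2) := by
        rw [integral_const_mul, hv, Real.exp_add]
        simp
    _ ≤ _ := by
        apply Real.exp_le_exp.2
        have h1 : s * v₀ = x := by rw [hs]; field_simp
        have h2 : x ^ 2 / (2 * v₀) = s * x / 2 := by rw [hs]; field_simp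
        rw [h2]
        nlinarith [mul_le_mul_of_nonneg_left hκ (sq_nonneg s)]

/-! ### The threshold estimate -/

/-- The threshold estimate of `G ω β` from `u ~ N(ω, v)` and the independent `w ~ N(ω, v)`. -/
noncomputable def thresholdEstimate (N : ℕ) (v β lam n u w : ℝ) : ℝ :=
  if w < -lam then -β * u
  else if w ≤ lam then truncate n (hermiteEstimate N v β u)
  else (1 - β) * u

/-- The check function with slopes `-β` and `1 - β`. -/
noncomputable def check (β a : ℝ) : ℝ := max (-β * a) ((1 - β) * a)

/-- The size of the threshold estimate beyond that of the check function. -/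
noncomputable def estimateBound (N : ℕ) (t lam : ℝ) : ℝ := (2 * N + 2) * Real.exp (t * lam ^ 2 / 2)

lemma measurable_thresholdEstimate {v n : ℝ} (hv : 0 ≤ v) (hn : 0 ≤ n) (N : ℕ) (β lam : ℝ) :
    Measurable fun p : ℝ × ℝ => thresholdEstimate N v β lam n p.1 p.2 := by
  unfold thresholdEstimate
  refine Measurable.ite (measurableSet_lt measurable_snd measurable_const) (by fun_prop) ?_
  refine Measurable.ite (measurableSet_le measurable_snd measurable_const) ?_ (by fun_prop)
  exact (measurable_truncate hn).comp ((measurable_hermiteEstimate hv N β).comp measurable_fst)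

lemma abs_thresholdEstimate_le {β n : ℝ} (hβ0 : 0 ≤ β) (hβ1 : β ≤ 1) (hn : 0 ≤ n)
    (N : ℕ) (v lam u w : ℝ) : |thresholdEstimate N v β lam n u w| ≤ |u| + n := by
  unfold thresholdEstimate
  split_ifs
  · rw [abs_mul, abs_neg, abs_of_nonneg hβ0]
    have := mul_le_of_le_one_left (abs_nonneg u) hβ1
    linarith
  · linarith [abs_truncate_le hn (hermiteEstimate N v β u), abs_nonneg u]
  · rw [abs_mul, abs_of_nonneg (by linarith)]
    have := mul_le_of_le_one_left (abs_nonneg u) (by linarith : 1 - β ≤ 1)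
    linarith

/-- On |w| ≤ lam one has 1 ≤ exp(t(lam² - w²)), which trades the indicator for a Gaussian factor
that offsets exp(u²) in the integral. -/
lemma sq_hermiteEstimate_indicator_le {v β lam t : ℝ} (hv0 : 0 ≤ v) (hv : v ≤ 1 / 2)
    (hβ0 : 0 ≤ β) (hβ1 : β ≤ 1) (ht : 1 ≤ t) (N : ℕ) (u w : ℝ) :
    (if |w| ≤ lam then hermiteEstimate N v β u ^ 2 else 0)
      ≤ estimateBound N t lam ^ 2 * Real.exp (u ^ 2 - t * w ^ 2) := by
  split_ifs with h
  · have h1 := abs_hermiteEstimate_le hv0 hv hβ0 hβ1 N u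
    have hw : w ^ 2 ≤ lam ^ 2 := by
      rw [← sq_abs w]; exact pow_le_pow_left₀ (abs_nonneg w) h 2
    rw [← sq_abs]
    calc |hermiteEstimate N v β u| ^ 2 ≤ ((2 * N + 2) * Real.exp (u ^ 2 / 2)) ^ 2 := by gcongr
      _ = (2 * N + 2) ^ 2 * Real.exp (u ^ 2) := by
          rw [mul_pow, ← Real.exp_nat_mul]; congr 2; push_cast; ring
      _ ≤ (2 * N + 2) ^ 2 * Real.exp (t * lam ^ 2 + (u ^ 2 - t * w ^ 2)) := by
          gcongr
          nlinarith
      _ = _ := by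
          rw [estimateBound, mul_pow, ← Real.exp_nat_mul, mul_assoc, ← Real.exp_add]
          congr 2; push_cast; ring
  · positivity

lemma estimateBound_nonneg (N : ℕ) (t lam : ℝ) : 0 ≤ estimateBound N t lam := by
  unfold estimateBound; positivity

/-- The mean over the added noise of the square of the polynomial part is bounded, whatever the
observation. -/
lemma integral_sq_hermiteEstimate_le {β η t : ℝ} (lam : ℝ) (hβ0 : 0 ≤ β) (hβ1 : β ≤ 1)
    (ht : 1 ≤ t) (htη : 8 * t * η ^ 2 ≤ t - 1) (N : ℕ) (a : ℝ) :
    Integrable (fun z => if |a - η * z| ≤ lam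
        then hermiteEstimate N (2 * η ^ 2) β (a + η * z) ^ 2 else 0) stdNormal ∧
    ∫ z, (if |a - η * z| ≤ lam then hermiteEstimate N (2 * η ^ 2) β (a + η * z) ^ 2 else 0)
      ∂stdNormal ≤ estimateBound N t lam ^ 2 := by
  have hη : 2 * η ^ 2 ≤ 1 / 2 := by nlinarith
  have hb : ∀ z, _ := fun z => sq_hermiteEstimate_indicator_le (lam := lam) (by positivity) hη
    hβ0 hβ1 ht N (a + η * z) (a - η * z)
  have hi := (integrable_exp_sq_sub a η ht).const_mul (estimateBound N t lam ^ 2)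
  have hm : Measurable (fun z => if |a - η * z| ≤ lam
        then hermiteEstimate N (2 * η ^ 2) β (a + η * z) ^ 2 else 0) := by
    have := measurable_hermiteEstimate (v := 2 * η ^ 2) (by positivity) N β
    refine Measurable.ite (measurableSet_le (by fun_prop) measurable_const) (by fun_prop)
      measurable_const
  have hI : Integrable (fun z => if |a - η * z| ≤ lam
        then hermiteEstimate N (2 * η ^ 2) β (a + η * z) ^ 2 else 0) stdNormal := by
    refine hi.mono' hm.aestronglyMeasurable (ae_of_all _ fun z => ?_)
    rw [Real.norm_of_nonneg (by split_ifs <;> positivity)]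
    exact hb z
  refine ⟨hI, (integral_mono hI hi hb).trans ?_⟩
  rw [integral_const_mul]
  exact mul_le_of_le_one_right (by positivity) (integral_exp_sq_sub_le a ht htη)

lemma check_of_nonpos {β a : ℝ} (ha : a ≤ 0) : check β a = -β * a :=
  max_eq_left (by nlinarith)

lemma check_of_nonneg {β a : ℝ} (ha : 0 ≤ a) : check β a = (1 - β) * a :=
  max_eq_right (by nlinarith)

lemma check_eq (β a : ℝ) : check β a = max a 0 - β * a := by
  rcases le_total a 0 with h | h
  · rw [check_of_nonpos h, max_eq_right h]; ring
  · rw [check_of_nonneg h, max_eq_left h]; ring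

lemma abs_check_sub_le {β : ℝ} (hβ0 : 0 ≤ β) (hβ1 : β ≤ 1) (a b : ℝ) :
    |check β a - check β b| ≤ |a - b| := by
  refine (abs_max_sub_max_le_max _ _ _ _).trans (max_le ?_ ?_)
  · rw [← mul_sub, abs_mul, abs_neg, abs_of_nonneg hβ0]
    exact mul_le_of_le_one_left (abs_nonneg _) hβ1
  · rw [← mul_sub, abs_mul, abs_of_nonneg (by linarith)]
    exact mul_le_of_le_one_left (abs_nonneg _) (by linarith)

lemma abs_check_le {β : ℝ} (hβ0 : 0 ≤ β) (hβ1 : β ≤ 1) (a : ℝ) : |check β a| ≤ |a| := by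
  simpa [check] using abs_check_sub_le hβ0 hβ1 a 0

lemma integral_sq_stdNormal : ∫ z : ℝ, z ^ 2 ∂stdNormal = 1 := by
  have := integral_mul_polynomial_stdNormal (𝕜 := ℝ) Polynomial.X
  simpa [sq] using this

lemma integral_abs_stdNormal_le : ∫ z : ℝ, |z| ∂stdNormal ≤ 1 := by
  have h2 := integrable_pow_gaussianReal 0 1 2
  calc ∫ z : ℝ, |z| ∂stdNormal ≤ ∫ z : ℝ, (1 / 2 + 1 / 2 * z ^ 2) ∂stdNormal := by
        refine integral_mono integrable_id_stdNormal.abs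
          ((integrable_const _).add (h2.const_mul _)) fun z => ?_
        have := sq_nonneg (|z| - 1)
        have := sq_abs z
        dsimp only
        nlinarith
    _ = 1 := by
        rw [integral_add (integrable_const _) (h2.const_mul _), integral_const_mul,
          integral_sq_stdNormal]
        norm_num

lemma estimateBound_pos (N : ℕ) (t lam : ℝ) : 0 < estimateBound N t lam := by
  unfold estimateBound; positivity

lemma integrable_thresholdEstimate {v β n : ℝ} (hv : 0 ≤ v) (hβ0 : 0 ≤ β) (hβ1 : β ≤ 1)
    (hn : 0 ≤ n) (N : ℕ) (lam a η b κ : ℝ) :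
    Integrable (fun z => thresholdEstimate N v β lam n (a + η * z) (b + κ * z)) stdNormal := by
  have hm := (measurable_thresholdEstimate hv hn N β lam).comp
    (by fun_prop : Measurable fun z : ℝ => (a + η * z, b + κ * z))
  have hi : Integrable (fun z : ℝ => |a + η * z| + n) stdNormal :=
    ((integrable_const a).add (integrable_id_stdNormal.const_mul η)).abs.add (integrable_const n)
  exact hi.mono' hm.aestronglyMeasurable
    (ae_of_all _ fun z => abs_thresholdEstimate_le hβ0 hβ1 hn N v lam _ _)

/-- An outer regime uses the wrong slope only if `y` carries `a` across zero, and then |a| ≤ |y|. In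
the middle regime |a| ≤ lam + |y|, and |s| ≤ s²/(2B) + B/2 leaves only a second moment to be
integrated; `B` is chosen later as the square root of its bound. -/
lemma abs_thresholdEstimate_sub_check_le {v β lam n : ℝ} (hβ0 : 0 ≤ β) (hβ1 : β ≤ 1)
    (hn : 0 ≤ n) (hlam : 0 ≤ lam) (N : ℕ) (a y B : ℝ) (hB : 0 < B) :
    |thresholdEstimate N v β lam n (a + y) (a - y) - check β a|
      ≤ 3 * |y| + lam + (1 / (2 * B) *
        (if |a - y| ≤ lam then hermiteEstimate N v β (a + y) ^ 2 else 0) + B / 2) := by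
  have hy := abs_nonneg y
  have hy1 := le_abs_self y
  have hy2 := neg_abs_le y
  have hnn : 0 ≤ 1 / (2 * B) *
        (if |a - y| ≤ lam then hermiteEstimate N v β (a + y) ^ 2 else 0) + B / 2 := by
    have : 0 ≤ (if |a - y| ≤ lam then hermiteEstimate N v β (a + y) ^ 2 else 0) := by
      split_ifs <;> positivity
    positivity
  have hβy0 : 0 ≤ β * |y| := by positivity
  have hβy1 : β * |y| ≤ |y| := mul_le_of_le_one_left hy hβ1
  set q := (if |a - y| ≤ lam then hermiteEstimate N v β (a + y) ^ 2 else 0) with hq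
  unfold thresholdEstimate
  split_ifs with h1 h2
  · suffices h : |-β * (a + y) - check β a| ≤ 3 * |y| by linarith
    rcases le_total a 0 with h | h
    · rw [check_of_nonpos h, ← mul_sub, abs_mul, abs_neg, abs_of_nonneg hβ0]
      simp only [add_sub_cancel_left]
      linarith
    · rw [check_of_nonneg h, abs_le]
      constructor <;> nlinarith
  · have hV : |a - y| ≤ lam := abs_le.2 ⟨by linarith, h2⟩
    rw [hq, if_pos hV]
    have e1 := abs_sub (truncate n (hermiteEstimate N v β (a + y))) (check β a)
    have e2 := abs_truncate_le_abs hn (hermiteEstimate N v β (a + y))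
    have e3 := abs_check_le hβ0 hβ1 a
    have e4 : |a| ≤ |a - y| + |y| := by simpa using abs_add_le (a - y) y
    set s := hermiteEstimate N v β (a + y)
    have e5 : |s| ≤ 1 / (2 * B) * s ^ 2 + B / 2 := by
      rw [← sq_abs s]
      have : 0 ≤ 1 / (2 * B) * (|s| - B) ^ 2 := by positivity
      have e : 1 / (2 * B) * (|s| - B) ^ 2 = 1 / (2 * B) * |s| ^ 2 + B / 2 - |s| := by
        field_simp
        ring
      linarith
    linarith
  · suffices h : |(1 - β) * (a + y) - check β a| ≤ 3 * |y| by linarith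
    have h3 : lam < a - y := not_le.1 h2
    rcases le_total a 0 with h | h
    · rw [check_of_nonpos h, abs_le]
      constructor <;> nlinarith
    · rw [check_of_nonneg h, ← mul_sub, abs_mul, abs_of_nonneg (by linarith)]
      simp only [add_sub_cancel_left]
      linarith

/-- The randomized threshold estimate is close to the check function, whatever the observation. -/
lemma abs_integral_thresholdEstimate_sub_check_le {β η t lam n : ℝ} (hβ0 : 0 ≤ β) (hβ1 : β ≤ 1)
    (ht : 1 ≤ t) (htη : 8 * t * η ^ 2 ≤ t - 1) (hn : 0 ≤ n) (hlam : 0 ≤ lam) (N : ℕ) (a : ℝ) :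
    |(∫ z, thresholdEstimate N (2 * η ^ 2) β lam n (a + η * z) (a - η * z) ∂stdNormal)
        - check β a| ≤ 3 + lam + estimateBound N t lam := by
  set B := estimateBound N t lam with hBdef
  have hB : 0 < B := estimateBound_pos N t lam
  have hη : |η| ≤ 1 := by
    rw [← sq_le_one_iff_abs_le_one]; nlinarith
  obtain ⟨hsi, hsb⟩ := integral_sq_hermiteEstimate_le lam hβ0 hβ1 ht htη N a
  have hI := integrable_thresholdEstimate (v := 2 * η ^ 2) (by positivity) hβ0 hβ1 hn N lam a η a (-η)
  simp only [neg_mul, ← sub_eq_add_neg] at hI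
  have hc : (∫ z, thresholdEstimate N (2 * η ^ 2) β lam n (a + η * z) (a - η * z) ∂stdNormal)
        - check β a = ∫ z, (thresholdEstimate N (2 * η ^ 2) β lam n (a + η * z) (a - η * z)
          - check β a) ∂stdNormal := by
    rw [integral_sub hI (integrable_const _)]; simp
  have hbd : Integrable (fun z => 3 * |z| + lam + (1 / (2 * B) *
      (if |a - η * z| ≤ lam then hermiteEstimate N (2 * η ^ 2) β (a + η * z) ^ 2 else 0) + B / 2))
      stdNormal :=
    ((integrable_id_stdNormal.abs.const_mul 3).add (integrable_const lam)).add
      ((hsi.const_mul _).add (integrable_const _))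
  rw [hc, ← Real.norm_eq_abs]
  refine (norm_integral_le_of_norm_le hbd (ae_of_all _ fun z => ?_)).trans ?_
  · refine (abs_thresholdEstimate_sub_check_le hβ0 hβ1 hn hlam N a (η * z) B hB).trans ?_
    have : |η * z| ≤ |z| := by
      rw [abs_mul]; exact mul_le_of_le_one_left (abs_nonneg z) hη
    linarith
  · rw [integral_add (by exact (integrable_id_stdNormal.abs.const_mul 3).add (integrable_const lam))
      (by exact (hsi.const_mul _).add (integrable_const _)),
      integral_add (integrable_id_stdNormal.abs.const_mul 3) (integrable_const lam),
      integral_add (hsi.const_mul _) (integrable_const _), integral_const_mul, integral_const_mul]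
    have h1 : 1 / (2 * B) * ∫ z, (if |a - η * z| ≤ lam
        then hermiteEstimate N (2 * η ^ 2) β (a + η * z) ^ 2 else 0) ∂stdNormal ≤ B / 2 := by
      calc _ ≤ 1 / (2 * B) * B ^ 2 := by gcongr
        _ = B / 2 := by field_simp
    have h2 := integral_abs_stdNormal_le
    simp only [integral_const, probReal_univ, smul_eq_mul, one_mul]
    linarith

/-! ### The bias of the threshold estimate -/

lemma one_add_le_two_mul_exp {x : ℝ} : 1 + x ≤ 2 * Real.exp (x ^ 2 / 2) := by
  have := Real.add_one_le_exp (x ^ 2 / 2)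
  nlinarith [sq_nonneg (x - 1)]

/-- Either ω ≤ -lam/2, and G is already within exp(-lam²/8) of its asymptote, or the event is a
deviation by ω + lam ≥ lam/2. As v₀ ≤ 1/4, its probability is then at most exp(-2(ω + lam)²), which
outweighs the growth of G for positive ω. -/
lemma lower_tail_mul_le {v₀ κ lam : ℝ} (hκ : κ ^ 2 ≤ v₀) (hv₀ : 0 < v₀) (hv₁ : v₀ ≤ 1 / 4)
    (hlam : 0 ≤ lam) (β ω : ℝ) :
    stdNormal.real {z | ω + κ * z < -lam} * (G ω β + β * ω) ≤ 2 * Real.exp (-(lam ^ 2 / 8)) := by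
  have hG := G_add_nonneg ω β
  rcases le_total ω (-(lam / 2)) with h | h
  · refine (mul_le_of_le_one_left hG measureReal_le_one).trans ?_
    refine (G_add_le_of_nonpos (by linarith) β).trans ?_
    have : Real.exp (-(ω ^ 2 / 2)) ≤ Real.exp (-(lam ^ 2 / 8)) := Real.exp_le_exp.2 (by nlinarith)
    linarith [Real.exp_pos (-(lam ^ 2 / 8))]
  · have hx : 0 ≤ ω + lam := by linarith
    have ht : stdNormal.real {z | ω + κ * z < -lam} ≤ Real.exp (-(2 * (ω + lam) ^ 2)) := by
      refine (measureReal_mono (fun z hz => ?_)).trans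
        ((stdNormal_tail_le hκ hv₀ hx).trans (Real.exp_le_exp.2 ?_))
      · have : ω + κ * z < -lam := hz
        show κ * z ≤ -(ω + lam)
        linarith
      · rw [neg_le_neg_iff, le_div_iff₀ (by positivity)]
        nlinarith [sq_nonneg (ω + lam)]
    have hG2 : G ω β + β * ω ≤ 2 * Real.exp ((max ω 0) ^ 2 / 2) :=
      (G_add_le ω β).trans one_add_le_two_mul_exp
    calc _ ≤ Real.exp (-(2 * (ω + lam) ^ 2)) * (2 * Real.exp ((max ω 0) ^ 2 / 2)) := by gcongr
      _ = 2 * Real.exp (-(2 * (ω + lam) ^ 2) + (max ω 0) ^ 2 / 2) := by rw [Real.exp_add]; ring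
      _ ≤ _ := by
        gcongr
        rcases le_total ω 0 with h0 | h0
        · rw [max_eq_right h0]; nlinarith
        · rw [max_eq_left h0]; nlinarith

lemma central_prob_le {v₀ κ lam y ω : ℝ} (hκ : κ ^ 2 ≤ v₀) (hv₀ : 0 < v₀) (hy : 0 ≤ y)
    (hω : lam + y ≤ |ω|) :
    stdNormal.real {z | |ω + κ * z| ≤ lam} ≤ Real.exp (-(y ^ 2 / (2 * v₀))) := by
  rcases le_total 0 ω with h | h
  · rw [abs_of_nonneg h] at hω
    refine (measureReal_mono (fun z hz => ?_)).trans (stdNormal_tail_le hκ hv₀ hy)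
    have := (abs_le.1 (show |ω + κ * z| ≤ lam from hz)).2
    show κ * z ≤ -y
    linarith
  · rw [abs_of_nonpos h] at hω
    refine (measureReal_mono (fun z hz => ?_)).trans
      (stdNormal_tail_le (κ := -κ) (by rwa [neg_sq]) hv₀ hy)
    have := (abs_le.1 (show |ω + κ * z| ≤ lam from hz)).1
    show -κ * z ≤ -y
    linarith

lemma abs_G_le {β : ℝ} (hβ0 : 0 ≤ β) (hβ1 : β ≤ 1) (ω : ℝ) : |G ω β| ≤ 1 + |ω| := by
  have h1 := G_add_nonneg ω β
  have h2 := G_add_le ω β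
  rcases le_total 0 ω with h | h
  · rw [max_eq_left h] at h2
    rw [abs_of_nonneg h, abs_le]
    constructor <;> nlinarith
  · rw [max_eq_right h] at h2
    rw [abs_of_nonpos h, abs_le]
    constructor <;> nlinarith

/-- The error of the polynomial part of the threshold estimate. -/
lemma central_bias_le {v₀ κ lam β ℓ B Q : ℝ} {N : ℕ} (hκ : κ ^ 2 ≤ v₀) (hv₀ : 0 < v₀)
    (hv₁ : v₀ ≤ 1 / 4) (hlam : 0 ≤ lam) (hℓ : 0 ≤ ℓ) (hβ0 : 0 ≤ β) (hβ1 : β ≤ 1) (ω : ℝ)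
    (hN : Real.exp 1 ^ 2 * (lam + √v₀ * ℓ) ^ 2 ≤ N) (hB : 0 ≤ B)
    (hQ : taylorG N β ω ^ 2 ≤ Q)
    (hpQ : stdNormal.real {z | |ω + κ * z| ≤ lam} * Q ≤ B ^ 2) :
    stdNormal.real {z | |ω + κ * z| ≤ lam} * |taylorG N β ω - G ω β|
      ≤ N * Real.exp (-(N / 4)) + (B + 2 + lam) * Real.exp (-(ℓ ^ 2 / 4)) := by
  set p := stdNormal.real {z | |ω + κ * z| ≤ lam} with hp
  have hp0 : 0 ≤ p := measureReal_nonneg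
  have hp1 : p ≤ 1 := measureReal_le_one
  have he : (2 : ℝ) ≤ Real.exp 1 := by linarith [Real.exp_one_gt_d9]
  have hr0 : 0 ≤ √v₀ * ℓ := by positivity
  have hQ0 : 0 ≤ Q := (sq_nonneg _).trans hQ
  -- In the first range e²ω² ≤ N, and since e ≥ 2 the exponent eω²/2 - N/2 of the Taylor remainder
  -- is at most -N/4. In the second, the middle regime requires a deviation by y = |ω| - lam ≥ √v₀
  -- ℓ.
  rcases le_total |ω| (lam + √v₀ * ℓ) with h | h
  · have hω : Real.exp 1 ^ 2 * ω ^ 2 ≤ N := by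
      refine le_trans ?_ hN
      rw [← sq_abs ω]
      gcongr
    have hT : |taylorG N β ω - G ω β| ≤ N * Real.exp (-(N / 4)) := by
      rw [abs_sub_comm]
      refine (abs_G_sub_taylorG_le N β ω).trans ?_
      rw [mul_comm]
      have h2 : ω ^ 2 ≤ N := by
        have he2 : 1 ≤ Real.exp 1 ^ 2 := by nlinarith
        exact (le_mul_of_one_le_left (sq_nonneg ω) he2).trans hω
      have h3 : (N : ℝ) / 2 ≤ ((N + 1) / 2 : ℕ) := by
        have : N ≤ 2 * ((N + 1) / 2) := by omega
        have : (N : ℝ) ≤ 2 * (((N + 1) / 2 : ℕ) : ℝ) := by exact_mod_cast this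
        linarith
      have h4 : Real.exp 1 * (ω ^ 2 / 2) ≤ N / 4 := by
        nlinarith [mul_le_mul_of_nonneg_right he (by positivity : 0 ≤ Real.exp 1 * ω ^ 2)]
      gcongr
      linarith
    have h5 : 0 ≤ (B + 2 + lam) * Real.exp (-(ℓ ^ 2 / 4)) := by positivity
    calc _ ≤ |taylorG N β ω - G ω β| := mul_le_of_le_one_left (abs_nonneg _) hp1
      _ ≤ _ := by linarith
  · set y := |ω| - lam with hy
    have hy1 : √v₀ * ℓ ≤ y := by linarith
    have hy0 : 0 ≤ y := hr0.trans hy1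
    have hpy : p ≤ Real.exp (-(y ^ 2 / (2 * v₀))) :=
      central_prob_le hκ hv₀ hy0 (by linarith)
    have hyv : v₀ * ℓ ^ 2 ≤ y ^ 2 := by
      have := pow_le_pow_left₀ hr0 hy1 2
      rwa [mul_pow, Real.sq_sqrt hv₀.le] at this
    have hyℓ : ℓ ^ 2 ≤ y ^ 2 / v₀ := by rw [le_div_iff₀ hv₀]; linarith
    have hyy : 4 * y ^ 2 ≤ y ^ 2 / v₀ := by
      rw [le_div_iff₀ hv₀]; nlinarith [sq_nonneg y]
    have hdiv : y ^ 2 / (2 * v₀) = y ^ 2 / v₀ / 2 := by field_simp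
    have hsq : p ≤ Real.exp (-(ℓ ^ 2 / 4)) ^ 2 := by
      rw [← Real.exp_nat_mul]
      refine hpy.trans (Real.exp_le_exp.2 ?_)
      push_cast
      rw [hdiv]
      linarith
    -- Far from the centre the polynomial itself may be huge, but p times its square is at most B².
    -- Hence p|T| = √p √(pT²), and √p supplies the decay.
    have h1 : p * |taylorG N β ω| ≤ B * Real.exp (-(ℓ ^ 2 / 4)) := by
      refine abs_le_of_sq_le_sq' ?_ (by positivity) |>.2
      calc (p * |taylorG N β ω|) ^ 2 = p * (p * taylorG N β ω ^ 2) := by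
            rw [mul_pow, sq_abs]; ring
        _ ≤ p * (p * Q) := by gcongr
        _ ≤ Real.exp (-(ℓ ^ 2 / 4)) ^ 2 * B ^ 2 := by gcongr
        _ = _ := by ring
    -- The exponent y²/(2v₀) is split: one half gives ℓ²/4, the other absorbs the linear growth of G
    -- in y.
    have h2 : p * |G ω β| ≤ (2 + lam) * Real.exp (-(ℓ ^ 2 / 4)) := by
      have e1 : p ≤ Real.exp (-(ℓ ^ 2 / 4)) * Real.exp (-(y ^ 2 / 2)) := by
        rw [← Real.exp_add]
        refine hpy.trans (Real.exp_le_exp.2 ?_)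
        rw [hdiv]
        linarith [sq_nonneg y]
      have e2 : |G ω β| ≤ (2 + lam) * Real.exp (y ^ 2 / 2) := by
        have e3 : |ω| = lam + y := by rw [hy]; ring
        have e4 := one_add_le_two_mul_exp (x := y)
        have e5 : 1 ≤ Real.exp (y ^ 2 / 2) := Real.one_le_exp (by positivity)
        have := abs_G_le hβ0 hβ1 ω
        nlinarith
      calc p * |G ω β| ≤ (Real.exp (-(ℓ ^ 2 / 4)) * Real.exp (-(y ^ 2 / 2)))
            * ((2 + lam) * Real.exp (y ^ 2 / 2)) := by gcongr
        _ = (2 + lam) * Real.exp (-(ℓ ^ 2 / 4))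
            * (Real.exp (-(y ^ 2 / 2)) * Real.exp (y ^ 2 / 2)) := by ring
        _ = _ := by rw [← Real.exp_add]; simp
    have h3 := mul_le_mul_of_nonneg_left (abs_sub (taylorG N β ω) (G ω β)) hp0
    have h4 : 0 ≤ N * Real.exp (-(N / 4 : ℝ)) := by positivity
    linarith

lemma exists_polynomial_hermiteEstimate {v : ℝ} (hv : 0 ≤ v) (N : ℕ) (β : ℝ) :
    ∃ P : Polynomial ℝ, ∀ u, hermiteEstimate N v β u = P.eval u := by
  refine ⟨Polynomial.C (G 0 β) + Polynomial.C (deriv (fun w => G w β) 0) * Polynomial.X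
    + Polynomial.C (stdPdf 0) * ∑ k ∈ Finset.range N,
      Polynomial.C ((-1) ^ k * hermiteZero k / (k + 2).factorial) * heatPoly v (k + 2), fun u => ?_⟩
  rw [hermiteEstimate_eq hv]
  simp [Polynomial.eval_finsetSum]

lemma integrable_sq_hermiteEstimate (N : ℕ) (β ω κ : ℝ) :
    Integrable (fun z => hermiteEstimate N (κ ^ 2) β (ω + κ * z) ^ 2) stdNormal := by
  obtain ⟨P, hP⟩ := exists_polynomial_hermiteEstimate (sq_nonneg κ) N β
  have := integrable_polynomial_gaussianReal (𝕜 := ℝ) 0 1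
    ((P ^ 2).comp (Polynomial.C ω + Polynomial.C κ * Polynomial.X))
  simpa [hP] using this

/-- Jensen's inequality for an unbiased estimate: its variance is nonnegative. -/
lemma sq_taylorG_le (N : ℕ) (β ω κ : ℝ) :
    taylorG N β ω ^ 2 ≤ ∫ z, hermiteEstimate N (κ ^ 2) β (ω + κ * z) ^ 2 ∂stdNormal := by
  set m := taylorG N β ω
  have h2 := integrable_sq_hermiteEstimate N β ω κ
  have h1 := integrable_hermiteEstimate N β ω κ
  have h : 0 ≤ ∫ z, (hermiteEstimate N (κ ^ 2) β (ω + κ * z) - m) ^ 2 ∂stdNormal :=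
    integral_nonneg fun z => sq_nonneg _
  have e : ∀ z, (hermiteEstimate N (κ ^ 2) β (ω + κ * z) - m) ^ 2
      = hermiteEstimate N (κ ^ 2) β (ω + κ * z) ^ 2
        - (2 * m) * hermiteEstimate N (κ ^ 2) β (ω + κ * z) + m ^ 2 := fun z => by ring
  simp only [e] at h
  rw [integral_add (by exact h2.sub (h1.const_mul _)) (integrable_const _),
    integral_sub h2 (h1.const_mul _), integral_const_mul, integral_hermiteEstimate] at h
  simp only [integral_const, probReal_univ, smul_eq_mul, one_mul] at h
  have : 2 * m * taylorG N β ω = 2 * m ^ 2 := by ring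
  linarith

/-- The second moment of the polynomial part of the threshold estimate. -/
lemma central_prob_mul_sq_le {β η t : ℝ} (lam : ℝ) (hβ0 : 0 ≤ β) (hβ1 : β ≤ 1)
    (ht : 1 ≤ t) (htη : 8 * t * η ^ 2 ≤ t - 1) (N : ℕ) (ω : ℝ) :
    stdNormal.real {z | |ω + √2 * η * z| ≤ lam}
        * ∫ z, hermiteEstimate N ((√2 * η) ^ 2) β (ω + √2 * η * z) ^ 2 ∂stdNormal
      ≤ estimateBound N t lam ^ 2 := by
  set κ := √2 * η with hκ
  have hκ2 : κ ^ 2 = 2 * η ^ 2 := by rw [hκ, mul_pow, Real.sq_sqrt (by norm_num)]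
  have hm : MeasurableSet {z : ℝ | |ω + κ * z| ≤ lam} := measurableSet_le (by fun_prop) (by fun_prop)
  set f : ℝ × ℝ → ℝ := fun q => if |ω + η * q.2| ≤ lam
    then hermiteEstimate N (2 * η ^ 2) β (ω + η * q.1) ^ 2 else 0 with hf
  have hfm : Measurable f := by
    have := measurable_hermiteEstimate (v := 2 * η ^ 2) (by positivity) N β
    exact Measurable.ite (measurableSet_le (by fun_prop) measurable_const) (by fun_prop)
      measurable_const
  -- One integral is evaluated twice. In the rotated variables the estimate and the event are
  -- independent, and it factorizes into the left side of the claim. In the original ones the first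
  -- variable plays the part of the observation, and the integral over the second is bounded
  -- uniformly in it.
  have h1 := integral_add_sub_stdNormal hfm
  have h2 : ∫ p : ℝ × ℝ, f (√2 * p.1, √2 * p.2) ∂(stdNormal.prod stdNormal)
      = (∫ z, hermiteEstimate N (κ ^ 2) β (ω + κ * z) ^ 2 ∂stdNormal)
        * stdNormal.real {z | |ω + κ * z| ≤ lam} := by
    rw [← integral_indicator_one hm, ← integral_prod_mul]
    refine integral_congr_ae (ae_of_all _ fun p => ?_)
    simp only [hf, hκ2]
    rw [show ω + η * (√2 * p.2) = ω + κ * p.2 by rw [hκ]; ring,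
      show ω + η * (√2 * p.1) = ω + κ * p.1 by rw [hκ]; ring]
    by_cases h : |ω + κ * p.2| ≤ lam
    · rw [if_pos h, Set.indicator_of_mem (by exact h), Pi.one_apply, mul_one]
    · rw [if_neg h, Set.indicator_of_notMem (by exact h), mul_zero]
  rw [mul_comm, ← h2, ← h1]
  by_cases hi : Integrable (fun p : ℝ × ℝ => f (p.1 + p.2, p.1 - p.2)) (stdNormal.prod stdNormal)
  · rw [integral_prod _ hi]
    have hb : ∀ x : ℝ, ∫ y, f (x + y, x - y) ∂stdNormal ≤ estimateBound N t lam ^ 2 := by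
      intro x
      have := (integral_sq_hermiteEstimate_le lam hβ0 hβ1 ht htη N (ω + η * x)).2
      refine le_of_eq_of_le (integral_congr_ae (ae_of_all _ fun y => ?_)) this
      simp only [hf]
      rw [show ω + η * (x - y) = ω + η * x - η * y by ring,
        show ω + η * (x + y) = ω + η * x + η * y by ring]
    calc _ ≤ ∫ _x : ℝ, estimateBound N t lam ^ 2 ∂stdNormal :=
          integral_mono hi.integral_prod_left (integrable_const _) hb
      _ = _ := by simp
  -- Without integrability the integral is 0 by convention and the bound is trivial.
  · rw [integral_undef hi]
    positivity

lemma abs_integral_truncate_sub_taylorG_le {n : ℝ} (hn : 0 < n) (N : ℕ) (β ω κ : ℝ) :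
    |(∫ z, truncate n (hermiteEstimate N (κ ^ 2) β (ω + κ * z)) ∂stdNormal) - taylorG N β ω|
      ≤ (∫ z, hermiteEstimate N (κ ^ 2) β (ω + κ * z) ^ 2 ∂stdNormal) / n := by
  have h1 := integrable_hermiteEstimate N β ω κ
  have hm : Measurable fun z => truncate n (hermiteEstimate N (κ ^ 2) β (ω + κ * z)) :=
    (measurable_truncate hn.le).comp
      ((measurable_hermiteEstimate (sq_nonneg κ) N β).comp (by fun_prop))
  have h0 : Integrable (fun z => truncate n (hermiteEstimate N (κ ^ 2) β (ω + κ * z)))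
      stdNormal :=
    Integrable.of_bound hm.aestronglyMeasurable n (ae_of_all _ fun z => abs_truncate_le hn.le _)
  rw [← integral_hermiteEstimate N β ω κ, ← integral_sub h0 h1, ← integral_div,
    ← Real.norm_eq_abs]
  exact norm_integral_le_of_norm_le ((integrable_sq_hermiteEstimate N β ω κ).div_const n)
    (ae_of_all _ fun z => abs_truncate_sub_le hn _)

/-- The bias of the threshold estimate, uniformly in the mean `ω` of the observation. -/
lemma abs_integral_thresholdEstimate_sub_G_le {β η t lam n v₀ ℓ : ℝ} {N : ℕ} (hβ0 : 0 ≤ β)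
    (hβ1 : β ≤ 1) (ht : 1 ≤ t) (htη : 8 * t * η ^ 2 ≤ t - 1) (hn : 0 < n) (hlam : 0 ≤ lam)
    (hη : 2 * η ^ 2 ≤ v₀) (hv₀ : 0 < v₀) (hv₁ : v₀ ≤ 1 / 4) (hℓ : 0 ≤ ℓ)
    (hN : Real.exp 1 ^ 2 * (lam + √v₀ * ℓ) ^ 2 ≤ N) (ω : ℝ) :
    |(∫ p : ℝ × ℝ, thresholdEstimate N (2 * η ^ 2) β lam n (ω + η * (p.1 + p.2))
        (ω + η * (p.1 - p.2)) ∂(stdNormal.prod stdNormal)) - G ω β|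
      ≤ 4 * Real.exp (-(lam ^ 2 / 8)) + estimateBound N t lam ^ 2 / n
        + (N * Real.exp (-(N / 4)) + (estimateBound N t lam + 2 + lam) * Real.exp (-(ℓ ^ 2 / 4))) := by
  set B := estimateBound N t lam with hB
  set κ := √2 * η with hκ
  have hκ2 : κ ^ 2 = 2 * η ^ 2 := by rw [hκ, mul_pow, Real.sq_sqrt (by norm_num)]
  set f : ℝ × ℝ → ℝ := fun q => thresholdEstimate N (κ ^ 2) β lam n (ω + η * q.1) (ω + η * q.2)
    with hf
  have hfm : Measurable f :=
    (measurable_thresholdEstimate (sq_nonneg κ) hn.le N β lam).comp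
      (by fun_prop : Measurable fun q : ℝ × ℝ => (ω + η * q.1, ω + η * q.2))
  set τ := ∫ z, truncate n (hermiteEstimate N (κ ^ 2) β (ω + κ * z)) ∂stdNormal with hτ
  set A₁ := {z : ℝ | ω + κ * z < -lam} with hA₁
  set A₂ := {z : ℝ | |ω + κ * z| ≤ lam} with hA₂
  -- The upper regime is written as a lower tail for -ω and -κ, so that the reflection `G_neg`
  -- reduces it to the lower one.
  set A₃ := {z : ℝ | -ω + -κ * z < -lam} with hA₃
  have m₁ : MeasurableSet A₁ := measurableSet_lt (by fun_prop) (by fun_prop)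
  have m₂ : MeasurableSet A₂ := measurableSet_le (by fun_prop) (by fun_prop)
  have m₃ : MeasurableSet A₃ := measurableSet_lt (by fun_prop) (by fun_prop)
  have hfi : Integrable (fun p : ℝ × ℝ => f (√2 * p.1, √2 * p.2)) (stdNormal.prod stdNormal) := by
    have hb : Integrable (fun p : ℝ × ℝ => |ω + κ * p.1| + n) (stdNormal.prod stdNormal) := by
      refine Integrable.add (Integrable.abs ((integrable_const ω).add ?_)) (integrable_const n)
      exact (integrable_id_stdNormal.comp_fst stdNormal).const_mul κ
    refine hb.mono' (hfm.comp (by fun_prop)).aestronglyMeasurable (ae_of_all _ fun p => ?_)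
    refine (abs_thresholdEstimate_le hβ0 hβ1 hn.le N _ lam _ _).trans (le_of_eq ?_)
    congr 2
    rw [hκ]; ring
  have hinner : ∀ y : ℝ, ∫ x, f (√2 * x, √2 * y) ∂stdNormal - G ω β
      = A₁.indicator 1 y * (-β * ω - G ω β) + A₂.indicator 1 y * (τ - G ω β)
        + A₃.indicator 1 y * ((1 - β) * ω - G ω β) := by
    intro y
    have e1 : ∀ x : ℝ, ω + η * (√2 * x) = ω + κ * x := fun x => by rw [hκ]; ring
    have hU : ∫ x, (ω + κ * x) ∂stdNormal = ω := by
      rw [integral_add (integrable_const _) (integrable_id_stdNormal.const_mul _),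
        integral_const_mul, integral_id_gaussianReal]
      simp
    simp only [hf, thresholdEstimate, e1]
    by_cases h1 : ω + κ * y < -lam
    · have h2 : y ∉ A₂ := fun h => by
        have := (abs_le.1 (show |ω + κ * y| ≤ lam from h)).1; linarith
      have h3 : y ∉ A₃ := fun h => by
        have : -ω + -κ * y < -lam := h
        linarith
      simp only [if_pos h1, Set.indicator_of_mem (show y ∈ A₁ from h1),
        Set.indicator_of_notMem h2, Set.indicator_of_notMem h3, Pi.one_apply]
      rw [integral_const_mul, hU]
      ring
    · by_cases h2 : ω + κ * y ≤ lam
      · have h3 : y ∉ A₃ := fun h => by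
          have : -ω + -κ * y < -lam := h
          linarith
        simp only [if_neg h1, if_pos h2, Set.indicator_of_notMem (show y ∉ A₁ from h1),
          Set.indicator_of_mem (show y ∈ A₂ from abs_le.2 ⟨by linarith, h2⟩),
          Set.indicator_of_notMem h3, Pi.one_apply]
        rw [← hτ]
        ring
      · have h4 : y ∉ A₂ := fun h => h2 (abs_le.1 (show |ω + κ * y| ≤ lam from h)).2
        have h3 : y ∈ A₃ := by
          show -ω + -κ * y < -lam
          linarith
        simp only [if_neg h1, if_neg h2, Set.indicator_of_notMem (show y ∉ A₁ from h1),
          Set.indicator_of_notMem h4, Set.indicator_of_mem h3, Pi.one_apply]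
        rw [integral_const_mul, hU]
        ring
  have i : ∀ {A : Set ℝ}, MeasurableSet A → ∀ c : ℝ,
      Integrable (fun y => A.indicator 1 y * c) stdNormal := fun hA c =>
    ((integrable_const (1 : ℝ)).indicator hA).mul_const c
  have hmain : (∫ p : ℝ × ℝ, f (p.1 + p.2, p.1 - p.2) ∂(stdNormal.prod stdNormal)) - G ω β
      = stdNormal.real A₁ * (-β * ω - G ω β) + stdNormal.real A₂ * (τ - G ω β)
        + stdNormal.real A₃ * ((1 - β) * ω - G ω β) := by
    rw [integral_add_sub_stdNormal hfm, integral_prod_symm _ hfi]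
    have : (∫ y, ∫ x, f (√2 * x, √2 * y) ∂stdNormal ∂stdNormal) - G ω β
        = ∫ y, ((∫ x, f (√2 * x, √2 * y) ∂stdNormal) - G ω β) ∂stdNormal := by
      rw [integral_sub hfi.integral_prod_right (integrable_const _)]; simp
    rw [this]
    simp only [hinner]
    rw [integral_add (by exact (i m₁ _).add (i m₂ _)) (i m₃ _), integral_add (i m₁ _) (i m₂ _),
      integral_mul_const, integral_mul_const, integral_mul_const, integral_indicator_one m₁,
      integral_indicator_one m₂, integral_indicator_one m₃]
  have hκv : κ ^ 2 ≤ v₀ := by rw [hκ2]; exact hη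
  have b₁ := lower_tail_mul_le hκv hv₀ hv₁ hlam β ω
  have b₃ := lower_tail_mul_le (κ := -κ) (by rwa [neg_sq]) hv₀ hv₁ hlam (1 - β) (-ω)
  rw [G_neg] at b₃
  have n₁ : 0 ≤ stdNormal.real A₁ * (G ω β + β * ω) :=
    mul_nonneg measureReal_nonneg (G_add_nonneg ω β)
  have n₃ : 0 ≤ stdNormal.real A₃ * (G ω β + (1 - β) * -ω) := by
    refine mul_nonneg measureReal_nonneg ?_
    have := G_add_nonneg (-ω) (1 - β)
    rwa [G_neg] at this
  set Q := ∫ z, hermiteEstimate N (κ ^ 2) β (ω + κ * z) ^ 2 ∂stdNormal with hQ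
  have hpQ : stdNormal.real A₂ * Q ≤ B ^ 2 := central_prob_mul_sq_le lam hβ0 hβ1 ht htη N ω
  have b₂ := central_bias_le hκv hv₀ hv₁ hlam hℓ hβ0 hβ1 ω hN (estimateBound_nonneg N t lam)
    (sq_taylorG_le N β ω κ) hpQ
  have b₂' : stdNormal.real A₂ * |τ - taylorG N β ω| ≤ B ^ 2 / n := by
    calc _ ≤ stdNormal.real A₂ * (Q / n) :=
          mul_le_mul_of_nonneg_left (abs_integral_truncate_sub_taylorG_le hn N β ω κ)
            measureReal_nonneg
      _ = stdNormal.real A₂ * Q / n := by ring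
      _ ≤ B ^ 2 / n := by gcongr
  have b₂'' : |stdNormal.real A₂ * (τ - G ω β)| ≤ stdNormal.real A₂ * |τ - taylorG N β ω|
      + stdNormal.real A₂ * |taylorG N β ω - G ω β| := by
    rw [abs_mul, abs_of_nonneg measureReal_nonneg, ← mul_add]
    exact mul_le_mul_of_nonneg_left (abs_sub_le _ _ _) measureReal_nonneg
  have hgoal : (∫ p : ℝ × ℝ, thresholdEstimate N (2 * η ^ 2) β lam n (ω + η * (p.1 + p.2))
        (ω + η * (p.1 - p.2)) ∂(stdNormal.prod stdNormal))
      = ∫ p : ℝ × ℝ, f (p.1 + p.2, p.1 - p.2) ∂(stdNormal.prod stdNormal) := by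
    simp only [hf, hκ2]
  rw [hgoal, hmain]
  have a₁ : |stdNormal.real A₁ * (-β * ω - G ω β)| ≤ 2 * Real.exp (-(lam ^ 2 / 8)) := by
    rw [show stdNormal.real A₁ * (-β * ω - G ω β) = -(stdNormal.real A₁ * (G ω β + β * ω)) by ring,
      abs_neg, abs_of_nonneg n₁]
    exact b₁
  have a₃ : |stdNormal.real A₃ * ((1 - β) * ω - G ω β)| ≤ 2 * Real.exp (-(lam ^ 2 / 8)) := by
    rw [show stdNormal.real A₃ * ((1 - β) * ω - G ω β)
      = -(stdNormal.real A₃ * (G ω β + (1 - β) * -ω)) by ring, abs_neg, abs_of_nonneg n₃]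
    exact b₃
  refine (abs_add_three _ _ _).trans ?_
  linarith

/-! ### A Gaussian pair under a small linear perturbation -/

/-- Subtraction of `ε (x + y)` from both coordinates. -/
noncomputable def subSum (ε : ℝ) (p : ℝ × ℝ) : ℝ × ℝ := (p.1 - ε * (p.1 + p.2), p.2 - ε * (p.1 + p.2))

lemma measurable_subSum (ε : ℝ) : Measurable (subSum ε) := by unfold subSum; fun_prop

lemma subSum_subSum {ε : ℝ} (hε : 1 - 2 * ε ≠ 0) (p : ℝ × ℝ) :
    subSum (-(ε / (1 - 2 * ε))) (subSum ε p) = p := by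
  have h : ε / (1 - 2 * ε) * (1 - 2 * ε) = ε := div_mul_cancel₀ _ hε
  ext <;> simp only [subSum] <;> linear_combination (p.1 + p.2) * h

lemma map_subSum_volume {ε : ℝ} (hε : 0 < 1 - 2 * ε) :
    (volume : Measure (ℝ × ℝ)).map (subSum ε)
      = ENNReal.ofReal (1 - 2 * ε)⁻¹ • (volume : Measure (ℝ × ℝ)) := by
  set f := Matrix.toLin (Module.Basis.finTwoProd ℝ) (Module.Basis.finTwoProd ℝ)
    !![1 - ε, -ε; -ε, 1 - ε] with hf
  have hdet : LinearMap.det f = 1 - 2 * ε := by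
    rw [hf, LinearMap.det_toLin, Matrix.det_fin_two_of]; ring
  have h := Measure.map_linearMap_addHaar_eq_smul_addHaar (volume : Measure (ℝ × ℝ)) (f := f)
    (by rw [hdet]; exact hε.ne')
  rw [hdet, abs_of_pos (inv_pos.2 hε)] at h
  rw [← h]
  congr 1
  ext p
  · rw [hf, Matrix.toLin_finTwoProd_apply]; simp only [subSum]; ring
  · rw [hf, Matrix.toLin_finTwoProd_apply]; simp only [subSum]; ring

/-- The change of variables moves the perturbation from `F` onto the density `φ`, so that no
smoothness of `F` is needed. The inverse of the map is of the same kind, with parameter -ε/(1 - 2ε).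
-/
lemma integral_subSum {ε : ℝ} (hε : 0 < 1 - 2 * ε) {F φ : ℝ × ℝ → ℝ} (hF : Measurable F)
    (hφ : Measurable φ) :
    ∫ p, F (subSum ε p) * φ p
      = (1 - 2 * ε)⁻¹ * ∫ q, F q * φ (subSum (-(ε / (1 - 2 * ε))) q) := by
  have h : ∫ q, F q * φ (subSum (-(ε / (1 - 2 * ε))) q) ∂((volume : Measure (ℝ × ℝ)).map (subSum ε))
      = ∫ p, F (subSum ε p) * φ p := by
    rw [integral_map (measurable_subSum ε).aemeasurable
      (by exact (hF.mul (hφ.comp (measurable_subSum _))).aestronglyMeasurable)]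
    simp only [subSum_subSum hε.ne']
  rw [← h, map_subSum_volume hε, integral_smul_measure,
    ENNReal.toReal_ofReal (inv_pos.2 hε).le, smul_eq_mul]

lemma integral_gaussian_prod {σ₁ σ₂ : ℝ≥0} (h₁ : σ₁ ≠ 0) (h₂ : σ₂ ≠ 0) (F : ℝ × ℝ → ℝ) :
    ∫ p, F p ∂((gaussianReal 0 σ₁).prod (gaussianReal 0 σ₂))
      = ∫ p : ℝ × ℝ, F p * (gaussianPDFReal 0 σ₁ p.1 * gaussianPDFReal 0 σ₂ p.2) := by
  have m₁ := measurable_gaussianPDF 0 σ₁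
  have m₂ := measurable_gaussianPDF 0 σ₂
  rw [gaussianReal_of_var_ne_zero _ h₁, gaussianReal_of_var_ne_zero _ h₂,
    prod_withDensity m₁ m₂, integral_withDensity_eq_integral_toReal_smul (by fun_prop)
      (ae_of_all _ fun p => ENNReal.mul_lt_top gaussianPDF_lt_top gaussianPDF_lt_top)]
  · refine integral_congr_ae (ae_of_all _ fun p => ?_)
    simp only [ENNReal.toReal_mul, toReal_gaussianPDF, smul_eq_mul]
    ring

lemma abs_exp_neg_sub_le {a b m : ℝ} (ha : m ≤ a) (hb : m ≤ b) :
    |Real.exp (-a) - Real.exp (-b)| ≤ |a - b| * Real.exp (-m) := by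
  wlog h : a ≤ b generalizing a b
  · rw [abs_sub_comm, abs_sub_comm a b]
    exact this hb ha (le_of_not_ge h)
  rw [abs_of_nonneg (sub_nonneg.2 (Real.exp_le_exp.2 (by linarith))), abs_of_nonpos (by linarith)]
  have h1 : Real.exp (-b) = Real.exp (-a) * Real.exp (-(b - a)) := by
    rw [← Real.exp_add]; congr 1; ring
  have h2 := Real.add_one_le_exp (-(b - a))
  have h3 : Real.exp (-a) ≤ Real.exp (-m) := Real.exp_le_exp.2 (by linarith)
  rw [h1]
  nlinarith [Real.exp_pos (-a)]

/-- The dominating function for the densities of a Gaussian pair. -/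
noncomputable def pairMajorant (s₁ x : ℝ) : ℝ := (1 + |x|) * (1 + x ^ 2) * Real.exp (-(x ^ 2 / (4 * s₁)))

lemma pairMajorant_nonneg (s₁ x : ℝ) : 0 ≤ pairMajorant s₁ x := by unfold pairMajorant; positivity

lemma integrable_pairMajorant {s₁ : ℝ} (hs : 0 < s₁) : Integrable (pairMajorant s₁) := by
  have hv : ((Real.toNNReal (2 * s₁) : ℝ≥0) : ℝ) = 2 * s₁ := Real.coe_toNNReal _ (by positivity)
  have h := (integrable_gaussianReal_iff (v := Real.toNNReal (2 * s₁)) (by simpa using hs)).1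
    (integrable_polynomial_gaussianReal (𝕜 := ℝ) 0 (Real.toNNReal (2 * s₁))
      ((2 + Polynomial.X ^ 2) * (1 + Polynomial.X ^ 2)))
  refine (h.const_mul √(2 * Real.pi * (2 * s₁))).mono'
    (by unfold pairMajorant; fun_prop) (ae_of_all _ fun x => ?_)
  rw [Real.norm_of_nonneg (pairMajorant_nonneg s₁ x)]
  have hr : √(2 * Real.pi * (2 * s₁)) ≠ 0 := by positivity
  simp only [gaussianPDFReal, smul_eq_mul, hv, RCLike.ofReal_real_eq_id, id_eq,
    Polynomial.eval_mul, Polynomial.eval_add, Polynomial.eval_pow, Polynomial.eval_X,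
    Polynomial.eval_one, Polynomial.eval_ofNat]
  rw [mul_assoc _ (Real.exp _), mul_inv_cancel_left₀ hr, pairMajorant,
    show -(x - 0) ^ 2 / (2 * (2 * s₁)) = -(x ^ 2 / (4 * s₁)) by ring, mul_comm]
  have hx : 1 + |x| ≤ 2 + x ^ 2 := by
    have := sq_nonneg (|x| - 1)
    have := sq_abs x
    nlinarith
  gcongr

/-- The joint density of two centred normal variables. -/
noncomputable def pairDensity (σ₁ σ₂ : ℝ≥0) (p : ℝ × ℝ) : ℝ :=
  gaussianPDFReal 0 σ₁ p.1 * gaussianPDFReal 0 σ₂ p.2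

lemma measurable_pairDensity (σ₁ σ₂ : ℝ≥0) : Measurable (pairDensity σ₁ σ₂) :=
  ((measurable_gaussianPDFReal 0 σ₁).comp measurable_fst).mul
    ((measurable_gaussianPDFReal 0 σ₂).comp measurable_snd)

/-- The energy of a point under the joint density. -/
noncomputable def pairEnergy (σ₁ σ₂ : ℝ≥0) (p : ℝ × ℝ) : ℝ :=
  p.1 ^ 2 / (2 * σ₁) + p.2 ^ 2 / (2 * σ₂)

lemma pairDensity_eq (σ₁ σ₂ : ℝ≥0) (p : ℝ × ℝ) :
    pairDensity σ₁ σ₂ p = pairDensity σ₁ σ₂ 0 * Real.exp (-pairEnergy σ₁ σ₂ p) := by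
  simp only [pairDensity, pairEnergy, gaussianPDFReal]
  have : Real.exp (-(p.1 ^ 2 / (2 * (σ₁ : ℝ)) + p.2 ^ 2 / (2 * (σ₂ : ℝ))))
      = Real.exp (-(p.1 - 0) ^ 2 / (2 * (σ₁ : ℝ))) * Real.exp (-(p.2 - 0) ^ 2 / (2 * (σ₂ : ℝ))) := by
    rw [← Real.exp_add]; congr 1; ring
  rw [this]
  simp
  ring

lemma pairDensity_zero_le {s₀ : ℝ} (hs₀ : 0 < s₀) {σ₁ σ₂ : ℝ≥0} (h₁ : s₀ ≤ σ₁) (h₂ : s₀ ≤ σ₂) :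
    pairDensity σ₁ σ₂ 0 ≤ s₀⁻¹ := by
  have h : ∀ σ : ℝ≥0, s₀ ≤ σ → gaussianPDFReal 0 σ 0 ≤ (√s₀)⁻¹ := by
    intro σ hσ
    simp only [gaussianPDFReal, sub_self]
    simp only [ne_eq, OfNat.ofNat_ne_zero, not_false_eq_true, zero_pow, neg_zero, zero_div,
      Real.exp_zero, mul_one]
    refine inv_anti₀ (Real.sqrt_pos.2 hs₀) (Real.sqrt_le_sqrt ?_)
    nlinarith [Real.pi_gt_three]
  have e : s₀⁻¹ = (√s₀)⁻¹ * (√s₀)⁻¹ := by rw [← mul_inv, Real.mul_self_sqrt hs₀.le]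
  rw [e]
  exact mul_le_mul (h σ₁ h₁) (h σ₂ h₂) (gaussianPDFReal_nonneg _ _ _) (by positivity)

lemma abs_pairEnergy_sub_le {s₀ δ : ℝ} (hs₀ : 0 < s₀) {σ₁ σ₂ : ℝ≥0} (h₁ : s₀ ≤ σ₁) (h₂ : s₀ ≤ σ₂)
    (hδ0 : 0 ≤ δ) (hδ1 : δ ≤ 1) (p : ℝ × ℝ) :
    |pairEnergy σ₁ σ₂ (subSum (-δ) p) - pairEnergy σ₁ σ₂ p| ≤ 5 * δ * (p.1 ^ 2 + p.2 ^ 2) / s₀ := by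
  obtain ⟨x, y⟩ := p
  simp only [subSum, pairEnergy]
  have hδδ : δ ^ 2 ≤ δ := by nlinarith
  have key : ∀ x y : ℝ, |(x - -δ * (x + y)) ^ 2 - x ^ 2| ≤ 5 * δ * (x ^ 2 + y ^ 2) := by
    intro x y
    have e : (x - -δ * (x + y)) ^ 2 - x ^ 2 = δ * (2 * x * (x + y)) + δ ^ 2 * (x + y) ^ 2 := by ring
    have e1 : |δ * (2 * x * (x + y))| ≤ δ * (3 * (x ^ 2 + y ^ 2)) := by
      rw [abs_mul, abs_of_nonneg hδ0]
      refine mul_le_mul_of_nonneg_left (abs_le.2 ⟨?_, ?_⟩) hδ0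
      · nlinarith [sq_nonneg (x + y), sq_nonneg x, sq_nonneg y]
      · nlinarith [sq_nonneg (x - y), sq_nonneg x, sq_nonneg y]
    have e2 : |δ ^ 2 * (x + y) ^ 2| ≤ δ * (2 * (x ^ 2 + y ^ 2)) := by
      rw [abs_of_nonneg (by positivity)]
      have : (x + y) ^ 2 ≤ 2 * (x ^ 2 + y ^ 2) := by nlinarith [sq_nonneg (x - y)]
      gcongr
    rw [e]
    refine (abs_add_le _ _).trans ?_
    linarith
  have div : ∀ {σ : ℝ≥0}, s₀ ≤ σ → ∀ x y : ℝ, |(x - -δ * (x + y)) ^ 2 / (2 * σ) - x ^ 2 / (2 * σ)|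
      ≤ 5 * δ * (x ^ 2 + y ^ 2) / (2 * s₀) := by
    intro σ hσ x y
    have hσ0 : (0 : ℝ) < σ := hs₀.trans_le hσ
    rw [← sub_div, abs_div, abs_of_pos (by positivity : (0 : ℝ) < 2 * σ)]
    gcongr
    exact key x y
  have d₁ := div h₁ x y
  have d₂ := div h₂ y x
  rw [add_comm y x, add_comm (y ^ 2) (x ^ 2)] at d₂
  have e : 5 * δ * (x ^ 2 + y ^ 2) / s₀ = 5 * δ * (x ^ 2 + y ^ 2) / (2 * s₀)
      + 5 * δ * (x ^ 2 + y ^ 2) / (2 * s₀) := by field_simp; ring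
  rw [e, add_sub_add_comm]
  exact (abs_add_le _ _).trans (add_le_add d₁ d₂)

lemma one_add_mul_exp_le_majorant (s₁ : ℝ) (p : ℝ × ℝ) :
    (1 + |p.1|) * (1 + |p.2|) * ((1 + (p.1 ^ 2 + p.2 ^ 2))
      * Real.exp (-((p.1 ^ 2 + p.2 ^ 2) / (4 * s₁)))) ≤ pairMajorant s₁ p.1 * pairMajorant s₁ p.2 := by
  have e : Real.exp (-((p.1 ^ 2 + p.2 ^ 2) / (4 * s₁)))
      = Real.exp (-(p.1 ^ 2 / (4 * s₁))) * Real.exp (-(p.2 ^ 2 / (4 * s₁))) := by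
    rw [← Real.exp_add]; congr 1; ring
  have h : 1 + (p.1 ^ 2 + p.2 ^ 2) ≤ (1 + p.1 ^ 2) * (1 + p.2 ^ 2) := by
    nlinarith [mul_nonneg (sq_nonneg p.1) (sq_nonneg p.2)]
  calc _ ≤ (1 + |p.1|) * (1 + |p.2|) * (((1 + p.1 ^ 2) * (1 + p.2 ^ 2))
      * (Real.exp (-(p.1 ^ 2 / (4 * s₁))) * Real.exp (-(p.2 ^ 2 / (4 * s₁))))) := by
        rw [e]; gcongr
    _ = _ := by unfold pairMajorant; ring

/-- A Gaussian pair and its perturbation by `ε (x + y)` have laws at distance `O(ε)`, uniformly for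
variances in a compact subset of `(0, ∞)`. -/
lemma exists_abs_integral_subSum_sub_le {s₀ s₁ : ℝ} (hs₀ : 0 < s₀) (hs₀₁ : s₀ ≤ s₁) :
    ∃ C : ℝ, 0 ≤ C ∧ ∃ ε₀ : ℝ, 0 < ε₀ ∧ ∀ σ₁ σ₂ : ℝ≥0, s₀ ≤ σ₁ → σ₁ ≤ s₁ → s₀ ≤ σ₂ → σ₂ ≤ s₁ →
      ∀ ε : ℝ, 0 ≤ ε → ε ≤ ε₀ → ∀ (D : ℝ) (F : ℝ × ℝ → ℝ), Measurable F → 0 ≤ D →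
      (∀ p, |F p| ≤ D * ((1 + |p.1|) * (1 + |p.2|))) →
      |(∫ p, F (subSum ε p) ∂((gaussianReal 0 σ₁).prod (gaussianReal 0 σ₂)))
        - ∫ p, F p ∂((gaussianReal 0 σ₁).prod (gaussianReal 0 σ₂))| ≤ C * ε * D := by
  have hs₁ : 0 < s₁ := hs₀.trans_le hs₀₁
  set H := ∫ p : ℝ × ℝ, pairMajorant s₁ p.1 * pairMajorant s₁ p.2 with hH
  have hHi : Integrable (fun p : ℝ × ℝ => pairMajorant s₁ p.1 * pairMajorant s₁ p.2) :=
    (integrable_pairMajorant hs₁).mul_prod (integrable_pairMajorant hs₁)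
  have hH0 : 0 ≤ H := integral_nonneg fun p =>
    mul_nonneg (pairMajorant_nonneg _ _) (pairMajorant_nonneg _ _)
  -- The factor s₀⁻¹ bounds the density at the origin, 4 comes from the Jacobian and 10/s₀ from the
  -- change of the energy. The second bound on ε keeps that change below half of the lower bound (x²
  -- + y²)/(2s₁) of the energy, so one Gaussian majorant serves both densities.
  refine ⟨s₀⁻¹ * (4 + 10 / s₀) * H, by positivity, min (1 / 4) (s₀ / (40 * s₁)), by positivity, ?_⟩
  intro σ₁ σ₂ h₁ h₁' h₂ h₂' ε hε0 hε D F hF hD hFb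
  have hε1 : ε ≤ 1 / 4 := hε.trans (min_le_left _ _)
  have hε2 : ε ≤ s₀ / (40 * s₁) := hε.trans (min_le_right _ _)
  have hσ₁ : (0 : ℝ) < σ₁ := hs₀.trans_le h₁
  have hσ₂ : (0 : ℝ) < σ₂ := hs₀.trans_le h₂
  have hne₁ : σ₁ ≠ 0 := by rintro rfl; simp at hσ₁
  have hne₂ : σ₂ ≠ 0 := by rintro rfl; simp at hσ₂
  have hdet : 0 < 1 - 2 * ε := by linarith
  set δ := ε / (1 - 2 * ε) with hδ
  have hδ0 : 0 ≤ δ := by positivity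
  have hδ2 : δ ≤ 2 * ε := by rw [hδ, div_le_iff₀ hdet]; nlinarith
  set K := pairDensity σ₁ σ₂ 0 with hK
  have hK0 : 0 ≤ K := mul_nonneg (gaussianPDFReal_nonneg _ _ _) (gaussianPDFReal_nonneg _ _ _)
  have hK1 : K ≤ s₀⁻¹ := pairDensity_zero_le hs₀ h₁ h₂
  set c := (1 - 2 * ε)⁻¹ with hc
  have hc0 : 0 ≤ c := by positivity
  have hc2 : c ≤ 2 := by rw [hc]; exact inv_le_of_inv_le₀ (by norm_num) (by linarith)
  have hc4 : |c - 1| ≤ 4 * ε := by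
    have : c - 1 = 2 * ε * c := by rw [hc]; field_simp; ring
    rw [this, abs_of_nonneg (by positivity)]
    nlinarith
  set m : ℝ × ℝ → ℝ := fun p => (p.1 ^ 2 + p.2 ^ 2) / (4 * s₁) with hm
  set ψ : ℝ × ℝ → ℝ := fun q => pairDensity σ₁ σ₂ (subSum (-δ) q) with hψ
  have hE0 : ∀ p, 2 * m p ≤ pairEnergy σ₁ σ₂ p := by
    intro p
    have e : 2 * m p = p.1 ^ 2 / (2 * s₁) + p.2 ^ 2 / (2 * s₁) := by
      simp only [hm]; field_simp; ring
    rw [e, pairEnergy]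
    gcongr
  have hm0 : ∀ p, 0 ≤ m p := fun p => by simp only [hm]; positivity
  have hEd : ∀ p, |pairEnergy σ₁ σ₂ (subSum (-δ) p) - pairEnergy σ₁ σ₂ p|
      ≤ 10 * ε * (p.1 ^ 2 + p.2 ^ 2) / s₀ := by
    intro p
    refine (abs_pairEnergy_sub_le hs₀ h₁ h₂ hδ0 (by linarith) p).trans ?_
    have : 5 * δ ≤ 10 * ε := by linarith
    gcongr
  have hE1 : ∀ p, m p ≤ pairEnergy σ₁ σ₂ (subSum (-δ) p) := by
    intro p
    have h := (abs_le.1 (hEd p)).1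
    have h3 : 10 * ε * (p.1 ^ 2 + p.2 ^ 2) / s₀ ≤ m p := by
      simp only [hm]
      rw [div_le_div_iff₀ hs₀ (by positivity)]
      rw [le_div_iff₀ (by positivity)] at hε2
      nlinarith [mul_le_mul_of_nonneg_right hε2 (by positivity : 0 ≤ p.1 ^ 2 + p.2 ^ 2)]
    linarith [hE0 p]
  have hd0 : ∀ p, pairDensity σ₁ σ₂ p ≤ K * Real.exp (-m p) := by
    intro p
    rw [pairDensity_eq]
    have : Real.exp (-pairEnergy σ₁ σ₂ p) ≤ Real.exp (-m p) :=
      Real.exp_le_exp.2 (by linarith [hE0 p, hm0 p])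
    gcongr
  have hd1 : ∀ p, ψ p ≤ K * Real.exp (-m p) := by
    intro p
    simp only [hψ]
    rw [pairDensity_eq]
    have : Real.exp (-pairEnergy σ₁ σ₂ (subSum (-δ) p)) ≤ Real.exp (-m p) :=
      Real.exp_le_exp.2 (by linarith [hE1 p])
    gcongr
  have hpos : ∀ p, 0 ≤ pairDensity σ₁ σ₂ p := fun p =>
    mul_nonneg (gaussianPDFReal_nonneg _ _ _) (gaussianPDFReal_nonneg _ _ _)
  have hmaj := one_add_mul_exp_le_majorant s₁
  have hint : ∀ χ : ℝ × ℝ → ℝ, Measurable χ → (∀ p, 0 ≤ χ p) → (∀ p, χ p ≤ K * Real.exp (-m p)) →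
      Integrable fun p => F p * χ p := by
    intro χ hχ hχ0 hχ1
    refine (hHi.const_mul (D * K)).mono' (hF.mul hχ).aestronglyMeasurable
      (ae_of_all _ fun p => ?_)
    rw [norm_mul, Real.norm_eq_abs, Real.norm_of_nonneg (hχ0 p)]
    calc |F p| * χ p ≤ (D * ((1 + |p.1|) * (1 + |p.2|))) * (K * Real.exp (-m p)) :=
          mul_le_mul (hFb p) (hχ1 p) (hχ0 p) (by positivity)
      _ ≤ (D * K) * ((1 + |p.1|) * (1 + |p.2|) * ((1 + (p.1 ^ 2 + p.2 ^ 2)) * Real.exp (-m p))) := by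
          have : Real.exp (-m p) ≤ (1 + (p.1 ^ 2 + p.2 ^ 2)) * Real.exp (-m p) :=
            le_mul_of_one_le_left (Real.exp_pos _).le (by nlinarith [sq_nonneg p.1, sq_nonneg p.2])
          calc _ = (D * K) * ((1 + |p.1|) * (1 + |p.2|) * Real.exp (-m p)) := by ring
            _ ≤ _ := by gcongr
      _ ≤ _ := mul_le_mul_of_nonneg_left (hmaj p) (by positivity)
  have hφm := measurable_pairDensity σ₁ σ₂
  have hψm : Measurable ψ := hφm.comp (measurable_subSum _)
  have i0 := hint _ hφm hpos hd0
  have i1 := hint ψ hψm (fun p => hpos _) hd1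
  rw [integral_gaussian_prod hne₁ hne₂, integral_gaussian_prod hne₁ hne₂]
  have hch := integral_subSum hdet hF hφm
  simp only [pairDensity] at hch
  rw [hch]
  have e1 : (1 - 2 * ε)⁻¹ * ∫ q, F q * (gaussianPDFReal 0 σ₁ (subSum (-(ε / (1 - 2 * ε))) q).1
      * gaussianPDFReal 0 σ₂ (subSum (-(ε / (1 - 2 * ε))) q).2) = ∫ q, c * (F q * ψ q) := by
    rw [integral_const_mul]
    rfl
  rw [e1]
  have e2 : ∫ p : ℝ × ℝ, F p * (gaussianPDFReal 0 σ₁ p.1 * gaussianPDFReal 0 σ₂ p.2)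
      = ∫ p, F p * pairDensity σ₁ σ₂ p := rfl
  rw [e2, ← integral_sub (i1.const_mul c) i0, ← Real.norm_eq_abs]
  refine (norm_integral_le_of_norm_le (hHi.const_mul (s₀⁻¹ * (4 + 10 / s₀) * ε * D))
    (ae_of_all _ fun p => ?_)).trans (le_of_eq (by rw [integral_const_mul, ← hH]; ring))
  have e3 : c * (F p * ψ p) - F p * pairDensity σ₁ σ₂ p
      = F p * ((c - 1) * ψ p + (ψ p - pairDensity σ₁ σ₂ p)) := by ring
  rw [e3, norm_mul, Real.norm_eq_abs, Real.norm_eq_abs]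
  have b1 : |(c - 1) * ψ p| ≤ 4 * ε * (K * Real.exp (-m p)) := by
    rw [abs_mul, abs_of_nonneg (hpos _ : 0 ≤ ψ p)]
    exact mul_le_mul hc4 (hd1 p) (hpos _) (by positivity)
  have b2 : |ψ p - pairDensity σ₁ σ₂ p|
      ≤ 10 * ε * (p.1 ^ 2 + p.2 ^ 2) / s₀ * (K * Real.exp (-m p)) := by
    simp only [hψ]
    rw [pairDensity_eq, pairDensity_eq _ _ p, ← mul_sub, abs_mul, abs_of_nonneg hK0]
    calc _ ≤ K * (|pairEnergy σ₁ σ₂ (subSum (-δ) p) - pairEnergy σ₁ σ₂ p| * Real.exp (-m p)) :=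
          mul_le_mul_of_nonneg_left
            (abs_exp_neg_sub_le (hE1 p) (by linarith [hE0 p, hm0 p])) hK0
      _ ≤ K * (10 * ε * (p.1 ^ 2 + p.2 ^ 2) / s₀ * Real.exp (-m p)) := by
          gcongr
          exact hEd p
      _ = _ := by ring
  have hr0 : 0 ≤ p.1 ^ 2 + p.2 ^ 2 := by positivity
  have b3 : |(c - 1) * ψ p + (ψ p - pairDensity σ₁ σ₂ p)|
      ≤ s₀⁻¹ * (4 + 10 / s₀) * ε * ((1 + (p.1 ^ 2 + p.2 ^ 2)) * Real.exp (-m p)) := by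
    refine (abs_add_le _ _).trans ((add_le_add b1 b2).trans ?_)
    calc _ = K * (ε * (4 + 10 / s₀ * (p.1 ^ 2 + p.2 ^ 2)) * Real.exp (-m p)) := by ring
      _ ≤ s₀⁻¹ * (ε * ((4 + 10 / s₀) * (1 + (p.1 ^ 2 + p.2 ^ 2))) * Real.exp (-m p)) := by
          gcongr
          have : 0 ≤ 10 / s₀ := by positivity
          nlinarith
      _ = _ := by ring
  calc _ ≤ (D * ((1 + |p.1|) * (1 + |p.2|))) * (s₀⁻¹ * (4 + 10 / s₀) * ε
        * ((1 + (p.1 ^ 2 + p.2 ^ 2)) * Real.exp (-m p))) :=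
        mul_le_mul (hFb p) b3 (abs_nonneg _) (by positivity)
    _ = (s₀⁻¹ * (4 + 10 / s₀) * ε * D) * ((1 + |p.1|) * (1 + |p.2|)
        * ((1 + (p.1 ^ 2 + p.2 ^ 2)) * Real.exp (-m p))) := by ring
    _ ≤ _ := mul_le_mul_of_nonneg_left (hmaj p) (by positivity)

/-! ### Averages of functions of observations centred at the grand mean -/

lemma memLp_of_map_gaussian {Ω : Type*} [MeasurableSpace Ω] {P : Measure Ω} {X : Ω → ℝ} (hX : Measurable X) {v : ℝ≥0}
    (h : P.map X = gaussianReal 0 v) : MemLp X 2 P := by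
  have := memLp_id_gaussianReal (μ := 0) (v := v) 2
  rw [← h] at this
  exact this.comp_of_map hX.aemeasurable

section GrandMean

variable {Ω : Type*} [MeasurableSpace Ω] {P : Measure Ω} [IsProbabilityMeasure P]
  {n : ℕ} {Δ : Fin n → Ω → ℝ} {σ : Fin n → ℝ≥0}

lemma integral_sq_average_le (hm : ∀ i, Measurable (Δ i)) (hind : iIndepFun Δ P)
    (hlaw : ∀ i, P.map (Δ i) = gaussianReal 0 (σ i)) {s₁ : ℝ} (hσ : ∀ i, (σ i : ℝ) ≤ s₁)
    (hs₁ : 0 ≤ s₁) (s : Finset (Fin n)) :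
    MemLp (fun ω => (1 / (n : ℝ)) * ∑ k ∈ s, Δ k ω) 2 P ∧
    ∫ ω, ((1 / (n : ℝ)) * ∑ k ∈ s, Δ k ω) ^ 2 ∂P ≤ s₁ / n := by
  have hL : ∀ i, MemLp (Δ i) 2 P := fun i => memLp_of_map_gaussian (hm i) (hlaw i)
  have hS : MemLp (∑ k ∈ s, Δ k) 2 P := memLp_finsetSum' s fun i _ => hL i
  have hS' : (fun ω => ∑ k ∈ s, Δ k ω) = ∑ k ∈ s, Δ k := by ext ω; simp
  have hmean : ∀ i, ∫ ω, Δ i ω ∂P = 0 := by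
    intro i
    have := integral_map (hm i).aemeasurable (f := fun x : ℝ => x)
      (μ := P) (by fun_prop)
    rw [← this, hlaw, integral_id_gaussianReal]
  have hvar : ∀ i, Var[Δ i; P] = σ i := by
    intro i
    rw [← variance_id_map (hm i).aemeasurable, hlaw, variance_id_gaussianReal]
  have h1 : Var[∑ k ∈ s, Δ k; P] = ∑ k ∈ s, (σ k : ℝ) := by
    rw [IndepFun.variance_sum (fun i _ => hL i) fun i _ j _ hij => hind.indepFun hij]
    exact Finset.sum_congr rfl fun i _ => hvar i
  have h2 : ∫ ω, (∑ k ∈ s, Δ k ω) ^ 2 ∂P = ∑ k ∈ s, (σ k : ℝ) := by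
    rw [← h1, variance_eq_sub hS]
    have : ∫ ω, (∑ k ∈ s, Δ k) ω ∂P = 0 := by
      simp only [Finset.sum_apply]
      rw [integral_finsetSum _ fun i _ => (hL i).integrable (by norm_num)]
      simp [hmean]
    rw [this]
    simp
  refine ⟨by rw [← hS'] at hS; exact hS.const_mul _, ?_⟩
  rcases Nat.eq_zero_or_pos n with rfl | hn
  · simp
  have hn' : (0 : ℝ) < n := by exact_mod_cast hn
  simp only [mul_pow]
  rw [integral_const_mul, h2]
  have h3 : ∑ k ∈ s, (σ k : ℝ) ≤ n * s₁ := by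
    calc ∑ k ∈ s, (σ k : ℝ) ≤ ∑ _k ∈ s, s₁ := Finset.sum_le_sum fun i _ => hσ i
      _ = s.card * s₁ := by simp
      _ ≤ n * s₁ := by
        gcongr
        simpa using Finset.card_le_univ s
  calc (1 / (n : ℝ)) ^ 2 * ∑ k ∈ s, (σ k : ℝ) ≤ (1 / (n : ℝ)) ^ 2 * (n * s₁) := by gcongr
    _ = s₁ / n := by field_simp

/-- The joint law of two coordinates and of the sum of the others. -/
lemma map_pair_rest (hm : ∀ i, Measurable (Δ i)) (hind : iIndepFun Δ P)
    (hlaw : ∀ i, P.map (Δ i) = gaussianReal 0 (σ i)) {i j : Fin n} (hij : i ≠ j) :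
    P.map (fun ω => ((Δ i ω, Δ j ω), (1 / (n : ℝ)) * ∑ k ∈ Finset.univ \ {i, j}, Δ k ω))
      = ((gaussianReal 0 (σ i)).prod (gaussianReal 0 (σ j))).prod
        (P.map fun ω => (1 / (n : ℝ)) * ∑ k ∈ Finset.univ \ {i, j}, Δ k ω) := by
  have h1 := hind.indepFun_finset {i, j} (Finset.univ \ {i, j}) Finset.disjoint_sdiff hm
  have h2 := h1.comp
    (φ := fun f : ({i, j} : Finset (Fin n)) → ℝ =>
      (f ⟨i, by simp⟩, f ⟨j, by simp⟩))
    (ψ := fun f : (Finset.univ \ {i, j} : Finset (Fin n)) → ℝ => (1 / (n : ℝ)) * ∑ k, f k)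
    (by fun_prop) (by fun_prop)
  have e1 : (fun f : (Finset.univ \ {i, j} : Finset (Fin n)) → ℝ => (1 / (n : ℝ)) * ∑ k, f k)
      ∘ (fun ω (k : (Finset.univ \ {i, j} : Finset (Fin n))) => Δ k ω)
      = fun ω => (1 / (n : ℝ)) * ∑ k ∈ Finset.univ \ {i, j}, Δ k ω := by
    ext ω
    simp only [Function.comp]
    rw [Finset.sum_coe_sort (Finset.univ \ {i, j}) fun k => Δ k ω]
  rw [e1] at h2
  have h3 := (indepFun_iff_map_prod_eq_prod_map_map (by
      exact ((hm i).prodMk (hm j)).aemeasurable) (by fun_prop)).1 h2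
  have h4 := (indepFun_iff_map_prod_eq_prod_map_map (hm i).aemeasurable (hm j).aemeasurable).1
    (hind.indepFun hij)
  rw [hlaw, hlaw] at h4
  rw [← h4]
  exact h3

variable {g : Fin n → ℝ → ℝ} {B η D : ℝ}

/-- With the contribution of the other coordinates frozen at w, removing the perturbation costs C/n
times the squared growth bound B²(1 + |w|)². The unperturbed pair is independent, so the rest
factorizes into two means, each at most η + D|w|. -/
lemma pair_integral_le {C ε₀ s₀ s₁ : ℝ}
    (hC : ∀ σ₁ σ₂ : ℝ≥0, s₀ ≤ σ₁ → σ₁ ≤ s₁ → s₀ ≤ σ₂ → σ₂ ≤ s₁ →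
      ∀ ε : ℝ, 0 ≤ ε → ε ≤ ε₀ → ∀ (D : ℝ) (F : ℝ × ℝ → ℝ), Measurable F → 0 ≤ D →
      (∀ p, |F p| ≤ D * ((1 + |p.1|) * (1 + |p.2|))) →
      |(∫ p, F (subSum ε p) ∂((gaussianReal 0 σ₁).prod (gaussianReal 0 σ₂)))
        - ∫ p, F p ∂((gaussianReal 0 σ₁).prod (gaussianReal 0 σ₂))| ≤ C * ε * D)
    (hC0 : 0 ≤ C) (hσ : ∀ i, s₀ ≤ σ i ∧ σ i ≤ s₁) (hn : 1 / (n : ℝ) ≤ ε₀)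
    (hg : ∀ i, Measurable (g i)) (hB : 0 ≤ B) (hgB : ∀ i y, |g i y| ≤ B * (1 + |y|))
    (hη : ∀ i w, |∫ x, g i (x - w) ∂(gaussianReal 0 (σ i))| ≤ η + D * |w|)
    (i j : Fin n) (w : ℝ) :
    ∫ p, g i ((subSum (1 / n) p).1 - w) * g j ((subSum (1 / n) p).2 - w)
      ∂((gaussianReal 0 (σ i)).prod (gaussianReal 0 (σ j)))
      ≤ (2 * C * B ^ 2 / n + 2 * η ^ 2) + (2 * C * B ^ 2 / n + 2 * D ^ 2) * w ^ 2 := by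
  set F : ℝ × ℝ → ℝ := fun p => g i (p.1 - w) * g j (p.2 - w) with hF
  have hFm : Measurable F := by
    have := hg i
    have := hg j
    fun_prop
  have hb : ∀ k (x : ℝ), |g k (x - w)| ≤ B * (1 + |w|) * (1 + |x|) := by
    intro k x
    refine (hgB k _).trans ?_
    have := abs_sub x w
    have h : 1 + |x - w| ≤ (1 + |w|) * (1 + |x|) := by nlinarith [abs_nonneg x, abs_nonneg w]
    rw [mul_assoc]
    gcongr
  have hFb : ∀ p, |F p| ≤ (B * (1 + |w|)) ^ 2 * ((1 + |p.1|) * (1 + |p.2|)) := by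
    intro p
    simp only [hF]
    rw [abs_mul]
    calc _ ≤ (B * (1 + |w|) * (1 + |p.1|)) * (B * (1 + |w|) * (1 + |p.2|)) :=
          mul_le_mul (hb i p.1) (hb j p.2) (abs_nonneg _) (by positivity)
      _ = _ := by ring
  have h := hC (σ i) (σ j) (hσ i).1 (hσ i).2 (hσ j).1 (hσ j).2 (1 / n) (by positivity) hn _ F hFm
    (by positivity) hFb
  have hprod : ∫ p, F p ∂((gaussianReal 0 (σ i)).prod (gaussianReal 0 (σ j)))
      = (∫ x, g i (x - w) ∂(gaussianReal 0 (σ i))) * ∫ x, g j (x - w) ∂(gaussianReal 0 (σ j)) :=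
    integral_prod_mul (fun x => g i (x - w)) fun x => g j (x - w)
  have hprodb : ∫ p, F p ∂((gaussianReal 0 (σ i)).prod (gaussianReal 0 (σ j)))
      ≤ (η + D * |w|) ^ 2 := by
    rw [hprod]
    refine (le_abs_self _).trans ?_
    rw [abs_mul, sq]
    exact mul_le_mul (hη i w) (hη j w) (abs_nonneg _) ((abs_nonneg _).trans (hη i w))
  have h1 := (abs_le.1 h).2
  have h2 : (η + D * |w|) ^ 2 ≤ 2 * η ^ 2 + 2 * D ^ 2 * w ^ 2 := by
    have := sq_nonneg (η - D * |w|)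
    have e := sq_abs w
    nlinarith
  have h3 : C * (1 / n) * (B * (1 + |w|)) ^ 2 ≤ 2 * C * B ^ 2 / n + 2 * C * B ^ 2 / n * w ^ 2 := by
    have e : (1 + |w|) ^ 2 ≤ 2 * (1 + w ^ 2) := by
      have := sq_nonneg (1 - |w|)
      have e := sq_abs w
      nlinarith
    calc _ = C * B ^ 2 / n * (1 + |w|) ^ 2 := by ring
      _ ≤ C * B ^ 2 / n * (2 * (1 + w ^ 2)) := by gcongr
      _ = _ := by ring
  have h4 : ∫ p, g i ((subSum (1 / n) p).1 - w) * g j ((subSum (1 / n) p).2 - w)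
      ∂((gaussianReal 0 (σ i)).prod (gaussianReal 0 (σ j)))
      = ∫ p, F (subSum (1 / n) p) ∂((gaussianReal 0 (σ i)).prod (gaussianReal 0 (σ j))) := rfl
  rw [h4]
  linarith

/-- The deviation of a coordinate from the average. -/
noncomputable def centred (Δ : Fin n → Ω → ℝ) (i : Fin n) (ω : Ω) : ℝ :=
  Δ i ω - (1 / (n : ℝ)) * ∑ k, Δ k ω

/-- Serves the diagonal terms: there are only n of them among n², so a crude second moment
contributes no more than B²/n to the average. -/
lemma memLp_comp_centred (hm : ∀ i, Measurable (Δ i)) (hind : iIndepFun Δ P)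
    (hlaw : ∀ i, P.map (Δ i) = gaussianReal 0 (σ i)) {s₁ : ℝ} (hσ : ∀ i, (σ i : ℝ) ≤ s₁)
    (hs₁ : 0 ≤ s₁) (hn : 1 ≤ n) (hg : ∀ i, Measurable (g i)) (hB : 0 ≤ B)
    (hgB : ∀ i y, |g i y| ≤ B * (1 + |y|)) (i : Fin n) :
    MemLp (fun ω => g i (centred Δ i ω)) 2 P ∧
    ∫ ω, g i (centred Δ i ω) ^ 2 ∂P ≤ (3 + 6 * s₁) * B ^ 2 := by
  obtain ⟨hA, hA2⟩ := integral_sq_average_le hm hind hlaw hσ hs₁ Finset.univ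
  have hi : MemLp (Δ i) 2 P := memLp_of_map_gaussian (hm i) (hlaw i)
  have hc : MemLp (centred Δ i) 2 P := hi.sub hA
  have hcm : Measurable (centred Δ i) := by
    unfold centred
    have := hm i
    fun_prop
  have hL : MemLp (fun ω => g i (centred Δ i ω)) 2 P := by
    have hb : MemLp (fun ω => B * (1 + |centred Δ i ω|)) 2 P :=
      ((memLp_const (1 : ℝ)).add hc.abs).const_mul B
    refine hb.of_le ((hg i).comp hcm).aestronglyMeasurable (ae_of_all _ fun ω => ?_)
    refine (hgB i _).trans ?_
    exact le_abs_self _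
  refine ⟨hL, ?_⟩
  have hi2 : ∫ ω, Δ i ω ^ 2 ∂P ≤ s₁ := by
    have h := integral_map (hm i).aemeasurable (f := fun x : ℝ => x ^ 2) (μ := P) (by fun_prop)
    have hv := variance_id_gaussianReal (μ := 0) (v := σ i)
    rw [variance_eq_sub (by simpa using memLp_id_gaussianReal (μ := 0) (v := σ i) 2)] at hv
    rw [← h, hlaw]
    simp only [Pi.pow_apply, id_eq, integral_id_gaussianReal] at hv
    have := hσ i
    linarith
  calc ∫ ω, g i (centred Δ i ω) ^ 2 ∂P
      ≤ ∫ ω, (3 * B ^ 2 * (1 + (Δ i ω ^ 2 + ((1 / (n : ℝ)) * ∑ k, Δ k ω) ^ 2))) ∂P := by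
        refine integral_mono hL.integrable_sq
          (((integrable_const _).add (hi.integrable_sq.add hA.integrable_sq)).const_mul _)
          fun ω => ?_
        have h1 := hgB i (centred Δ i ω)
        have h2 : |centred Δ i ω| ≤ |Δ i ω| + |(1 / (n : ℝ)) * ∑ k, Δ k ω| := abs_sub _ _
        set x := Δ i ω
        set y := (1 / (n : ℝ)) * ∑ k, Δ k ω
        have h3 : g i (centred Δ i ω) ^ 2 ≤ (B * (1 + (|x| + |y|))) ^ 2 := by
          rw [← sq_abs (g i _)]
          refine pow_le_pow_left₀ (abs_nonneg _) (h1.trans ?_) 2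
          gcongr
        have h4 : (1 + (|x| + |y|)) ^ 2 ≤ 3 * (1 + (x ^ 2 + y ^ 2)) := by
          have := sq_abs x
          have := sq_abs y
          nlinarith [sq_nonneg (1 - |x|), sq_nonneg (1 - |y|), sq_nonneg (|x| - |y|)]
        calc _ ≤ B ^ 2 * (1 + (|x| + |y|)) ^ 2 := by rw [← mul_pow]; exact h3
          _ ≤ B ^ 2 * (3 * (1 + (x ^ 2 + y ^ 2))) := by gcongr
          _ = _ := by ring
    _ = 3 * B ^ 2 * (1 + (∫ ω, Δ i ω ^ 2 ∂P + ∫ ω, ((1 / (n : ℝ)) * ∑ k, Δ k ω) ^ 2 ∂P)) := by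
        rw [integral_const_mul, integral_add (integrable_const _)
          (by exact hi.integrable_sq.add hA.integrable_sq),
          integral_add hi.integrable_sq hA.integrable_sq]
        simp
    _ ≤ 3 * B ^ 2 * (1 + (s₁ + s₁)) := by
        have : s₁ / n ≤ s₁ := div_le_self hs₁ (by exact_mod_cast hn)
        gcongr
        linarith
    _ = _ := by ring

/-- The centred pair is `subSum (1 / n)` of (Δ_i, Δ_j), shifted by the average `W` over the other
coordinates. `W` is independent of the pair and its second moment is at most s₁/n, so integrating
the bound for frozen w finishes the estimate. -/
lemma integral_mul_comp_centred_le {C ε₀ s₀ s₁ : ℝ}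
    (hC : ∀ σ₁ σ₂ : ℝ≥0, s₀ ≤ σ₁ → σ₁ ≤ s₁ → s₀ ≤ σ₂ → σ₂ ≤ s₁ →
      ∀ ε : ℝ, 0 ≤ ε → ε ≤ ε₀ → ∀ (D : ℝ) (F : ℝ × ℝ → ℝ), Measurable F → 0 ≤ D →
      (∀ p, |F p| ≤ D * ((1 + |p.1|) * (1 + |p.2|))) →
      |(∫ p, F (subSum ε p) ∂((gaussianReal 0 σ₁).prod (gaussianReal 0 σ₂)))
        - ∫ p, F p ∂((gaussianReal 0 σ₁).prod (gaussianReal 0 σ₂))| ≤ C * ε * D)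
    (hC0 : 0 ≤ C) (hm : ∀ i, Measurable (Δ i)) (hind : iIndepFun Δ P)
    (hlaw : ∀ i, P.map (Δ i) = gaussianReal 0 (σ i))
    (hσ : ∀ i, s₀ ≤ σ i ∧ σ i ≤ s₁) (hs₁ : 0 ≤ s₁) (hn1 : 1 ≤ n) (hn : 1 / (n : ℝ) ≤ ε₀)
    (hg : ∀ i, Measurable (g i)) (hB : 0 ≤ B) (hgB : ∀ i y, |g i y| ≤ B * (1 + |y|))
    (hη : ∀ i w, |∫ x, g i (x - w) ∂(gaussianReal 0 (σ i))| ≤ η + D * |w|)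
    {i j : Fin n} (hij : i ≠ j) :
    ∫ ω, g i (centred Δ i ω) * g j (centred Δ j ω) ∂P
      ≤ (2 * C * B ^ 2 / n + 2 * η ^ 2) + (2 * C * B ^ 2 / n + 2 * D ^ 2) * (s₁ / n) := by
  set W : Ω → ℝ := fun ω => (1 / (n : ℝ)) * ∑ k ∈ Finset.univ \ {i, j}, Δ k ω with hW
  obtain ⟨hWL, hW2⟩ := integral_sq_average_le hm hind hlaw (fun i => (hσ i).2) hs₁
    (Finset.univ \ {i, j})
  have hWm : Measurable W := by fun_prop
  set Φ : (ℝ × ℝ) × ℝ → ℝ := fun q =>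
    g i ((subSum (1 / n) q.1).1 - q.2) * g j ((subSum (1 / n) q.1).2 - q.2) with hΦ
  have hΦm : Measurable Φ := by
    have h0 := measurable_subSum (1 / n)
    have := hg i
    have := hg j
    fun_prop
  have hsum : ∀ ω, ∑ k, Δ k ω = (Δ i ω + Δ j ω) + ∑ k ∈ Finset.univ \ {i, j}, Δ k ω := by
    intro ω
    rw [← Finset.sum_pair hij (f := fun k => Δ k ω), add_comm]
    exact (Finset.sum_sdiff (Finset.subset_univ _)).symm
  have e : ∀ ω, g i (centred Δ i ω) * g j (centred Δ j ω) = Φ ((Δ i ω, Δ j ω), W ω) := by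
    intro ω
    simp only [hΦ, subSum, centred, hsum, hW]
    congr 2 <;> ring
  have hlaw3 := map_pair_rest hm hind hlaw hij
  have hmeas : Measurable fun ω => ((Δ i ω, Δ j ω), W ω) := by
    have := hm i
    have := hm j
    fun_prop
  have : IsProbabilityMeasure (P.map W) := Measure.isProbabilityMeasure_map hWm.aemeasurable
  have hLi := (memLp_comp_centred hm hind hlaw (fun i => (hσ i).2) hs₁ hn1 hg hB hgB i).1
  have hLj := (memLp_comp_centred hm hind hlaw (fun i => (hσ i).2) hs₁ hn1 hg hB hgB j).1
  have hint : Integrable Φ (((gaussianReal 0 (σ i)).prod (gaussianReal 0 (σ j))).prod (P.map W)) := by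
    rw [← hlaw3, integrable_map_measure hΦm.aestronglyMeasurable hmeas.aemeasurable]
    refine (hLi.integrable_mul hLj).congr (ae_of_all _ fun ω => ?_)
    exact e ω
  simp only [e]
  have h1 : ∫ ω, Φ ((Δ i ω, Δ j ω), W ω) ∂P = ∫ w, ∫ p, Φ (p, w)
      ∂((gaussianReal 0 (σ i)).prod (gaussianReal 0 (σ j))) ∂(P.map W) := by
    rw [← integral_prod_symm _ hint, ← hlaw3,
      integral_map hmeas.aemeasurable hΦm.aestronglyMeasurable]
  rw [h1]
  set a := 2 * C * B ^ 2 / n + 2 * η ^ 2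
  set b := 2 * C * B ^ 2 / n + 2 * D ^ 2
  have hb : 0 ≤ b := by positivity
  have hw2 : Integrable (fun w : ℝ => w ^ 2) (P.map W) := by
    rw [integrable_map_measure (by fun_prop) hWm.aemeasurable]
    exact hWL.integrable_sq
  calc _ ≤ ∫ w, (a + b * w ^ 2) ∂(P.map W) := by
        refine integral_mono hint.integral_prod_right
          ((integrable_const _).add (hw2.const_mul _)) fun w => ?_
        exact pair_integral_le hC hC0 hσ hn hg hB hgB hη i j w
    _ = a + b * ∫ w, w ^ 2 ∂(P.map W) := by
        rw [integral_add (integrable_const _) (hw2.const_mul _), integral_const_mul]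
        simp
    _ = a + b * ∫ ω, W ω ^ 2 ∂P := by
        rw [integral_map hWm.aemeasurable (by fun_prop)]
    _ ≤ _ := by gcongr

end GrandMean

/-- Averages of functions of observations centred at the grand mean are small in mean square if
their means are small when the grand mean is replaced by a constant. -/
lemma exists_integral_sq_average_centred_le {s₀ s₁ : ℝ} (hs₀ : 0 < s₀) (hs₀₁ : s₀ ≤ s₁) :
    ∃ C : ℝ, 0 ≤ C ∧ ∃ n₀ : ℕ, ∀ n ≥ n₀, ∀ {Ω : Type} [MeasurableSpace Ω] (P : Measure Ω)
      [IsProbabilityMeasure P] (Δ : Fin n → Ω → ℝ) (σ : Fin n → ℝ≥0),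
      (∀ i, Measurable (Δ i)) → iIndepFun Δ P → (∀ i, P.map (Δ i) = gaussianReal 0 (σ i)) →
      (∀ i, s₀ ≤ σ i ∧ σ i ≤ s₁) → ∀ (g : Fin n → ℝ → ℝ) (B η D : ℝ),
      (∀ i, Measurable (g i)) → 0 ≤ B → (∀ i y, |g i y| ≤ B * (1 + |y|)) →
      (∀ i w, |∫ x, g i (x - w) ∂(gaussianReal 0 (σ i))| ≤ η + D * |w|) →
      MemLp (fun ω => (1 / (n : ℝ)) * ∑ i, g i (centred Δ i ω)) 2 P ∧
      ∫ ω, ((1 / (n : ℝ)) * ∑ i, g i (centred Δ i ω)) ^ 2 ∂P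
        ≤ C * (B ^ 2 / n + η ^ 2 + D ^ 2 / n) := by
  have hs₁ : 0 < s₁ := hs₀.trans_le hs₀₁
  obtain ⟨C, hC0, ε₀, hε₀, hC⟩ := exists_abs_integral_subSum_sub_le hs₀ hs₀₁
  obtain ⟨n₀, hn₀⟩ := exists_nat_one_div_lt hε₀
  refine ⟨(3 + 6 * s₁) + 2 * C * (1 + s₁) + 2 + 2 * s₁, by positivity, n₀ + 1, ?_⟩
  intro n hn Ω _ P _ Δ σ hm hind hlaw hσ g B η D hg hB hgB hη
  have hn1 : 1 ≤ n := by omega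
  have hn' : (1 : ℝ) ≤ n := by exact_mod_cast hn1
  have hnε : 1 / (n : ℝ) ≤ ε₀ := by
    refine le_trans ?_ hn₀.le
    have : ((n₀ + 1 : ℕ) : ℝ) ≤ n := by exact_mod_cast hn
    push_cast at this
    gcongr
  have hL := fun i => memLp_comp_centred hm hind hlaw (fun i => (hσ i).2) hs₁.le hn1 hg hB hgB i
  refine ⟨(memLp_finsetSum _ fun i _ => (hL i).1).const_mul _, ?_⟩
  set a := (2 * C * B ^ 2 / n + 2 * η ^ 2) + (2 * C * B ^ 2 / n + 2 * D ^ 2) * (s₁ / n) with ha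
  have ha0 : 0 ≤ a := by positivity
  have hpair : ∀ i j : Fin n, ∫ ω, g i (centred Δ i ω) * g j (centred Δ j ω) ∂P
      ≤ a + if i = j then (3 + 6 * s₁) * B ^ 2 else 0 := by
    intro i j
    split_ifs with h
    · subst h
      have := (hL i).2
      simp only [← sq]
      linarith
    · rw [add_zero]
      exact integral_mul_comp_centred_le hC hC0 hm hind hlaw hσ hs₁.le hn1 hnε hg hB hgB hη h
  have e : ∀ ω, ((1 / (n : ℝ)) * ∑ i, g i (centred Δ i ω)) ^ 2
      = (1 / (n : ℝ)) ^ 2 * ∑ i, ∑ j, g i (centred Δ i ω) * g j (centred Δ j ω) := by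
    intro ω
    rw [mul_pow, sq (∑ i, _), Finset.sum_mul_sum]
  have hij : ∀ i j, Integrable (fun ω => g i (centred Δ i ω) * g j (centred Δ j ω)) P :=
    fun i j => (hL i).1.integrable_mul (hL j).1
  simp only [e]
  rw [integral_const_mul, integral_finsetSum _ fun i _ => integrable_finsetSum _ fun j _ => hij i j]
  have h1 : ∑ i, ∫ ω, ∑ j, g i (centred Δ i ω) * g j (centred Δ j ω) ∂P
      ≤ ∑ i : Fin n, ∑ j : Fin n, (a + if i = j then (3 + 6 * s₁) * B ^ 2 else 0) := by
    refine Finset.sum_le_sum fun i _ => ?_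
    rw [integral_finsetSum _ fun j _ => hij i j]
    exact Finset.sum_le_sum fun j _ => hpair i j
  have h2 : ∑ i : Fin n, ∑ j : Fin n, (a + if i = j then (3 + 6 * s₁) * B ^ 2 else 0)
      = n * (n * a) + n * ((3 + 6 * s₁) * B ^ 2) := by
    simp [Finset.sum_add_distrib]
  rw [h2] at h1
  calc _ ≤ (1 / (n : ℝ)) ^ 2 * (n * (n * a) + n * ((3 + 6 * s₁) * B ^ 2)) := by gcongr
    _ = a + (3 + 6 * s₁) * (B ^ 2 / n) := by field_simp
    _ ≤ _ := by
      have hB2 : 0 ≤ B ^ 2 / n := by positivity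
      have hD2 : 0 ≤ D ^ 2 / n := by positivity
      have hη2 : 0 ≤ η ^ 2 := by positivity
      have e1 : a ≤ 2 * C * (1 + s₁) * (B ^ 2 / n) + 2 * η ^ 2 + 2 * s₁ * (D ^ 2 / n) := by
        have h3 : s₁ / n ≤ s₁ := div_le_self hs₁.le hn'
        have h4 : 2 * C * B ^ 2 / n * (s₁ / n) ≤ 2 * C * B ^ 2 / n * s₁ := by gcongr
        have h5 : 2 * D ^ 2 * (s₁ / n) = 2 * s₁ * (D ^ 2 / n) := by ring
        have h6 : 2 * C * B ^ 2 / n = 2 * C * (B ^ 2 / n) := by ring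
        rw [ha]
        rw [h6] at h4 ⊢
        nlinarith
      nlinarith [mul_nonneg hC0 hs₁.le, mul_nonneg hC0 hB2, mul_nonneg hC0 hη2, mul_nonneg hC0 hD2,
        mul_nonneg hs₁.le hB2, mul_nonneg hs₁.le hη2, mul_nonneg hs₁.le hD2,
        mul_nonneg (mul_nonneg hC0 hs₁.le) hη2, mul_nonneg (mul_nonneg hC0 hs₁.le) hD2]

/-! ### The predictive loss -/

lemma integral_gaussianReal_eq_stdNormal {f : ℝ → ℝ} (hf : Measurable f) (μ : ℝ) (v : ℝ≥0) :
    ∫ x, f x ∂(gaussianReal μ v) = ∫ z, f (μ + √v * z) ∂stdNormal := by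
  have h : stdNormal.map (fun z => μ + √v * z) = gaussianReal μ v := by
    have h1 : stdNormal.map (fun z => √v * z) = gaussianReal 0 v := by
      rw [gaussianReal_map_const_mul]
      congr 1
      · simp
      · ext; simp
    have h2 := gaussianReal_map_const_add (μ := 0) (v := v) μ
    rw [← h1, Measure.map_map (by fun_prop) (by fun_prop)] at h2
    rw [zero_add] at h2
    exact h2
  rw [← h, integral_map (by fun_prop) hf.aestronglyMeasurable]

lemma integral_prod_add_stdNormal {f : ℝ → ℝ} (hf : Measurable f) (a b : ℝ) :
    ∫ p : ℝ × ℝ, f (a * p.1 + b * p.2) ∂(stdNormal.prod stdNormal)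
      = ∫ z, f (√(a ^ 2 + b ^ 2) * z) ∂stdNormal := by
  have hind : IndepFun (fun p : ℝ × ℝ => a * p.1) (fun p : ℝ × ℝ => b * p.2)
      (stdNormal.prod stdNormal) :=
    indepFun_prod (X := fun x : ℝ => a * x) (Y := fun x : ℝ => b * x) (by fun_prop) (by fun_prop)
  have h1 : ∀ c : ℝ, stdNormal.map (fun x => c * x) = gaussianReal 0 (Real.toNNReal (c ^ 2)) := by
    intro c
    rw [gaussianReal_map_const_mul]
    congr 1
    · simp
    · ext; simp [Real.coe_toNNReal _ (sq_nonneg c)]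
  have hX : (stdNormal.prod stdNormal).map (fun p : ℝ × ℝ => a * p.1)
      = gaussianReal 0 (Real.toNNReal (a ^ 2)) := by
    rw [← h1 a]
    nth_rewrite 3 [← (measurePreserving_fst (μ := stdNormal) (ν := stdNormal)).map_eq]
    rw [Measure.map_map (by fun_prop) (by fun_prop)]
    rfl
  have hY : (stdNormal.prod stdNormal).map (fun p : ℝ × ℝ => b * p.2)
      = gaussianReal 0 (Real.toNNReal (b ^ 2)) := by
    rw [← h1 b]
    nth_rewrite 3 [← (measurePreserving_snd (μ := stdNormal) (ν := stdNormal)).map_eq]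
    rw [Measure.map_map (by fun_prop) (by fun_prop)]
    rfl
  have h := gaussianReal_add_gaussianReal_of_indepFun hind hX hY
  have h2 := integral_map (f := f) (μ := stdNormal.prod stdNormal)
    (φ := fun p : ℝ × ℝ => a * p.1 + b * p.2) (by fun_prop) hf.aestronglyMeasurable
  have h3 : (stdNormal.prod stdNormal).map (fun p : ℝ × ℝ => a * p.1 + b * p.2)
      = gaussianReal 0 (Real.toNNReal (a ^ 2 + b ^ 2)) := by
    rw [Real.toNNReal_add (sq_nonneg a) (sq_nonneg b)]
    rw [add_zero] at h
    exact h
  rw [← h2, h3, integral_gaussianReal_eq_stdNormal hf,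
    Real.coe_toNNReal _ (add_nonneg (sq_nonneg a) (sq_nonneg b))]
  simp only [zero_add]

lemma measurable_check (β : ℝ) : Measurable (check β) := by unfold check; fun_prop

lemma integrable_check_stdNormal (β μ s : ℝ) :
    Integrable (fun z => check β (μ + s * z)) stdNormal := by
  have : Integrable (fun z => μ + s * z) stdNormal :=
    (integrable_const _).add (integrable_id_stdNormal.const_mul _)
  simp only [check_eq]
  exact (this.sup (integrable_const 0)).sub (this.const_mul β)

lemma check_mul {s : ℝ} (hs : 0 ≤ s) (β a : ℝ) : check β (s * a) = s * check β a := by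
  simp only [check]
  rw [mul_max_of_nonneg _ _ hs]
  congr 1 <;> ring

lemma integral_check (β w : ℝ) : ∫ z, check β (w + z) ∂stdNormal = G w β := by
  have h1 : Integrable (fun z => w + z) stdNormal := (integrable_const _).add integrable_id_stdNormal
  simp only [check_eq]
  rw [integral_sub (integrable_posPart w) (h1.const_mul β), integral_const_mul,
    integral_add (integrable_const _) integrable_id_stdNormal, integral_id_gaussianReal,
    G_eq_integral]
  simp

lemma integral_check_scaled {s : ℝ} (hs : 0 < s) (β w : ℝ) :
    ∫ z, check β (s * w + s * z) ∂stdNormal = s * G w β := by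
  simp only [← mul_add, check_mul hs.le]
  rw [integral_const_mul, integral_check]

namespace Model

variable (M : Model)

lemma ratio_nonneg (i : ℕ) : 0 ≤ M.ratio i :=
  div_nonneg (M.b_pos i).le (add_pos (M.b_pos i) (M.h_pos i)).le

lemma ratio_le_one (i : ℕ) : M.ratio i ≤ 1 :=
  (div_le_one (add_pos (M.b_pos i) (M.h_pos i))).2 (by linarith [M.h_pos i])

lemma weight_pos (i : ℕ) : 0 < M.b i + M.h i := add_pos (M.b_pos i) (M.h_pos i)

lemma coordLoss_eq (i : ℕ) (t q : ℝ) :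
    M.coordLoss i t q
      = (M.b i + M.h i) * ∫ z, check (M.ratio i) ((q - t) + -√(M.σf i) * z) ∂stdNormal := by
  have e : ∀ y, M.b i * max (y - q) 0 + M.h i * max (q - y) 0
      = (M.b i + M.h i) * check (M.ratio i) (q - y) := by
    intro y
    have hr : (M.b i + M.h i) * M.ratio i = M.b i := mul_div_cancel₀ _ (M.weight_pos i).ne'
    rw [check_eq]
    rcases le_total y q with h | h
    · rw [max_eq_right (by linarith), max_eq_left (by linarith)]
      linear_combination (q - y) * hr
    · rw [max_eq_left (by linarith), max_eq_right (by linarith)]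
      linear_combination (q - y) * hr
  rw [coordLoss]
  simp only [e]
  have := measurable_check (M.ratio i)
  rw [integral_const_mul, integral_gaussianReal_eq_stdNormal (by fun_prop)]
  congr 2
  ext z
  congr 1
  ring

lemma abs_coordLoss_sub_le (i : ℕ) (t q q' : ℝ) :
    |M.coordLoss i t q - M.coordLoss i t q'| ≤ (M.b i + M.h i) * |q - q'| := by
  have i1 := integrable_check_stdNormal (M.ratio i) (q - t) (-√(M.σf i))
  have i2 := integrable_check_stdNormal (M.ratio i) (q' - t) (-√(M.σf i))
  rw [coordLoss_eq, coordLoss_eq, ← mul_sub, abs_mul, abs_of_pos (M.weight_pos i),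
    ← integral_sub i1 i2]
  refine mul_le_mul_of_nonneg_left ?_ (M.weight_pos i).le
  rw [← Real.norm_eq_abs]
  refine (norm_integral_le_of_norm_le (integrable_const |q - q'|)
    (ae_of_all _ fun z => ?_)).trans (by simp)
  exact (abs_check_sub_le (M.ratio_nonneg i) (M.ratio_le_one i) _ _).trans
    (le_of_eq (congrArg _ (by ring)))

lemma abs_coordLoss_sub_check_le (i : ℕ) (t q : ℝ) :
    |M.coordLoss i t q - (M.b i + M.h i) * check (M.ratio i) (q - t)|
      ≤ (M.b i + M.h i) * √(M.σf i) := by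
  have i1 := integrable_check_stdNormal (M.ratio i) (q - t) (-√(M.σf i))
  have e : check (M.ratio i) (q - t) = ∫ _z, check (M.ratio i) (q - t) ∂stdNormal := by simp
  rw [coordLoss_eq, ← mul_sub, abs_mul, abs_of_pos (M.weight_pos i), e,
    ← integral_sub i1 (integrable_const _)]
  refine mul_le_mul_of_nonneg_left ?_ (M.weight_pos i).le
  rw [← Real.norm_eq_abs]
  refine (norm_integral_le_of_norm_le (integrable_id_stdNormal.abs.const_mul √(M.σf i))
    (ae_of_all _ fun z => ?_)).trans ?_
  · refine (abs_check_sub_le (M.ratio_nonneg i) (M.ratio_le_one i) _ _).trans (le_of_eq ?_)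
    rw [add_sub_cancel_left, abs_mul, abs_neg, abs_of_nonneg (Real.sqrt_nonneg _)]
  · rw [integral_const_mul]
    exact mul_le_of_le_one_right (Real.sqrt_nonneg _) integral_abs_stdNormal_le

lemma continuous_coordLoss (i : ℕ) (t : ℝ) : Continuous (M.coordLoss i t) := by
  have : LipschitzWith (Real.toNNReal (M.b i + M.h i)) (M.coordLoss i t) := by
    refine LipschitzWith.of_dist_le_mul fun x y => ?_
    rw [Real.dist_eq, Real.dist_eq, Real.coe_toNNReal _ (M.weight_pos i).le]
    exact M.abs_coordLoss_sub_le i t x y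
  exact this.continuous

/-- The mean loss of a linear rule. -/
lemma integral_coordLoss (i : ℕ) (t r κ ω : ℝ) (hr : r - t = √(M.σf i + κ ^ 2) * ω) :
    ∫ z, M.coordLoss i t (r + κ * z) ∂stdNormal
      = (M.b i + M.h i) * (√(M.σf i + κ ^ 2) * G ω (M.ratio i)) := by
  set s := √(M.σf i + κ ^ 2) with hs
  have hs0 : 0 < s := Real.sqrt_pos.2 (by
    have := M.σf_pos i
    have : (0 : ℝ) < M.σf i := by exact_mod_cast this
    positivity)
  have hcm := measurable_check (M.ratio i)
  have hlin : Integrable (fun p : ℝ × ℝ => (r - t) + (κ * p.1 + -√(M.σf i) * p.2))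
      (stdNormal.prod stdNormal) :=
    (integrable_const _).add (((integrable_id_stdNormal.comp_fst stdNormal).const_mul _).add
      ((integrable_id_stdNormal.comp_snd stdNormal).const_mul _))
  have hint : Integrable (fun p : ℝ × ℝ =>
      check (M.ratio i) ((r - t) + (κ * p.1 + -√(M.σf i) * p.2))) (stdNormal.prod stdNormal) := by
    simp only [check_eq]
    exact (hlin.sup (integrable_const 0)).sub (hlin.const_mul _)
  simp only [coordLoss_eq]
  rw [integral_const_mul]
  congr 1
  have h1 : ∫ x, ∫ z, check (M.ratio i) (r + κ * x - t + -√(M.σf i) * z) ∂stdNormal ∂stdNormal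
      = ∫ p : ℝ × ℝ, check (M.ratio i) ((r - t) + (κ * p.1 + -√(M.σf i) * p.2))
        ∂(stdNormal.prod stdNormal) := by
    rw [integral_prod _ hint]
    congr 1
    ext x
    congr 1
    ext z
    congr 1
    ring
  have h2 := integral_prod_add_stdNormal (f := fun y => check (M.ratio i) ((r - t) + y))
    (by fun_prop) κ (-√(M.σf i))
  have h3 : √(κ ^ 2 + (-√(M.σf i)) ^ 2) = s := by
    rw [neg_sq, Real.sq_sqrt (NNReal.coe_nonneg _), add_comm]
  rw [h3] at h2
  rw [h1, h2, hr, integral_check_scaled hs0]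

/-! ### The risk estimate of a single coordinate -/

/-- The ratio of the variances of the past and the future observation. -/
noncomputable def varRatio (i : ℕ) : ℝ := M.σp i / M.σf i

/-- The standard deviation of the prediction error in coordinate `i`. -/
noncomputable def scale (i : ℕ) (τ : ℝ≥0∞) : ℝ := √(M.σf i + M.σp i * M.shrink i τ ^ 2)

/-- The standard deviation of the noise in the argument of the estimate of `G`, up to sign. -/
noncomputable def noise (i : ℕ) (τ : ℝ≥0∞) : ℝ := M.d i τ * √(M.σp i)

lemma σp_pos' (i : ℕ) : (0 : ℝ) < M.σp i := NNReal.coe_pos.2 (M.σp_pos i)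

lemma σf_pos' (i : ℕ) : (0 : ℝ) < M.σf i := NNReal.coe_pos.2 (M.σf_pos i)

lemma varRatio_pos (i : ℕ) : 0 < M.varRatio i := div_pos (M.σp_pos' i) (M.σf_pos' i)

lemma shrink_mem (i : ℕ) (τ : ℝ≥0∞) : 0 ≤ M.shrink i τ ∧ M.shrink i τ ≤ 1 := by
  have h := M.σp_pos' i
  unfold shrink
  split_ifs
  · simp
  · have := ENNReal.toReal_nonneg (a := τ)
    exact ⟨by positivity, (div_le_one (by positivity)).2 (by linarith)⟩

lemma scale_pos (i : ℕ) (τ : ℝ≥0∞) : 0 < M.scale i τ := by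
  have := M.σf_pos' i
  exact Real.sqrt_pos.2 (by positivity)

lemma scale_sq (i : ℕ) (τ : ℝ≥0∞) :
    M.scale i τ ^ 2 = M.σf i + M.σp i * M.shrink i τ ^ 2 := Real.sq_sqrt (by positivity)

lemma scale_mul_d (i : ℕ) (τ : ℝ≥0∞) : M.scale i τ * M.d i τ = -(1 - M.shrink i τ) :=
  mul_div_cancel₀ _ (M.scale_pos i τ).ne'

lemma scale_mul_c (i : ℕ) (τ : ℝ≥0∞) :
    M.scale i τ * M.c i τ
      = √(M.σf i + M.shrink i τ * M.σp i) * stdQuantile (M.ratio i) := by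
  have h : M.scale i τ = √(M.σf i + M.shrink i τ ^ 2 * M.σp i) := by rw [scale, mul_comm]
  have h0 := (M.scale_pos i τ).ne'
  rw [c, Real.sqrt_div (by have := (M.shrink_mem i τ).1; positivity), ← h]
  field_simp

/-- The squared scale is at least σf and the shrinkage factor lies in [0, 1], so σf d² ≤ 1. This
makes all later bounds uniform in τ. -/
lemma noise_sq_le (i : ℕ) (τ : ℝ≥0∞) : M.noise i τ ^ 2 ≤ M.varRatio i := by
  obtain ⟨h0, h1⟩ := M.shrink_mem i τ
  have hf := M.σf_pos' i
  have hp := M.σp_pos' i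
  have hd := M.scale_mul_d i τ
  have hS := M.scale_sq i τ
  have h2 : M.σf i * M.d i τ ^ 2 ≤ 1 := by
    calc M.σf i * M.d i τ ^ 2 ≤ M.scale i τ ^ 2 * M.d i τ ^ 2 := by
          gcongr; rw [hS]; have : (0 : ℝ) ≤ M.σp i * M.shrink i τ ^ 2 := by positivity
          linarith
      _ = (1 - M.shrink i τ) ^ 2 := by rw [← mul_pow, hd, neg_sq]
      _ ≤ 1 := by nlinarith
  rw [noise, mul_pow, Real.sq_sqrt hp.le, varRatio, le_div_iff₀ hf]
  nlinarith

lemma randT_eq (γ : ℕ → ℝ) (n i : ℕ) (x z : ℝ) (τ : ℝ≥0∞) :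
    M.randT γ n i x z τ
      = thresholdEstimate (M.order γ n i - 1) (2 * M.noise i τ ^ 2) (M.ratio i) (threshold γ n i) n
        (M.c i τ + M.d i τ * x + M.noise i τ * z) (M.c i τ + M.d i τ * x - M.noise i τ * z) := by
  have hv : 2 * M.noise i τ ^ 2 = 2 * M.σp i * M.d i τ ^ 2 := by
    rw [noise, mul_pow, Real.sq_sqrt (M.σp_pos' i).le]; ring
  have hU : M.c i τ + M.d i τ * x + M.noise i τ * z
      = M.c i τ + M.d i τ * (x + √(M.σp i) * z) := by rw [noise]; ring
  have hV : M.c i τ + M.d i τ * x - M.noise i τ * z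
      = M.c i τ + M.d i τ * (x - √(M.σp i) * z) := by rw [noise]; ring
  rw [hv, hU, hV]
  rfl

lemma T_eq (γ : ℕ → ℝ) (n i : ℕ) (x : ℝ) (τ : ℝ≥0∞) :
    M.T γ n i x τ = ∫ z, thresholdEstimate (M.order γ n i - 1) (2 * M.noise i τ ^ 2) (M.ratio i)
      (threshold γ n i) n (M.c i τ + M.d i τ * x + M.noise i τ * z)
        (M.c i τ + M.d i τ * x - M.noise i τ * z) ∂stdNormal := by
  simp only [T, randT_eq]

lemma measurable_T (γ : ℕ → ℝ) (n i : ℕ) (τ : ℝ≥0∞) : Measurable fun x => M.T γ n i x τ := by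
  simp only [T_eq]
  have hm := (measurable_thresholdEstimate (v := 2 * M.noise i τ ^ 2) (by positivity)
    (Nat.cast_nonneg n) (M.order γ n i - 1) (M.ratio i) (threshold γ n i)).comp
    (by fun_prop : Measurable fun p : ℝ × ℝ => (M.c i τ + M.d i τ * p.1 + M.noise i τ * p.2,
      M.c i τ + M.d i τ * p.1 - M.noise i τ * p.2))
  exact (StronglyMeasurable.integral_prod_right (f := fun x z => thresholdEstimate
    (M.order γ n i - 1) (2 * M.noise i τ ^ 2) (M.ratio i) (threshold γ n i) n
    (M.c i τ + M.d i τ * x + M.noise i τ * z) (M.c i τ + M.d i τ * x - M.noise i τ * z))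
    (ν := stdNormal) hm.stronglyMeasurable).measurable

/-- The factor by which the exponent of the growth of the estimate is inflated. -/
noncomputable def inflation (i : ℕ) : ℝ := 1 / (1 - 8 * M.varRatio i)

/-- The size of the estimate beyond that of the check function. -/
noncomputable def sizeBound (γ : ℕ → ℝ) (n i : ℕ) : ℝ :=
  estimateBound (M.order γ n i - 1) (M.inflation i) (threshold γ n i)

/-- A bound of the bias of the estimate. -/
noncomputable def biasBound (γ : ℕ → ℝ) (n i : ℕ) : ℝ :=
  4 * Real.exp (-(threshold γ n i ^ 2 / 8)) + M.sizeBound γ n i ^ 2 / n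
    + ((M.order γ n i - 1 : ℕ) * Real.exp (-((M.order γ n i - 1 : ℕ) / 4))
      + (M.sizeBound γ n i + 2 + threshold γ n i)
        * Real.exp (-(√(2 * Real.log n) ^ 2 / 4)))

variable {M} {γ : ℕ → ℝ} {n i : ℕ}

lemma one_le_inflation (hρ : M.varRatio i < 1 / 8) : 1 ≤ M.inflation i := by
  have := M.varRatio_pos i
  exact (one_le_div (by linarith)).2 (by linarith)

/-- The inflation factor is the solution t of t - 1 = 8tρ, with ρ the variance ratio, which
dominates η² for every τ. -/
lemma inflation_mul_le (hρ : M.varRatio i < 1 / 8) (τ : ℝ≥0∞) :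
    8 * M.inflation i * M.noise i τ ^ 2 ≤ M.inflation i - 1 := by
  have h0 : 0 < 1 - 8 * M.varRatio i := by linarith
  have h : M.inflation i - 1 = 8 * M.inflation i * M.varRatio i := by
    rw [inflation]; field_simp; ring
  rw [h]
  have := one_le_inflation hρ
  exact mul_le_mul_of_nonneg_left (M.noise_sq_le i τ) (by positivity)

lemma threshold_nonneg (hγ : 0 ≤ γ i) : 0 ≤ threshold γ n i := mul_nonneg hγ (Real.sqrt_nonneg _)

lemma abs_T_sub_check_le (hρ : M.varRatio i < 1 / 8) (hγ : 0 ≤ γ i) (τ : ℝ≥0∞) (x : ℝ) :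
    |M.T γ n i x τ - check (M.ratio i) (M.c i τ + M.d i τ * x)|
      ≤ 3 + threshold γ n i + M.sizeBound γ n i := by
  rw [T_eq]
  exact abs_integral_thresholdEstimate_sub_check_le (M.ratio_nonneg i) (M.ratio_le_one i)
    (one_le_inflation hρ) (inflation_mul_le hρ τ) (Nat.cast_nonneg n) (threshold_nonneg hγ) _ _

lemma integrable_T (hρ : M.varRatio i < 1 / 8) (hγ : 0 ≤ γ i) (τ : ℝ≥0∞) (a κ : ℝ) :
    Integrable (fun z => M.T γ n i (a + κ * z) τ) stdNormal := by
  have hi : Integrable (fun z : ℝ => |M.c i τ + M.d i τ * (a + κ * z)|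
      + (3 + threshold γ n i + M.sizeBound γ n i)) stdNormal :=
    ((integrable_const _).add (((integrable_const a).add
      (integrable_id_stdNormal.const_mul κ)).const_mul _)).abs.add (integrable_const _)
  refine hi.mono' ((M.measurable_T γ n i τ).comp (by fun_prop)).aestronglyMeasurable
    (ae_of_all _ fun z => ?_)
  have h1 := abs_T_sub_check_le (n := n) hρ hγ τ (a + κ * z)
  have h2 := abs_check_le (M.ratio_nonneg i) (M.ratio_le_one i)
    (M.c i τ + M.d i τ * (a + κ * z))
  have h3 := abs_sub_abs_le_abs_sub (M.T γ n i (a + κ * z) τ)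
    (check (M.ratio i) (M.c i τ + M.d i τ * (a + κ * z)))
  rw [Real.norm_eq_abs]
  linarith

lemma abs_integral_T_sub_G_le (hρ : M.varRatio i < 1 / 8) (hγ : 0 ≤ γ i) (hn : 1 ≤ n)
    (τ : ℝ≥0∞) (m : ℝ) :
    |(∫ z, M.T γ n i (m + √(M.σp i) * z) τ ∂stdNormal) - G (M.c i τ + M.d i τ * m) (M.ratio i)|
      ≤ M.biasBound γ n i := by
  have hρ0 := M.varRatio_pos i
  have hlog : 0 ≤ Real.log n := Real.log_nonneg (by exact_mod_cast hn)
  have hv : 0 ≤ 2 * M.noise i τ ^ 2 := by positivity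
  -- The truncation order is made for this inequality with v₀ = 2σp/σf and ℓ = √(2 log n). The
  -- leading 1 in its definition cancels against the subtraction, leaving the ceiling of the left
  -- side.
  have hN : Real.exp 1 ^ 2 * (threshold γ n i + √(2 * M.varRatio i) * √(2 * Real.log n)) ^ 2
      ≤ ((M.order γ n i - 1 : ℕ) : ℝ) := by
    rw [order, Nat.add_sub_cancel_left]
    refine le_trans (le_of_eq ?_) (Nat.le_ceil _)
    rw [threshold, ← add_mul, mul_pow, Real.sq_sqrt (by positivity), varRatio, mul_div_assoc]
    ring
  have h := abs_integral_thresholdEstimate_sub_G_le (n := n) (M.ratio_nonneg i) (M.ratio_le_one i)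
    (one_le_inflation hρ) (inflation_mul_le hρ τ) (by exact_mod_cast hn) (threshold_nonneg hγ)
    (mul_le_mul_of_nonneg_left (M.noise_sq_le i τ) zero_le_two) (by linarith) (by linarith)
    (Real.sqrt_nonneg (2 * Real.log n)) hN (M.c i τ + M.d i τ * m)
  have hm := (measurable_thresholdEstimate hv
    (Nat.cast_nonneg n) (M.order γ n i - 1) (M.ratio i) (threshold γ n i)).comp
    (by fun_prop : Measurable fun p : ℝ × ℝ =>
      (M.c i τ + M.d i τ * m + M.noise i τ * (p.1 + p.2),
        M.c i τ + M.d i τ * m + M.noise i τ * (p.1 - p.2)))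
  have hi : Integrable (fun p : ℝ × ℝ => thresholdEstimate (M.order γ n i - 1)
      (2 * M.noise i τ ^ 2) (M.ratio i) (threshold γ n i) n
      (M.c i τ + M.d i τ * m + M.noise i τ * (p.1 + p.2))
      (M.c i τ + M.d i τ * m + M.noise i τ * (p.1 - p.2))) (stdNormal.prod stdNormal) := by
    have hb : Integrable (fun p : ℝ × ℝ => |M.c i τ + M.d i τ * m + M.noise i τ * (p.1 + p.2)|
        + (n : ℝ)) (stdNormal.prod stdNormal) :=
      ((integrable_const _).add (((integrable_id_stdNormal.comp_fst stdNormal).add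
        (integrable_id_stdNormal.comp_snd stdNormal)).const_mul _)).abs.add (integrable_const _)
    exact hb.mono' hm.aestronglyMeasurable (ae_of_all _ fun p =>
      abs_thresholdEstimate_le (M.ratio_nonneg i) (M.ratio_le_one i) (Nat.cast_nonneg n) _ _ _ _ _)
  rw [integral_prod _ hi] at h
  refine le_trans (le_of_eq ?_) h
  congr 2
  congr 1
  ext x
  rw [T_eq]
  congr 1
  ext z
  congr 1 <;> rw [noise] <;> ring

variable (M)

/-- The difference of the estimated and the actual loss of coordinate `i`, as a function of the
centred observation. The parameter is `m + μ`, where `m` stands for the grand mean. -/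
noncomputable def lossError (γ : ℕ → ℝ) (n i : ℕ) (τ : ℝ≥0∞) (m μ y : ℝ) : ℝ :=
  (M.b i + M.h i) * M.scale i τ * M.T γ n i (y + μ) τ
    - M.coordLoss i (m + μ) (M.shrink i τ * (y + μ) + m
      + √(M.σf i + M.shrink i τ * M.σp i) * stdQuantile (M.ratio i))

variable {M}

lemma measurable_lossError (τ : ℝ≥0∞) (m μ : ℝ) : Measurable (M.lossError γ n i τ m μ) :=
  (((M.measurable_T γ n i τ).comp (measurable_id.add_const μ)).const_mul _).sub
    ((M.continuous_coordLoss i _).measurable.comp (by fun_prop))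

/-- Both parts follow the check function, the estimate at scale · a and the loss at scale · a + y.
The location parameters cancel from this difference, so the bound does not involve θ. -/
lemma abs_lossError_le (hρ : M.varRatio i < 1 / 8) (hγ : 0 ≤ γ i) (τ : ℝ≥0∞) (m μ y : ℝ) :
    |M.lossError γ n i τ m μ y| ≤ (M.b i + M.h i)
      * (M.scale i τ * (3 + threshold γ n i + M.sizeBound γ n i) + |y| + √(M.σf i)) := by
  have hw := M.weight_pos i
  have hS := M.scale_pos i τ
  set q := M.shrink i τ * (y + μ) + m
      + √(M.σf i + M.shrink i τ * M.σp i) * stdQuantile (M.ratio i) with hq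
  set a := M.c i τ + M.d i τ * (y + μ) with ha
  have hqa : q - (m + μ) = M.scale i τ * a + y := by
    have h1 := M.scale_mul_c i τ
    have h2 := M.scale_mul_d i τ
    rw [hq, ha]
    linear_combination -h1 - (y + μ) * h2
  have h1 := abs_T_sub_check_le (n := n) hρ hγ τ (y + μ)
  have h2 := M.abs_coordLoss_sub_check_le i (m + μ) q
  have h3 := abs_check_sub_le (M.ratio_nonneg i) (M.ratio_le_one i) (M.scale i τ * a)
    (M.scale i τ * a + y)
  rw [hqa] at h2
  rw [sub_add_cancel_left, abs_neg, check_mul hS.le] at h3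
  have e : M.lossError γ n i τ m μ y
      = (M.b i + M.h i) * M.scale i τ * (M.T γ n i (y + μ) τ - check (M.ratio i) a)
        + (M.b i + M.h i) * (M.scale i τ * check (M.ratio i) a
          - check (M.ratio i) (M.scale i τ * a + y))
        - (M.coordLoss i (m + μ) q
          - (M.b i + M.h i) * check (M.ratio i) (M.scale i τ * a + y)) := by
    rw [lossError]; ring
  rw [e]
  refine (abs_sub _ _).trans ((add_le_add (abs_add_le _ _) h2).trans ?_)
  rw [abs_mul, abs_mul (M.b i + M.h i), abs_mul, abs_of_pos hw, abs_of_pos hS]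
  have h4 := mul_le_mul_of_nonneg_left h1 (mul_pos hw hS).le
  have h5 := mul_le_mul_of_nonneg_left h3 hw.le
  linarith

lemma abs_integral_lossError_le (hρ : M.varRatio i < 1 / 8) (hγ : 0 ≤ γ i) (hn : 1 ≤ n)
    (τ : ℝ≥0∞) (m μ w : ℝ) :
    |∫ x, M.lossError γ n i τ m μ (x - w) ∂(gaussianReal 0 (M.σp i))|
      ≤ (M.b i + M.h i) * (M.scale i τ * M.biasBound γ n i + |w|) := by
  have hw := M.weight_pos i
  have hS := M.scale_pos i τ
  set s := √(M.σf i + M.shrink i τ * M.σp i) * stdQuantile (M.ratio i) with hs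
  set r := M.shrink i τ * (μ - w) + m + s with hr
  set κ := M.shrink i τ * √(M.σp i) with hκ
  have hκ2 : κ ^ 2 = M.σp i * M.shrink i τ ^ 2 := by
    rw [hκ, mul_pow, Real.sq_sqrt (M.σp_pos' i).le]; ring
  set ω := M.c i τ + M.d i τ * (μ - w) with hω
  -- Given a shift by w, the estimate targets G at ω. This is exactly the mean loss of the rule
  -- centred at r + w; the actual centre is r, and the gap costs |w| by the Lipschitz property.
  have hrω : r + w - (m + μ) = √(M.σf i + κ ^ 2) * ω := by
    have h1 := M.scale_mul_c i τ
    have h2 := M.scale_mul_d i τ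
    rw [hκ2, ← scale, hr, hω]
    linear_combination -h1 - (μ - w) * h2
  have hmean := M.integral_coordLoss i (m + μ) (r + w) κ ω hrω
  rw [hκ2, ← scale] at hmean
  have hT := abs_integral_T_sub_G_le hρ hγ hn τ (μ - w)
  have iT := integrable_T (n := n) hρ hγ τ (μ - w) √(M.σp i)
  have iL : ∀ r : ℝ, Integrable (fun z => M.coordLoss i (m + μ) (r + κ * z)) stdNormal := by
    intro r
    have hb : Integrable (fun z : ℝ => |M.coordLoss i (m + μ) 0| + (M.b i + M.h i) * |r + κ * z|)
        stdNormal := (integrable_const _).add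
      (((integrable_const r).add (integrable_id_stdNormal.const_mul κ)).abs.const_mul _)
    refine hb.mono' ((M.continuous_coordLoss i _).comp (by fun_prop)).aestronglyMeasurable
      (ae_of_all _ fun z => ?_)
    have h1 := M.abs_coordLoss_sub_le i (m + μ) (r + κ * z) 0
    have h2 := abs_sub_abs_le_abs_sub (M.coordLoss i (m + μ) (r + κ * z)) (M.coordLoss i (m + μ) 0)
    rw [sub_zero] at h1
    rw [Real.norm_eq_abs]
    linarith
  have hshift : |(∫ z, M.coordLoss i (m + μ) (r + w + κ * z) ∂stdNormal)
      - ∫ z, M.coordLoss i (m + μ) (r + κ * z) ∂stdNormal| ≤ (M.b i + M.h i) * |w| := by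
    rw [← integral_sub (iL _) (iL _), ← Real.norm_eq_abs]
    refine (norm_integral_le_of_norm_le (integrable_const ((M.b i + M.h i) * |w|))
      (ae_of_all _ fun z => ?_)).trans (by simp)
    exact (M.abs_coordLoss_sub_le i _ _ _).trans (le_of_eq (by congr 2; ring))
  have e : ∫ x, M.lossError γ n i τ m μ (x - w) ∂(gaussianReal 0 (M.σp i))
      = (M.b i + M.h i) * M.scale i τ * (∫ z, M.T γ n i (μ - w + √(M.σp i) * z) τ ∂stdNormal)
        - ∫ z, M.coordLoss i (m + μ) (r + κ * z) ∂stdNormal := by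
    rw [integral_gaussianReal_eq_stdNormal (f := fun x => M.lossError γ n i τ m μ (x - w))
      ((measurable_lossError τ m μ).comp (measurable_id.sub_const w)),
      ← integral_const_mul, ← integral_sub (iT.const_mul _) (iL _)]
    congr 1
    ext z
    rw [lossError, hr, hκ]
    congr 2
    · congr 1; ring
    · ring
  rw [e]
  have e2 : (M.b i + M.h i) * M.scale i τ * (∫ z, M.T γ n i (μ - w + √(M.σp i) * z) τ ∂stdNormal)
        - ∫ z, M.coordLoss i (m + μ) (r + κ * z) ∂stdNormal
      = (M.b i + M.h i) * M.scale i τ * ((∫ z, M.T γ n i (μ - w + √(M.σp i) * z) τ ∂stdNormal)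
          - G ω (M.ratio i))
        + ((∫ z, M.coordLoss i (m + μ) (r + w + κ * z) ∂stdNormal)
          - ∫ z, M.coordLoss i (m + μ) (r + κ * z) ∂stdNormal) := by
    rw [hmean]; ring
  rw [e2]
  refine (abs_add_le _ _).trans ((add_le_add le_rfl hshift).trans ?_)
  rw [abs_mul, abs_mul, abs_of_pos hw, abs_of_pos hS]
  have h4 := mul_le_mul_of_nonneg_left hT (mul_pos hw hS).le
  linarith

end Model

namespace Model

/-! ### Uniform bounds over the coordinates -/

section Uniform

variable {M : Model} {γ : ℕ → ℝ} {n i : ℕ} {ε : ℝ}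

lemma varRatio_lt (h : M.varRatio i < 1 / (4 * Real.exp 1)) : M.varRatio i < 1 / 8 := by
  refine h.trans (one_div_lt_one_div_of_lt (by norm_num) ?_)
  linarith [Real.exp_one_gt_d9]

/-- Put A = 1/√(4e) and s = √(σp/σf). As s ≤ A and 8A² ≤ 1, (A - s)² ≤ A² - s² ≤ A²(1 - 8s²), so the
inflation factor is offset and at most A² ≤ 1/10 remains. -/
lemma inflation_mul_sq_le (h : M.varRatio i < 1 / (4 * Real.exp 1)) (h0 : 0 ≤ γ i)
    (h1 : γ i < 1 / √(4 * Real.exp 1) - √(M.varRatio i)) :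
    M.inflation i * γ i ^ 2 ≤ 1 / 10 := by
  have he := Real.exp_one_gt_d9
  have hρ := M.varRatio_pos i
  have h8 := varRatio_lt h
  set A := 1 / √(4 * Real.exp 1) with hA
  set s := √(M.varRatio i) with hs
  have hA2 : A ^ 2 = 1 / (4 * Real.exp 1) := by
    rw [hA, div_pow, Real.sq_sqrt (by positivity), one_pow]
  have hs2 : s ^ 2 = M.varRatio i := Real.sq_sqrt hρ.le
  have hs0 : 0 ≤ s := Real.sqrt_nonneg _
  have hA10 : A ^ 2 ≤ 1 / 10 := by
    rw [hA2]; exact one_div_le_one_div_of_le (by norm_num) (by linarith)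
  have hγ2 : γ i ^ 2 ≤ (A - s) ^ 2 := pow_le_pow_left₀ h0 h1.le 2
  have key : (A - s) ^ 2 ≤ A ^ 2 * (1 - 8 * s ^ 2) := by
    have hsA : s ≤ A := by linarith
    have : s * (8 * A ^ 2 * s) ≤ s * s := by
      refine mul_le_mul_of_nonneg_left (mul_le_of_le_one_left hs0 (by linarith)) hs0
    nlinarith [mul_nonneg hs0 (sub_nonneg.2 hsA)]
  rw [inflation, ← hs2, one_div_mul_eq_div, div_le_iff₀ (by rw [hs2]; linarith)]
  have : 0 ≤ 1 - 8 * s ^ 2 := by rw [hs2]; linarith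
  nlinarith

lemma gamma_le_half (h1 : γ i < 1 / √(4 * Real.exp 1) - √(M.varRatio i)) : γ i ≤ 1 / 2 := by
  have he := Real.exp_one_gt_d9
  have h2 : (2 : ℝ) ≤ √(4 * Real.exp 1) := Real.le_sqrt_of_sq_le (by linarith)
  have h3 := one_div_le_one_div_of_le (by norm_num) h2
  linarith [Real.sqrt_nonneg (M.varRatio i)]

lemma threshold_sq (hn : 1 ≤ n) : threshold γ n i ^ 2 = 2 * γ i ^ 2 * Real.log n := by
  have hlog : 0 ≤ Real.log n := Real.log_nonneg (by exact_mod_cast hn)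
  rw [threshold, mul_pow, Real.sq_sqrt (by positivity)]
  ring

lemma threshold_le (hn : 1 ≤ n) (h0 : 0 ≤ γ i)
    (h1 : γ i < 1 / √(4 * Real.exp 1) - √(M.varRatio i)) :
    threshold γ n i ≤ 1 + Real.log n := by
  have hlog : 0 ≤ Real.log n := Real.log_nonneg (by exact_mod_cast hn)
  have h2 := gamma_le_half h1
  refine le_of_sq_le_sq ?_ (by linarith)
  rw [threshold_sq hn]
  have h3 : γ i ^ 2 ≤ 1 := by nlinarith
  nlinarith [mul_le_mul_of_nonneg_right h3 hlog]

lemma order_sub_one_le (hn : 1 ≤ n) (h : M.varRatio i < 1 / (4 * Real.exp 1)) (h0 : 0 ≤ γ i)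
    (h1 : γ i < 1 / √(4 * Real.exp 1) - √(M.varRatio i)) :
    ((M.order γ n i - 1 : ℕ) : ℝ) ≤ 16 * (1 + Real.log n) := by
  have hlog : 0 ≤ Real.log n := Real.log_nonneg (by exact_mod_cast hn)
  have h2 := gamma_le_half h1
  have h8 := varRatio_lt h
  have h3 : √(2 * M.varRatio i) ≤ 1 / 2 :=
    Real.sqrt_le_iff.2 ⟨by norm_num, by norm_num; linarith⟩
  have h4 : (γ i + √(2 * M.varRatio i)) ^ 2 ≤ 1 :=
    pow_le_one₀ (add_nonneg h0 (Real.sqrt_nonneg _)) (by linarith)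
  have h5 : Real.exp 1 ^ 2 ≤ 8 := by nlinarith [Real.exp_one_lt_d9, Real.exp_pos 1]
  have h6 : 2 * (M.σp i : ℝ) / M.σf i = 2 * M.varRatio i := mul_div_assoc _ _ _
  rw [order, Nat.add_sub_cancel_left, h6]
  refine (Nat.ceil_lt_add_one (by positivity)).le.trans ?_
  have h7 : Real.exp 1 ^ 2 * (γ i + √(2 * M.varRatio i)) ^ 2 ≤ 8 * 1 :=
    mul_le_mul h5 h4 (sq_nonneg _) (by norm_num)
  nlinarith [mul_le_mul_of_nonneg_right h7 (by linarith : 0 ≤ 2 * Real.log n)]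

lemma le_order_sub_one (hn : 1 ≤ n) (h0 : 0 ≤ γ i) :
    4 * γ i ^ 2 * Real.log n ≤ ((M.order γ n i - 1 : ℕ) : ℝ) := by
  have hlog : 0 ≤ Real.log n := Real.log_nonneg (by exact_mod_cast hn)
  have h6 : 2 * (M.σp i : ℝ) / M.σf i = 2 * M.varRatio i := mul_div_assoc _ _ _
  rw [order, Nat.add_sub_cancel_left, h6]
  refine le_trans ?_ (Nat.le_ceil _)
  have h5 : 4 ≤ Real.exp 1 ^ 2 := by nlinarith [Real.exp_one_gt_d9]
  have h4 : γ i ^ 2 ≤ (γ i + √(2 * M.varRatio i)) ^ 2 :=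
    pow_le_pow_left₀ h0 (by linarith [Real.sqrt_nonneg (2 * M.varRatio i)]) 2
  have h7 : 4 * γ i ^ 2 ≤ Real.exp 1 ^ 2 * (γ i + √(2 * M.varRatio i)) ^ 2 :=
    mul_le_mul h5 h4 (sq_nonneg _) (by positivity)
  nlinarith [mul_le_mul_of_nonneg_right h7 hlog, mul_nonneg (sq_nonneg (γ i)) hlog]

/-- The order contributes a logarithm and exp(tλ²/2) = n^(tγ²) at most n^(1/10). -/
lemma sizeBound_le (hn : 1 ≤ n) (h : M.varRatio i < 1 / (4 * Real.exp 1)) (h0 : 0 ≤ γ i)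
    (h1 : γ i < 1 / √(4 * Real.exp 1) - √(M.varRatio i)) :
    M.sizeBound γ n i ≤ 34 * (1 + Real.log n) * Real.exp (Real.log n / 10) := by
  have hlog : 0 ≤ Real.log n := Real.log_nonneg (by exact_mod_cast hn)
  have h2 := order_sub_one_le hn h h0 h1
  have h3 := inflation_mul_sq_le h h0 h1
  rw [sizeBound, estimateBound, threshold_sq hn]
  refine mul_le_mul (by linarith) (Real.exp_le_exp.2 ?_) (Real.exp_nonneg _) (by linarith)
  nlinarith [mul_le_mul_of_nonneg_right h3 hlog]

lemma sizeBound_nonneg : 0 ≤ M.sizeBound γ n i := estimateBound_nonneg _ _ _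

/-- Up to logarithms the four contributions are n^(-γ²/4) from the outer regimes, n^(1/5 - 1) from
truncation, n^(-γ²) from the Taylor remainder and n^(1/10 - 1/2) from distant ω. The two conditions
on δ are read off from the slowest of these. The constants 4, 1156, 16 and 37 sum to less than 1300.
-/
lemma biasBound_le (hε : 0 ≤ ε) (hn : 1 ≤ n) (h : M.varRatio i < 1 / (4 * Real.exp 1))
    (h0 : ε ≤ γ i) (h1 : γ i < 1 / √(4 * Real.exp 1) - √(M.varRatio i)) {δ : ℝ}
    (hδ : δ ≤ ε ^ 2 / 4) (hδ' : δ ≤ 2 / 5) :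
    M.biasBound γ n i ≤ 1300 * (1 + Real.log n) ^ 2 * Real.exp (-(δ * Real.log n)) := by
  have hγ0 : 0 ≤ γ i := hε.trans h0
  have hn0 : (0 : ℝ) < n := by exact_mod_cast hn
  have hlog : 0 ≤ Real.log n := Real.log_nonneg (by exact_mod_cast hn)
  have hN := le_order_sub_one (M := M) hn hγ0
  have hN' := order_sub_one_le hn h hγ0 h1
  have hB := sizeBound_le hn h hγ0 h1
  have hB0 := sizeBound_nonneg (M := M) (γ := γ) (n := n) (i := i)
  have hth := threshold_le hn hγ0 h1
  have hth2 := threshold_sq (γ := γ) (i := i) hn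
  have hth0 := threshold_nonneg (n := n) hγ0
  have hexpn : Real.exp (Real.log n) = n := Real.exp_log hn0
  have hsq : √(2 * Real.log n) ^ 2 = 2 * Real.log n := Real.sq_sqrt (by positivity)
  rw [biasBound, hth2, hsq]
  set ℓ := Real.log n
  set N : ℝ := ((M.order γ n i - 1 : ℕ) : ℝ)
  set E := Real.exp (-(δ * ℓ)) with hE
  have hε2 : ε ^ 2 ≤ γ i ^ 2 := pow_le_pow_left₀ hε h0 2
  have hδγ : δ * ℓ ≤ γ i ^ 2 / 4 * ℓ := mul_le_mul_of_nonneg_right (by linarith) hlog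
  have hδ5 : δ * ℓ ≤ 2 / 5 * ℓ := mul_le_mul_of_nonneg_right hδ' hlog
  have hE0 : 0 < E := Real.exp_pos _
  set L := 1 + ℓ with hL
  have hL1 : 1 ≤ L := by linarith
  have hLL : L ≤ L ^ 2 := by nlinarith
  have t1 : Real.exp (-(2 * γ i ^ 2 * ℓ / 8)) ≤ E := Real.exp_le_exp.2 (by linarith)
  have t2 : M.sizeBound γ n i ^ 2 / n ≤ 1156 * L ^ 2 * E := by
    rw [div_le_iff₀ hn0]
    calc M.sizeBound γ n i ^ 2 ≤ (34 * L * Real.exp (ℓ / 10)) ^ 2 := pow_le_pow_left₀ hB0 hB 2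
      _ = 1156 * L ^ 2 * Real.exp (ℓ / 5) := by
          rw [mul_pow, mul_pow, ← Real.exp_nat_mul]; norm_num; left; ring
      _ ≤ 1156 * L ^ 2 * (E * Real.exp ℓ) := by
          rw [← Real.exp_add]
          gcongr
          linarith
      _ = 1156 * L ^ 2 * E * n := by rw [hexpn]; ring
  have t3 : N * Real.exp (-(N / 4)) ≤ 16 * L * E :=
    mul_le_mul hN' (Real.exp_le_exp.2 (by
      have := mul_nonneg (sq_nonneg (γ i)) hlog
      linarith)) (Real.exp_nonneg _) (by linarith)
  have t4 : (M.sizeBound γ n i + 2 + threshold γ n i) * Real.exp (-(2 * ℓ / 4)) ≤ 37 * L * E := by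
    have hx : 1 ≤ Real.exp (ℓ / 10) := Real.one_le_exp (by linarith)
    calc _ ≤ (37 * L * Real.exp (ℓ / 10)) * Real.exp (-(2 * ℓ / 4)) := by
          gcongr
          have := le_mul_of_one_le_right (by linarith : 0 ≤ L) hx
          linarith
      _ = 37 * L * Real.exp (ℓ / 10 + -(2 * ℓ / 4)) := by rw [Real.exp_add]; ring
      _ ≤ 37 * L * E :=
          mul_le_mul_of_nonneg_left (Real.exp_le_exp.2 (by linarith)) (by linarith)
  have hLE : L * E ≤ L ^ 2 * E := mul_le_mul_of_nonneg_right hLL hE0.le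
  have hLE' : E ≤ L ^ 2 * E := le_mul_of_one_le_left hE0.le (by linarith)
  linarith

end Uniform

end Model

/-- From |f| ≤ f²/s + s, which for s of the order of the root mean square is as good as the
Cauchy–Schwarz inequality. -/
lemma lintegral_abs_le_of_integral_sq_le {Ω : Type*} [MeasurableSpace Ω] {P : Measure Ω}
    [IsProbabilityMeasure P] {f : Ω → ℝ} (hf : MemLp f 2 P) {K s : ℝ} (hs : 0 < s)
    (h : ∫ ω, f ω ^ 2 ∂P ≤ K * s ^ 2) :
    ∫⁻ ω, ENNReal.ofReal |f ω| ∂P ≤ ENNReal.ofReal ((K + 1) * s) := by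
  have hi : Integrable (fun ω => f ω ^ 2 / s + s) P :=
    (hf.integrable_sq.div_const s).add (integrable_const s)
  calc ∫⁻ ω, ENNReal.ofReal |f ω| ∂P ≤ ∫⁻ ω, ENNReal.ofReal (f ω ^ 2 / s + s) ∂P := by
        refine lintegral_mono fun ω => ENNReal.ofReal_le_ofReal ?_
        have h1 : f ω ^ 2 / s + s = (f ω ^ 2 + s ^ 2) / s := by field_simp
        rw [h1, le_div_iff₀ hs]
        nlinarith [sq_nonneg (|f ω| - s), sq_abs (f ω), abs_nonneg (f ω)]
    _ = ENNReal.ofReal (∫ ω, (f ω ^ 2 / s + s) ∂P) :=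
        (ofReal_integral_eq_lintegral_ofReal hi (ae_of_all _ fun ω => by positivity)).symm
    _ ≤ ENNReal.ofReal ((K + 1) * s) := by
        refine ENNReal.ofReal_le_ofReal ?_
        rw [integral_add (hf.integrable_sq.div_const s) (integrable_const s), integral_div,
          integral_const]
        have h2 : (∫ ω, f ω ^ 2 ∂P) / s ≤ K * s := by
          rw [div_le_iff₀ hs]; linarith
        simp only [probReal_univ, one_smul]
        linarith

namespace Model

/-! ### The error of the risk estimate -/

/-- The noise of coordinate `i` of the past data. -/
def pastNoise (θ : ℕ → ℝ) {n : ℕ} (i : Fin n) (x : Fin n → ℝ) : ℝ := x i - θ i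

section Error

variable {M : Model} {γ θ : ℕ → ℝ} {n : ℕ}

instance : IsProbabilityMeasure (M.pastLaw θ n) := by unfold pastLaw; infer_instance

lemma measurable_pastNoise (i : Fin n) : Measurable (pastNoise θ i) := by
  unfold pastNoise; fun_prop

lemma iIndepFun_pastNoise : iIndepFun (fun i : Fin n => pastNoise θ i) (M.pastLaw θ n) :=
  iIndepFun_pi (X := fun (i : Fin n) (x : ℝ) => x - θ i)
    (μ := fun i : Fin n => gaussianReal (θ i) (M.σp i))
    fun _ => (measurable_id.sub_const _).aemeasurable

lemma map_pastNoise (i : Fin n) :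
    (M.pastLaw θ n).map (pastNoise θ i) = gaussianReal 0 (M.σp i) := by
  have h := gaussianReal_map_sub_const (μ := θ i) (v := M.σp i) (θ i)
  have h2 := (measurePreserving_eval (fun i : Fin n => gaussianReal (θ i) (M.σp i)) i).map_eq
  rw [← h2, Measure.map_map (by fun_prop) (by fun_prop), sub_self] at h
  exact h

lemma measurable_mean : Measurable (mean : (Fin n → ℝ) → ℝ) := by unfold mean; fun_prop

lemma measurable_AREG_sub_loss (τ : ℝ≥0∞) :
    Measurable fun x => M.AREG γ n τ x - M.loss n θ (M.grandMeanRule n τ x) := by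
  have hm := measurable_mean (n := n)
  unfold AREG ARE loss grandMeanRule
  refine Measurable.sub ?_ ?_
  · refine (Finset.measurable_sum _ fun i _ => ?_).const_mul _
    exact ((M.measurable_T γ n i τ).comp ((measurable_pi_apply i).sub hm)).const_mul _
  · refine (Finset.measurable_sum _ fun i _ => ?_).const_mul _
    exact (M.continuous_coordLoss i (θ i)).measurable.comp (by fun_prop)

/-- The average of the errors of the coordinates with the grand mean of the data replaced by that
of the parameters. -/
noncomputable def averageError (M : Model) (γ θ : ℕ → ℝ) (n : ℕ) (τ : ℝ≥0∞) (x : Fin n → ℝ) : ℝ :=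
  (1 / (n : ℝ)) * ∑ i : Fin n, M.lossError γ n i τ (mean fun k : Fin n => θ k)
    (θ i - mean fun k : Fin n => θ k) (centred (pastNoise θ) i x)

/-- The estimate sees only x_i - mean x, which is exactly the centred noise plus θ_i - mean θ. The
rule equals shrinkage of x_i - mean x plus mean x plus a constant, so exchanging the two grand means
shifts every prediction by the same average noise. -/
lemma abs_AREG_sub_loss_le (hn : 1 ≤ n) {C₁ : ℝ} (hC₁ : ∀ i, M.b i + M.h i ≤ C₁) (τ : ℝ≥0∞)
    (x : Fin n → ℝ) :
    |M.AREG γ n τ x - M.loss n θ (M.grandMeanRule n τ x)|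
      ≤ |M.averageError γ θ n τ x|
        + C₁ * |(1 / (n : ℝ)) * ∑ k : Fin n, pastNoise θ k x| := by
  have hn0 : (0 : ℝ) < n := by exact_mod_cast hn
  set m := mean fun k : Fin n => θ k with hm
  set D := (1 / (n : ℝ)) * ∑ k : Fin n, pastNoise θ k x with hD
  have hDm : D = mean x - m := by
    rw [hD, hm]
    simp only [pastNoise, mean, Finset.sum_sub_distrib, mul_sub]
  have hcen : ∀ i : Fin n, centred (pastNoise θ) i x + (θ i - m) = x i - mean x := by
    intro i
    have : centred (pastNoise θ) i x = pastNoise θ i x - D := rfl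
    rw [this, hDm, pastNoise]; ring
  set s : Fin n → ℝ := fun i => √(M.σf i + M.shrink i τ * M.σp i) * stdQuantile (M.ratio i) with hs
  have e : M.AREG γ n τ x - M.loss n θ (M.grandMeanRule n τ x)
      = M.averageError γ θ n τ x + (1 / (n : ℝ)) * ∑ i : Fin n,
        (M.coordLoss i (θ i) (M.shrink i τ * (x i - mean x) + m + s i)
          - M.coordLoss i (θ i) (M.grandMeanRule n τ x i)) := by
    rw [AREG, ARE, loss, averageError, ← mul_sub, ← mul_add, ← Finset.sum_sub_distrib,
      ← Finset.sum_add_distrib]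
    congr 1
    refine Finset.sum_congr rfl fun i _ => ?_
    rw [lossError, hcen, add_sub_cancel, scale]
    ring
  rw [e]
  refine (abs_add_le _ _).trans (add_le_add le_rfl ?_)
  rw [abs_mul, abs_of_pos (by positivity : 0 < 1 / (n : ℝ))]
  calc 1 / (n : ℝ) * |∑ i : Fin n, (M.coordLoss i (θ i) (M.shrink i τ * (x i - mean x) + m + s i)
          - M.coordLoss i (θ i) (M.grandMeanRule n τ x i))|
      ≤ 1 / (n : ℝ) * ∑ _i : Fin n, C₁ * |D| := by
        refine mul_le_mul_of_nonneg_left ((Finset.abs_sum_le_sum_abs _ _).trans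
          (Finset.sum_le_sum fun i _ => ?_)) (by positivity)
        refine (M.abs_coordLoss_sub_le i _ _ _).trans ?_
        have h1 : M.shrink i τ * (x i - mean x) + m + s i - M.grandMeanRule n τ x i = -D := by
          rw [grandMeanRule, hDm, hs]; ring
        rw [h1, abs_neg]
        exact mul_le_mul_of_nonneg_right (hC₁ i) (abs_nonneg _)
    _ = C₁ * |D| := by
        rw [Finset.sum_const, Finset.card_univ, Fintype.card_fin, nsmul_eq_mul]
        field_simp

/-- A bound of the mean error of the risk estimate that is uniform in the hyperparameter. -/
lemma exists_lintegral_abs_AREG_sub_loss_le {C₁ Cf r s₀ s₁ ε δ : ℝ}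
    (hC₁ : ∀ i, M.b i + M.h i ≤ C₁) (hr : r < 1 / (4 * Real.exp 1)) (hρ : ∀ i, M.varRatio i ≤ r)
    (hf : ∀ i, (M.σf i : ℝ) ≤ Cf) (hs₀ : 0 < s₀) (hσ : ∀ i, s₀ ≤ M.σp i ∧ M.σp i ≤ s₁)
    (hε : 0 ≤ ε) (hγ0 : ∀ i, ε ≤ γ i)
    (hγ1 : ∀ i, γ i < 1 / √(4 * Real.exp 1) - √(M.varRatio i))
    (hδ : δ ≤ ε ^ 2 / 4) (hδ' : δ ≤ 2 / 5) :
    ∃ C : ℝ, 0 ≤ C ∧ ∃ n₀ : ℕ, ∀ n ≥ n₀, ∀ τ,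
      ∫⁻ x, ENNReal.ofReal |M.AREG γ n τ x - M.loss n θ (M.grandMeanRule n τ x)| ∂(M.pastLaw θ n)
        ≤ ENNReal.ofReal (C * ((1 + Real.log n) ^ 2 * Real.exp (-(δ * Real.log n)))) := by
  have hs₀₁ : s₀ ≤ s₁ := (hσ 0).1.trans (hσ 0).2
  have hs₁ : 0 < s₁ := hs₀.trans_le hs₀₁
  have hCf : 0 < Cf := (M.σf_pos' 0).trans_le (hf 0)
  have hC₁0 : 0 < C₁ := (M.weight_pos 0).trans_le (hC₁ 0)
  obtain ⟨C, hC0, n₀, hC⟩ := exists_integral_sq_average_centred_le hs₀ hs₀₁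
  set Q := √(Cf + s₁) with hQ
  have hQ0 : 0 ≤ Q := Real.sqrt_nonneg _
  set K := C * ((C₁ * (38 * Q + 1 + √Cf)) ^ 2 + (C₁ * Q * 1300) ^ 2 + C₁ ^ 2) with hK
  -- With s the target rate, K s² bounds the mean square of the averaged coordinate errors and s₁ s²
  -- that of the average noise; each is turned into a first moment.
  refine ⟨(K + 1) + C₁ * (s₁ + 1), by positivity, n₀ + 1, fun n hn τ => ?_⟩
  have hn1 : 1 ≤ n := by omega
  have hn0 : (0 : ℝ) < n := by exact_mod_cast hn1
  have hlog : 0 ≤ Real.log n := Real.log_nonneg (by exact_mod_cast hn1)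
  have hexpn : Real.exp (Real.log n) = n := Real.exp_log hn0
  have hv : ∀ i, M.varRatio i < 1 / (4 * Real.exp 1) := fun i => (hρ i).trans_lt hr
  have hγ : ∀ i, 0 ≤ γ i := fun i => hε.trans (hγ0 i)
  have hS : ∀ i, M.scale i τ ≤ Q := by
    intro i
    refine Real.sqrt_le_sqrt (add_le_add (hf i) ?_)
    obtain ⟨h0, h1⟩ := M.shrink_mem i τ
    exact (mul_le_of_le_one_right (NNReal.coe_nonneg _) (pow_le_one₀ h0 h1)).trans (hσ i).2
  set ℓ := Real.log n with hℓ
  set L := 1 + ℓ with hL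
  have hL1 : 1 ≤ L := by linarith
  set E := Real.exp (-(δ * ℓ)) with hE
  have hE0 : 0 < E := Real.exp_pos _
  set s := L ^ 2 * E with hs
  have hs0 : 0 < s := by positivity
  set X := Real.exp (ℓ / 10) with hX
  have hX1 : 1 ≤ X := Real.one_le_exp (by linarith)
  have hLX : 1 ≤ L * X := by nlinarith
  have hδℓ : δ * ℓ ≤ 2 / 5 * ℓ := mul_le_mul_of_nonneg_right hδ' hlog
  -- This is n^(1/5 - 1) ≤ n^(-2δ), another use of δ ≤ 2/5: the squared growth bound over n is
  -- within the squared rate.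
  have hXn : X ^ 2 / n ≤ E ^ 2 := by
    rw [div_le_iff₀ hn0, ← hexpn, hX, hE, ← Real.exp_nat_mul, ← Real.exp_nat_mul, ← Real.exp_add]
    refine Real.exp_le_exp.2 ?_
    push_cast
    linarith
  have h1n : 1 / (n : ℝ) ≤ E ^ 2 :=
    (div_le_div_of_nonneg_right (by nlinarith) hn0.le).trans hXn
  have hL2 : L ^ 2 ≤ L ^ 4 := pow_le_pow_right₀ hL1 (by norm_num)
  have hL4 : 1 ≤ L ^ 4 := one_le_pow₀ hL1
  have hs2 : s ^ 2 = L ^ 4 * E ^ 2 := by rw [hs]; ring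
  -- Here 38 = 3 + 1 + 34 adds up the constant, the threshold and the size bound, each relative to L
  -- · X, and Q bounds the scale.
  set B := C₁ * (38 * Q + 1 + √Cf) * (L * X) with hB
  set η := C₁ * Q * 1300 * s with hη
  have hB0 : 0 ≤ B := by positivity
  have hmain := hC n (by omega) (M.pastLaw θ n) (fun i : Fin n => pastNoise θ i)
    (fun i => M.σp i) measurable_pastNoise iIndepFun_pastNoise map_pastNoise (fun i => hσ i)
    (fun i => M.lossError γ n i τ (mean fun k : Fin n => θ k) (θ i - mean fun k : Fin n => θ k))
    B η C₁ (fun i => measurable_lossError _ _ _) hB0 ?_ ?_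
  · obtain ⟨hL2', hint⟩ := hmain
    have hint' : ∫ x, M.averageError γ θ n τ x ^ 2 ∂(M.pastLaw θ n) ≤ K * s ^ 2 := by
      refine hint.trans ?_
      rw [hK, mul_assoc]
      refine mul_le_mul_of_nonneg_left ?_ hC0
      have e1 : B ^ 2 / n ≤ (C₁ * (38 * Q + 1 + √Cf)) ^ 2 * s ^ 2 := by
        rw [hB, hs2]
        calc _ = (C₁ * (38 * Q + 1 + √Cf)) ^ 2 * (L ^ 2 * (X ^ 2 / n)) := by ring
          _ ≤ (C₁ * (38 * Q + 1 + √Cf)) ^ 2 * (L ^ 4 * E ^ 2) := by gcongr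
      have e2 : η ^ 2 = (C₁ * Q * 1300) ^ 2 * s ^ 2 := by rw [hη]; ring
      have e3 : C₁ ^ 2 / n ≤ C₁ ^ 2 * s ^ 2 := by
        rw [hs2, div_eq_mul_one_div]
        refine mul_le_mul_of_nonneg_left (h1n.trans ?_) (sq_nonneg _)
        exact le_mul_of_one_le_left (sq_nonneg _) hL4
      linarith
    have h1 := lintegral_abs_le_of_integral_sq_le (f := M.averageError γ θ n τ) hL2' hs0 hint'
    obtain ⟨hL3, hint3⟩ := integral_sq_average_le (P := M.pastLaw θ n)
      (measurable_pastNoise (θ := θ)) iIndepFun_pastNoise map_pastNoise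
      (fun i => (hσ i).2) hs₁.le Finset.univ
    have h2 := lintegral_abs_le_of_integral_sq_le (K := s₁) hL3 hs0 (hint3.trans (by
      rw [hs2, div_eq_mul_one_div]
      refine mul_le_mul_of_nonneg_left (h1n.trans ?_) hs₁.le
      exact le_mul_of_one_le_left (sq_nonneg _) hL4))
    calc _ ≤ ∫⁻ x, (ENNReal.ofReal |M.averageError γ θ n τ x| + ENNReal.ofReal C₁
            * ENNReal.ofReal |(1 / (n : ℝ)) * ∑ k : Fin n, pastNoise θ k x|) ∂(M.pastLaw θ n) := by
          refine lintegral_mono fun x => ?_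
          rw [← ENNReal.ofReal_mul hC₁0.le, ← ENNReal.ofReal_add (abs_nonneg _) (by positivity)]
          exact ENNReal.ofReal_le_ofReal (abs_AREG_sub_loss_le hn1 hC₁ τ x)
      _ ≤ ENNReal.ofReal ((K + 1) * s) + ENNReal.ofReal C₁ * ENNReal.ofReal ((s₁ + 1) * s) := by
          have hm : Measurable fun x : Fin n → ℝ =>
              ENNReal.ofReal |(1 / (n : ℝ)) * ∑ k : Fin n, pastNoise θ k x| := by
            unfold pastNoise; fun_prop
          rw [lintegral_add_right _ (hm.const_mul _), lintegral_const_mul _ hm]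
          gcongr
      _ = ENNReal.ofReal ((K + 1 + C₁ * (s₁ + 1)) * s) := by
          rw [← ENNReal.ofReal_mul hC₁0.le, ← ENNReal.ofReal_add (by positivity) (by positivity)]
          congr 1; ring
  · intro i y
    refine (abs_lossError_le (varRatio_lt (hv i)) (hγ i) τ _ _ y).trans ?_
    have h1 := sizeBound_le hn1 (hv i) (hγ i) (hγ1 i)
    have h2 := threshold_le hn1 (hγ i) (hγ1 i)
    have h3 : 3 + threshold γ n i + M.sizeBound γ n i ≤ 38 * (L * X) := by
      have : L ≤ L * X := le_mul_of_one_le_right (by linarith) hX1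
      linarith
    have h4 : √(M.σf i : ℝ) ≤ √Cf := Real.sqrt_le_sqrt (hf i)
    have h5 : 0 ≤ 3 + threshold γ n i + M.sizeBound γ n i := by
      have := threshold_nonneg (n := n) (hγ i)
      have := sizeBound_nonneg (M := M) (γ := γ) (n := n) (i := i)
      linarith
    have h6 : M.scale i τ * (3 + threshold γ n i + M.sizeBound γ n i) ≤ Q * (38 * (L * X)) :=
      mul_le_mul (hS i) h3 h5 hQ0
    have h7 : Q * (38 * (L * X)) + |y| + √Cf
        ≤ (38 * Q + 1 + √Cf) * (L * X) * (1 + |y|) := by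
      have hy := abs_nonneg y
      have hc := Real.sqrt_nonneg Cf
      have a1 : Q * (38 * (L * X)) ≤ Q * (38 * (L * X)) * (1 + |y|) :=
        le_mul_of_one_le_right (by positivity) (by linarith)
      have a2 : 1 + |y| ≤ (L * X) * (1 + |y|) := le_mul_of_one_le_left (by positivity) hLX
      have a3 : √Cf * 1 ≤ √Cf * ((L * X) * (1 + |y|)) :=
        mul_le_mul_of_nonneg_left (by linarith) hc
      linarith
    calc _ ≤ C₁ * (Q * (38 * (L * X)) + |y| + √Cf) := by
          have := M.scale_pos i τ
          refine mul_le_mul (hC₁ i) (by linarith) (by positivity) hC₁0.le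
      _ ≤ C₁ * ((38 * Q + 1 + √Cf) * (L * X) * (1 + |y|)) := mul_le_mul_of_nonneg_left h7 hC₁0.le
      _ = B * (1 + |y|) := by rw [hB]; ring
  · intro i w
    refine (abs_integral_lossError_le (varRatio_lt (hv i)) (hγ i) hn1 τ _ _ w).trans ?_
    have h1 := biasBound_le hε hn1 (hv i) (hγ0 i) (hγ1 i) hδ hδ'
    have h2 : M.scale i τ * M.biasBound γ n i ≤ Q * (1300 * s) := by
      refine (mul_le_mul_of_nonneg_left h1 (M.scale_pos i τ).le).trans ?_
      rw [mul_assoc]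
      exact mul_le_mul_of_nonneg_right (hS i) (by positivity)
    calc _ ≤ (M.b i + M.h i) * (Q * (1300 * s) + |w|) :=
          mul_le_mul_of_nonneg_left (by linarith) (M.weight_pos i).le
      _ ≤ C₁ * (Q * (1300 * s) + |w|) := mul_le_mul_of_nonneg_right (hC₁ i) (by positivity)
      _ = η + C₁ * |w| := by rw [hη]; ring

end Error

/-! ### The size of the grid -/

lemma card_grid_le {C₁ C₂ C₃ C₄ : ℝ} : ∃ K : ℝ, 0 ≤ K ∧ ∀ᶠ n : ℕ in atTop,
    ((grid C₁ C₂ C₃ C₄ n).card : ℝ) ≤ K * (1 + Real.log n) := by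
  -- The reciprocal mesh grows like log log n; replacing a_n and its root by 1 + log n is wasteful
  -- but sufficient against a power of n. Absolute values allow for any signs of the constants.
  refine ⟨|2 * C₁ * C₂| * (2 * stdPdf 0 + |C₃| + 2 * |C₄| + 1) + 1, by
    have := stdPdf_nonneg 0; positivity, ?_⟩
  have hlog : Tendsto (fun n : ℕ => Real.log n) atTop atTop :=
    Real.tendsto_log_atTop.comp tendsto_natCast_atTop_atTop
  filter_upwards [hlog.eventually_ge_atTop 1] with n hn
  set ℓ := Real.log n with hℓ
  have ha0 : 0 ≤ a n := Real.log_nonneg hn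
  have ha1 : a n ≤ ℓ := (Real.log_le_sub_one_of_pos (by linarith)).trans (by linarith)
  have hφ := stdPdf_nonneg 0
  have hsq : √(a n) ≤ 1 + ℓ := Real.sqrt_le_iff.2 ⟨by linarith, by nlinarith⟩
  have hsum : |2 * stdPdf 0 + C₃ + √(a n) * C₄ + a n|
      ≤ (2 * stdPdf 0 + |C₃| + 2 * |C₄| + 1) * (1 + ℓ) := by
    have h1 : |2 * stdPdf 0 + C₃ + √(a n) * C₄ + a n|
        ≤ 2 * stdPdf 0 + |C₃| + √(a n) * |C₄| + a n := by
      refine (abs_add_le _ _).trans (add_le_add ((abs_add_le _ _).trans (add_le_add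
        ((abs_add_le _ _).trans (add_le_add ?_ le_rfl)) ?_)) (abs_of_nonneg ha0).le)
      · exact (abs_of_nonneg (by positivity)).le
      · rw [abs_mul, abs_of_nonneg (Real.sqrt_nonneg _)]
    have h2 : √(a n) * |C₄| ≤ (1 + ℓ) * |C₄| := mul_le_mul_of_nonneg_right hsq (abs_nonneg _)
    have h3 := mul_nonneg (abs_nonneg C₄) (by linarith : 0 ≤ 1 + ℓ)
    have h4 := mul_nonneg (abs_nonneg C₃) (by linarith : 0 ≤ ℓ)
    have h5 := mul_nonneg hφ (by linarith : 0 ≤ ℓ)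
    linarith
  have hmesh : |1 / mesh C₁ C₂ C₃ C₄ n|
      ≤ |2 * C₁ * C₂| * ((2 * stdPdf 0 + |C₃| + 2 * |C₄| + 1) * (1 + ℓ)) := by
    rw [mesh, one_div, inv_inv, abs_mul]
    exact mul_le_mul_of_nonneg_left hsum (abs_nonneg _)
  have hcard : ((grid C₁ C₂ C₃ C₄ n).card : ℝ) ≤ |1 / mesh C₁ C₂ C₃ C₄ n| + 1 := by
    calc ((grid C₁ C₂ C₃ C₄ n).card : ℝ) ≤ (⌈1 / mesh C₁ C₂ C₃ C₄ n⌉₊ : ℝ) := by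
          exact_mod_cast Finset.card_image_le.trans (Finset.card_range _).le
      _ ≤ (⌈|1 / mesh C₁ C₂ C₃ C₄ n|⌉₊ : ℝ) := by
          exact_mod_cast Nat.ceil_mono (le_abs_self _)
      _ ≤ _ := (Nat.ceil_lt_add_one (abs_nonneg _)).le
  linarith

end Model

lemma tendsto_pow_one_add_log_mul_exp {δ : ℝ} (hδ : 0 < δ) (C : ℝ) (k : ℕ) :
    Tendsto (fun n : ℕ => C * ((1 + Real.log n) ^ k * Real.exp (-(δ * Real.log n)))) atTop
      (𝓝 0) := by
  have hlog : Tendsto (fun n : ℕ => 1 + Real.log n) atTop atTop :=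
    tendsto_atTop_add_const_left _ _ (Real.tendsto_log_atTop.comp tendsto_natCast_atTop_atTop)
  have h := ((tendsto_rpow_mul_exp_neg_mul_atTop_nhds_zero k δ hδ).comp hlog).const_mul
    (C * Real.exp δ)
  rw [mul_zero] at h
  refine h.congr fun n => ?_
  simp only [Function.comp_apply, Real.rpow_natCast]
  have : Real.exp (-(δ * Real.log n)) = Real.exp δ * Real.exp (-δ * (1 + Real.log n)) := by
    rw [← Real.exp_add]; congr 1; ring
  rw [this]; ring

end CheckLoss

/-! ### Summation over the grid -/

theorem mainTheorem11 (M : CheckLoss.Model) (θ : ℕ → ℝ) (γ : ℕ → ℝ) (C₁ C₂ C₃ C₄ : ℝ)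
    (hA1 : M.BoundedWeights) (hA2 : CheckLoss.BoundedMeans θ) (hA3 : M.SufficientData)
    (hγ : M.AdmissibleThreshold γ) (hC : M.GridConstants θ C₁ C₂ C₃ C₄) :
    Tendsto
      (fun n : ℕ => ∫⁻ x, ⨆ τ ∈ CheckLoss.grid C₁ C₂ C₃ C₄ n,
        ENNReal.ofReal |M.AREG γ n τ x - M.loss n θ (M.grandMeanRule n τ x)|
          ∂(M.pastLaw θ n))
      atTop (𝓝 0) := by
  obtain ⟨⟨r, hr, hρ⟩, ⟨Cf, hf⟩, s₀, hs₀, hσ⟩ := hA3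
  obtain ⟨⟨ε, hε, hγ0⟩, hγ1⟩ := hγ
  -- The two bounds under which the bias of a single coordinate decays like n^(-δ) up to logarithms.
  set δ := min (ε ^ 2 / 4) (2 / 5) with hδ
  have hδ0 : 0 < δ := lt_min (by positivity) (by norm_num)
  obtain ⟨C, hC0, n₀, hn₀⟩ := CheckLoss.Model.exists_lintegral_abs_AREG_sub_loss_le (θ := θ)
    hC.weights hr hρ hf hs₀ (fun i => ⟨hσ i, (hC.variances i).1⟩) hε.le hγ0 hγ1
    (min_le_left _ _) (min_le_right _ _)
  obtain ⟨K, hK0, hK⟩ := CheckLoss.Model.card_grid_le (C₁ := C₁) (C₂ := C₂) (C₃ := C₃) (C₄ := C₄)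
  -- The power 3 collects two logarithms from the error at one τ and one from the number of grid
  -- points.
  have hlim := ENNReal.tendsto_ofReal
    (CheckLoss.tendsto_pow_one_add_log_mul_exp hδ0 (K * C) 3)
  rw [ENNReal.ofReal_zero] at hlim
  refine tendsto_of_tendsto_of_tendsto_of_le_of_le' tendsto_const_nhds hlim
    (Eventually.of_forall fun _ => zero_le) ?_
  filter_upwards [hK, eventually_ge_atTop n₀] with n hKn hn
  set s := C * ((1 + Real.log n) ^ 2 * Real.exp (-(δ * Real.log n))) with hs
  have hs0 : 0 ≤ s := by positivity
  -- The terms are nonnegative, so the supremum over the finite grid is at most the sum, whose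
  -- integral can be taken term by term.
  calc _ ≤ ∫⁻ x, ∑ τ ∈ CheckLoss.grid C₁ C₂ C₃ C₄ n,
          ENNReal.ofReal |M.AREG γ n τ x - M.loss n θ (M.grandMeanRule n τ x)|
            ∂(M.pastLaw θ n) := by
        refine lintegral_mono fun x => iSup₂_le fun τ hτ => ?_
        exact Finset.single_le_sum (f := fun τ =>
          ENNReal.ofReal |M.AREG γ n τ x - M.loss n θ (M.grandMeanRule n τ x)|)
          (fun _ _ => zero_le) hτ
    _ = ∑ τ ∈ CheckLoss.grid C₁ C₂ C₃ C₄ n, ∫⁻ x,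
          ENNReal.ofReal |M.AREG γ n τ x - M.loss n θ (M.grandMeanRule n τ x)|
            ∂(M.pastLaw θ n) :=
        lintegral_finsetSum _ fun τ _ =>
          (CheckLoss.Model.measurable_AREG_sub_loss τ).abs.ennreal_ofReal
    _ ≤ ∑ _τ ∈ CheckLoss.grid C₁ C₂ C₃ C₄ n, ENNReal.ofReal s :=
        Finset.sum_le_sum fun τ _ => hn₀ n hn τ
    _ = ENNReal.ofReal ((CheckLoss.grid C₁ C₂ C₃ C₄ n).card * s) := by
        rw [Finset.sum_const, nsmul_eq_mul, ENNReal.ofReal_mul (Nat.cast_nonneg _),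
          ENNReal.ofReal_natCast]
    _ ≤ _ := by
        refine ENNReal.ofReal_le_ofReal ((mul_le_mul_of_nonneg_right hKn hs0).trans (le_of_eq ?_))
        rw [hs]; ring
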